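/- Let $(V,Y,\mathbf 1,\omega)$ be a vertex operator algebra over $\mathbb C$, let $k\ge 1$, and let $g=(1,2,\dots,k)$ act on $V^{\otimes k}$ by permuting the tensor factors. Define complex numbers $a_n$ ($n\ge1$) by $\exp\bigl(\sum_{n\ge1}-a_nx^{n+1}\tfrac{d}{dx}\bigr)x=\tfrac1k(1+x)^k-\tfrac1k$ and put $$\Delta_k(z)=\exp\Bigl(\sum_{n\ge1}a_nz^{-n/k}L(n)\Bigr)\,k^{-L(0)}\,z^{(1/k-1)L(0)} .$$ For a $k$-cycle $\sigma$ and a $V$-module $(W,Y_W)$, let $T_\sigma(W)$ denote the (Barron--Dong--Mason) $\sigma$-twisted $V^{\otimes k}$-module with underlying space $W$ whose vertex operator map is the unique one with $Y_{T_\sigma(W)}(u\otimes\mathbf 1^{\otimes(k-1)},z)=Y_W(\Delta_k(z)u,z^{1/k})$ for all $u\in V$. For a (twisted) module $(M,Y_M)$ that is the direct sum of its $L(0)$-eigenspaces $M_\lambda$, the contragredient module is $M'=\bigoplus_\lambda M_\lambda^*$ with $\langle Y_{M'}(v,z)f,w\rangle=\langle f,Y_M(e^{zL(1)}(-z^{-2})^{L(0)}v,z^{-1})w\rangle$.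 Then for every (ordinary) $V$-module $W$, the contragredient module of the $g$-twisted $V^{\otimes k}$-module $T_g(W)$ is the $g^{-1}$-twisted $V^{\otimes k}$-module attached to the contragredient module $W'$ of $W$: the two have the same underlying space $W'$ and the same vertex operator map, that is, $$T_g(W)'=T_{g^{-1}}(W').$$ -/

import Mathlib

open scoped TensorProduct

noncomputable section

/-! ### Vertex operator algebras and twisted modules -/

/-- The data of a vertex algebra with conformal vector on a complex vector space `V`:
`Y v n` is the mode `v_n`, where `Y(v, z) = ∑ₙ v_n z^(-n-1)`; `vac` is the vacuum vector and
`conf` is the conformal vector `ω`. The axioms are imposed in `VOA` below. -/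
structure VertexData (V : Type*) [AddCommGroup V] [Module ℂ V] where
  Y : V →ₗ[ℂ] (ℤ → Module.End ℂ V)
  vac : V
  conf : V

namespace VertexData

variable {V : Type*} [AddCommGroup V] [Module ℂ V]

/-- `L(n) = ω_{n+1}`. -/
def L (A : VertexData V) (n : ℤ) : Module.End ℂ V := A.Y A.conf (n + 1)

/-- The subspace of vectors of conformal weight `n`. -/
def wt (A : VertexData V) (n : ℤ) : Submodule ℂ V :=
  Module.End.eigenspace (A.L 0) (n : ℂ)

end VertexData

/-- The binomial coefficient `a (a - 1) ⋯ (a - i + 1) / i!` of a complex number `a`. -/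
def binom (a : ℂ) (i : ℕ) : ℂ := (∏ j ∈ Finset.range i, (a - j)) / (i.factorial : ℂ)

/-- Weak `g`-twisted modules, where `T` is a positive period of `g` (so `g ^ T = 1`).
A vertex operator map `Y_M(v, z) = ∑_{n ∈ (1/T)ℤ} v_n z^(-n-1)` on `M` is given by its modes:
`Y v p` is the mode `v_{p/T}`, for `p : ℤ`.
Write `V^r` for the eigenspace of `g` with eigenvalue `exp (2 π i r / T)`.

The field `jacobi` is the twisted Jacobi identity
`z₀⁻¹ δ((z₁ - z₂)/z₀) Y_M(u, z₁) Y_M(v, z₂) - z₀⁻¹ δ((z₂ - z₁)/(-z₀)) Y_M(v, z₂) Y_M(u, z₁)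
  = z₂⁻¹ ((z₁ - z₀)/z₂)^(-r/T) δ((z₁ - z₀)/z₂) Y_M(Y(u, z₀) v, z₂)` for `u ∈ V^r`, applied to `w`,
coefficient by coefficient: it compares the coefficients of `z₀^(-l-1) z₁^(-m/T-1) z₂^(-n/T-1)`.
(If `m` is not congruent to `r` modulo `T`, both coefficients vanish by `support`.)
All the sums have finitely many non-zero terms, by truncation. -/
structure IsWeakTwistedModule {V M : Type*} [AddCommGroup V] [Module ℂ V]
    [AddCommGroup M] [Module ℂ M] (A : VertexData V) (g : V →ₗ[ℂ] V) (T : ℕ)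
    (Y : V →ₗ[ℂ] (ℤ → Module.End ℂ M)) : Prop where
  /-- `Y_M(u, z)` only involves the modes `u_n` with `n ∈ r/T + ℤ`, for `u ∈ V^r`. -/
  support : ∀ (r : ℤ) (u : V), g u = Complex.exp (2 * Real.pi * Complex.I * r / T) • u →
    ∀ p : ℤ, ¬ p ≡ r [ZMOD T] → Y u p = 0
  truncation : ∀ (u : V) (w : M), ∃ N : ℤ, ∀ p : ℤ, N ≤ p → Y u p w = 0
  /-- `Y_M(𝟏, z) = Id`. -/
  vacuum : ∀ p : ℤ, Y A.vac p = if p = -(T : ℤ) then 1 else 0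
  jacobi : ∀ (r : ℤ) (u : V), g u = Complex.exp (2 * Real.pi * Complex.I * r / T) • u →
    ∀ (v : V) (w : M) (l m n : ℤ), m ≡ r [ZMOD T] →
      ∑ᶠ i : ℕ, binom ((m : ℂ) / T) i • Y (A.Y u (l + i) v) (m + n - T * i) w =
      ∑ᶠ i : ℕ, ((-1 : ℂ) ^ i * binom l i) •
        (Y u (m + T * l - T * i) (Y v (n + T * i) w) -
          (-1 : ℂ) ^ l • Y v (n + T * l - T * i) (Y u (m + T * i) w))

/-- Ordinary `g`-twisted modules: `M` is the direct sum of the eigenspaces of `L(0) = ω_1`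
(eigenspaces for distinct eigenvalues are independent, so that it is enough that they span), these
are finite-dimensional, and for each `μ` the eigenvalue `μ + n/T` does not occur for sufficiently
small integers `n`. -/
structure IsTwistedModule {V M : Type*} [AddCommGroup V] [Module ℂ V]
    [AddCommGroup M] [Module ℂ M] (A : VertexData V) (g : V →ₗ[ℂ] V) (T : ℕ)
    (Y : V →ₗ[ℂ] (ℤ → Module.End ℂ M)) : Prop extends IsWeakTwistedModule A g T Y where
  graded : ⨆ μ : ℂ, Module.End.eigenspace (Y A.conf T) μ = ⊤
  finite : ∀ μ : ℂ, FiniteDimensional ℂ (Module.End.eigenspace (Y A.conf T) μ)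
  lower_bound : ∀ μ : ℂ, ∃ N : ℤ, ∀ n : ℤ, n < N →
    Module.End.eigenspace (Y A.conf T) (μ + n / T) = ⊥

/-- Vertex operator algebras. The first field consists of truncation, `Y(𝟏, z) = Id` and the
Jacobi identity. -/
structure VOA (V : Type*) [AddCommGroup V] [Module ℂ V] extends VertexData V where
  adjoint : IsWeakTwistedModule toVertexData LinearMap.id 1 Y
  /-- `Y(v, z) 𝟏` is a power series in `z` with constant term `v`. -/
  creation : ∀ v : V, Y v (-1) vac = v ∧ ∀ n : ℤ, 0 ≤ n → Y v n vac = 0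
  /-- The Virasoro relations, for some central charge `c`. -/
  virasoro : ∃ c : ℂ, ∀ m n : ℤ,
    toVertexData.L m * toVertexData.L n - toVertexData.L n * toVertexData.L m =
      ((m : ℂ) - n) • toVertexData.L (m + n) +
        (if m + n = 0 then ((m : ℂ) ^ 3 - m) / 12 * c else 0) • (1 : Module.End ℂ V)
  /-- `Y(L(-1) v, z) = d/dz Y(v, z)`. -/
  derivative : ∀ (v : V) (n : ℤ), Y (toVertexData.L (-1) v) n = -(n : ℂ) • Y v (n - 1)
  /-- `V` is the direct sum of its weight spaces `V_n`, for `n` an integer. -/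
  graded : ⨆ n : ℤ, toVertexData.wt n = ⊤
  finite : ∀ n : ℤ, FiniteDimensional ℂ (toVertexData.wt n)
  lower_bound : ∃ N : ℤ, ∀ n : ℤ, n < N → toVertexData.wt n = ⊥

/-- `V`-modules: ordinary modules, that is, ordinary twisted modules for `g = 1`. -/
def IsVOAModule {V W : Type*} [AddCommGroup V] [Module ℂ V] [AddCommGroup W] [Module ℂ W]
    (A : VOA V) (Y : V →ₗ[ℂ] (ℤ → Module.End ℂ W)) : Prop :=
  IsTwistedModule A.toVertexData LinearMap.id 1 Y

/-! ### Contragredient modules -/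

/-- For an endomorphism `L₀` of `M`, the restricted dual `M' = ⨁_μ (M_μ)^*` with respect to the
eigenspaces `M_μ` of `L₀`, as the space of all the linear functionals on `M` that vanish on all but
finitely many of the `M_μ`. -/
def restrictedDual {M : Type*} [AddCommGroup M] [Module ℂ M] (L₀ : Module.End ℂ M) :
    Submodule ℂ (Module.Dual ℂ M) where
  carrier := {f | {μ : ℂ | ∃ w ∈ Module.End.eigenspace L₀ μ, f w ≠ 0}.Finite}
  zero_mem' := by simp
  add_mem' := by
    intro f h hf hh
    refine (hf.union hh).subset ?_
    rintro μ ⟨w, hw, hne⟩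
    by_cases h0 : f w = 0
    · exact Or.inr ⟨w, hw, fun h1 => hne (by simp [h0, h1])⟩
    · exact Or.inl ⟨w, hw, h0⟩
  smul_mem' := by
    intro c f hf
    refine hf.subset ?_
    rintro μ ⟨w, hw, hne⟩
    exact ⟨w, hw, fun h0 => hne (by simp [h0])⟩

/-- For `v` of weight `n`, the coefficient of `z^(-p/T-1)` in
`Y_M(e^(z L(1)) (-z⁻²)^(L(0)) v, z⁻¹)`. Here `(-z⁻²)^(L(0)) v = (-1)^n z^(-2n) v`, and
`L(1)^j v = 0` for large `j`. -/
def contragredientMode {V M : Type*} [AddCommGroup V] [Module ℂ V] [AddCommGroup M] [Module ℂ M]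
    (A : VertexData V) (T : ℕ) (Y : V →ₗ[ℂ] (ℤ → Module.End ℂ M)) (n : ℤ) (v : V) (p : ℤ) :
    Module.End ℂ M :=
  (-1 : ℂ) ^ n • ∑ᶠ j : ℕ, (j.factorial : ℂ)⁻¹ •
    Y ((A.L 1 ^ j) v) (-p + T * (2 * n - j - 2))

/-- `(D, Y')` is the contragredient module of the twisted module `(M, Y)`: as a space, `D` is the
restricted dual of `M` with respect to the operator `L(0)` of `M`, and
`⟨Y'(v, z) f, w⟩ = ⟨f, Y(e^(z L(1)) (-z⁻²)^(L(0)) v, z⁻¹) w⟩` for all (homogeneous) `v`. -/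
def IsContragredient {V M : Type*} [AddCommGroup V] [Module ℂ V] [AddCommGroup M] [Module ℂ M]
    (A : VertexData V) (T : ℕ) (Y : V →ₗ[ℂ] (ℤ → Module.End ℂ M))
    (D : Submodule ℂ (Module.Dual ℂ M)) (Y' : V →ₗ[ℂ] (ℤ → Module.End ℂ D)) : Prop :=
  D = restrictedDual (Y A.conf T) ∧
  ∀ (n : ℤ) (v : V), v ∈ A.wt n → ∀ (p : ℤ) (f : D) (w : M),
    (Y' v p f : Module.Dual ℂ M) w =
      (f : Module.Dual ℂ M) (contragredientMode A T Y n v p w)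

/-! ### The vertex operator algebra `V^{⊗k}` -/

section TensorPower

variable {V : Type*} [AddCommGroup V] [Module ℂ V] (A : VOA V) (k : ℕ)

/-- For `n = (n₁, …, n_k)`, the linear extension of
`u₁ ⊗ ⋯ ⊗ u_k ↦ (u₁)_{n₁} ⊗ ⋯ ⊗ (u_k)_{n_k}`. -/
def multiMode (n : Fin k → ℤ) :
    (⨂[ℂ] _ : Fin k, V) →ₗ[ℂ] Module.End ℂ (⨂[ℂ] _ : Fin k, V) :=
  PiTensorProduct.lift
    ((PiTensorProduct.mapMultilinear ℂ (fun _ : Fin k => V) (fun _ : Fin k => V)).compLinearMap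
      (fun i => (LinearMap.proj (n i)).comp A.Y))

theorem multiMode_tprod (n : Fin k → ℤ) (u v : Fin k → V) :
    multiMode A k n (PiTensorProduct.tprod ℂ u) (PiTensorProduct.tprod ℂ v) =
      PiTensorProduct.tprod ℂ (fun i => A.Y (u i) (n i) (v i)) := by
  simp [multiMode]

theorem multiMode_finite (s : ℤ) (u v : ⨂[ℂ] _ : Fin k, V) :
    (Function.support fun n : {n : Fin k → ℤ // ∑ i, (n i + 1) = s} =>
      multiMode A k n.1 u v).Finite := by
  induction u using PiTensorProduct.induction_on with
  | add x y hx hy =>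
    refine (hx.union hy).subset ?_
    intro n hn
    by_contra hc
    simp only [Set.mem_union, Function.mem_support, not_or, not_not] at hc
    exact hn (by simp [hc.1, hc.2])
  | smul_tprod r u =>
    induction v using PiTensorProduct.induction_on with
    | add x y hx hy =>
      refine (hx.union hy).subset ?_
      intro n hn
      by_contra hc
      simp only [Set.mem_union, Function.mem_support, not_or, not_not] at hc
      exact hn (by simp only [map_add, hc.1, hc.2, add_zero])
    | smul_tprod r' v =>
      choose N hN using fun i => A.adjoint.truncation (u i) (v i)
      -- Non-zero terms have `n i < N i` for all `i`; with the sum fixed, `n` is bounded below too.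
      set B : ℤ := ∑ i, |N i + 1| with hB
      refine Set.Finite.of_finite_image (f := Subtype.val) ?_ Subtype.val_injective.injOn
      refine (Set.Finite.pi' (fun i : Fin k => Set.finite_Icc (s - B - 1) (N i))).subset ?_
      rintro _ ⟨n, hn, rfl⟩ i
      have hlt : ∀ j, n.1 j < N j := by
        intro j
        by_contra hj
        apply hn
        have h0 : A.Y (u j) (n.1 j) (v j) = 0 := hN j _ (not_lt.mp hj)
        simp only [map_smul, LinearMap.smul_apply, multiMode_tprod]
        rw [MultilinearMap.map_coord_zero _ j h0]
        simp
      refine ⟨?_, (hlt i).le⟩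
      have hsum := n.2
      rw [← Finset.add_sum_erase _ _ (Finset.mem_univ i)] at hsum
      have h1 : ∑ j ∈ Finset.univ.erase i, (n.1 j + 1) ≤
          ∑ j ∈ Finset.univ.erase i, |N j + 1| :=
        Finset.sum_le_sum fun j _ => by
          have := hlt j
          have := le_abs_self (N j + 1)
          omega
      have h2 : ∑ j ∈ Finset.univ.erase i, |N j + 1| ≤ B :=
        Finset.sum_le_sum_of_subset_of_nonneg (Finset.erase_subset _ _)
          (fun _ _ _ => abs_nonneg _)
      omega

/-- The vector `u` in position `i` and the vacuum in all the other positions of `V^{⊗k}`. -/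
def inPosition (i : Fin k) (u : V) : ⨂[ℂ] _ : Fin k, V :=
  PiTensorProduct.tprod ℂ (Function.update (fun _ => A.vac) i u)

/-- The tensor power `V^{⊗k}`, with vertex operators
`Y(u₁ ⊗ ⋯ ⊗ u_k, z) = Y(u₁, z) ⊗ ⋯ ⊗ Y(u_k, z)`, vacuum `𝟏 ⊗ ⋯ ⊗ 𝟏` and conformal vector
`∑ᵢ 𝟏 ⊗ ⋯ ⊗ ω ⊗ ⋯ ⊗ 𝟏`. In modes, `(u₁ ⊗ ⋯ ⊗ u_k)_p` is the (pointwise finite) sum of the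
`(u₁)_{n₁} ⊗ ⋯ ⊗ (u_k)_{n_k}` with `∑ (nᵢ + 1) = p + 1`. -/
def tensorPower : VertexData (⨂[ℂ] _ : Fin k, V) where
  Y :=
    { toFun := fun u p =>
        { toFun := fun v =>
            ∑ᶠ n : {n : Fin k → ℤ // ∑ i, (n i + 1) = p + 1}, multiMode A k n.1 u v
          map_add' := fun v w => by
            simp only [map_add]
            exact finsum_add_distrib (multiMode_finite A k _ u v) (multiMode_finite A k _ u w)
          map_smul' := fun c v => by
            simp only [map_smul, RingHom.id_apply]
            exact (smul_finsum' c (multiMode_finite A k _ u v)).symm }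
      map_add' := fun u u' => by
        ext1 p
        apply LinearMap.ext
        intro v
        simp only [map_add, LinearMap.add_apply, LinearMap.coe_mk, AddHom.coe_mk, Pi.add_apply]
        exact finsum_add_distrib (multiMode_finite A k _ u v) (multiMode_finite A k _ u' v)
      map_smul' := fun c u => by
        ext1 p
        apply LinearMap.ext
        intro v
        simp only [map_smul, LinearMap.smul_apply, LinearMap.coe_mk, AddHom.coe_mk, Pi.smul_apply,
          RingHom.id_apply]
        exact (smul_finsum' c (multiMode_finite A k _ u v)).symm }
  vac := PiTensorProduct.tprod ℂ (fun _ => A.vac)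
  conf := ∑ i, inPosition A k i A.conf

/-- The action of a permutation `σ` on `V^{⊗k}`: it moves the `i`-th tensor factor to position
`σ i`. -/
def permAction (V : Type*) [AddCommGroup V] [Module ℂ V] {k : ℕ} (σ : Equiv.Perm (Fin k)) :
    (⨂[ℂ] _ : Fin k, V) →ₗ[ℂ] (⨂[ℂ] _ : Fin k, V) :=
  (PiTensorProduct.reindex ℂ (fun _ : Fin k => V) σ).toLinearMap

end TensorPower

/-! ### The operator `Δ_k(z)` -/

/-- The operator `∑_{n ≥ 1} (-a_n) x^(n+1) d/dx` on `ℂ⟦x⟧`, where `a_n` is `a (n - 1)`. -/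
def vectorField (a : ℕ → ℂ) (f : PowerSeries ℂ) : PowerSeries ℂ :=
  -(PowerSeries.X ^ 2 * PowerSeries.mk a) * PowerSeries.derivative ℂ f

/-- The power series `exp (∑_{n ≥ 1} (-a_n) x^(n+1) d/dx) x`. (The `j`-th power of the
operator raises the degree by at least `j`, so that only `j ≤ m` contributes to the coefficient of
`x^m`.) -/
def expVectorField (a : ℕ → ℂ) : PowerSeries ℂ :=
  PowerSeries.mk fun m => ∑ j ∈ Finset.range (m + 1),
    (j.factorial : ℂ)⁻¹ * PowerSeries.coeff m ((vectorField a)^[j] PowerSeries.X)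

/-- The power series `((1 + x)^k - 1) / k`. -/
def targetSeries (k : ℕ) : PowerSeries ℂ :=
  PowerSeries.C ((k : ℂ)⁻¹) * ((1 + PowerSeries.X) ^ k - 1)

theorem X_pow_dvd_derivative {e : ℕ} {f : PowerSeries ℂ} (h : PowerSeries.X ^ (e + 1) ∣ f) :
    PowerSeries.X ^ e ∣ PowerSeries.derivative ℂ f := by
  rw [PowerSeries.X_pow_dvd_iff] at h ⊢
  intro m hm
  rw [PowerSeries.coeff_derivative, h (m + 1) (by omega), zero_mul]

theorem X_pow_dvd_vectorField (a : ℕ → ℂ) {c : ℕ} {f : PowerSeries ℂ}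
    (h : PowerSeries.X ^ (c + 1) ∣ f) : PowerSeries.X ^ (c + 2) ∣ vectorField a f := by
  obtain ⟨q, hq⟩ := X_pow_dvd_derivative h
  exact ⟨-(PowerSeries.mk a * q), by rw [vectorField, hq]; ring⟩

theorem X_pow_dvd_iterate (a : ℕ → ℂ) (j : ℕ) :
    PowerSeries.X ^ (j + 1) ∣ (vectorField a)^[j] PowerSeries.X := by
  induction j with
  | zero => simp
  | succ j ih => rw [Function.iterate_succ_apply']; exact X_pow_dvd_vectorField a ih

theorem vectorField_sub_dvd {a b : ℕ → ℂ} {i c d e : ℕ} (hab : ∀ t < i, a t = b t)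
    {f h : PowerSeries ℂ} (hfh : PowerSeries.X ^ (d + 1) ∣ f - h)
    (hf : PowerSeries.X ^ (c + 1) ∣ f) (hc : e ≤ i + 2 + c) (hd : e ≤ d + 2) :
    PowerSeries.X ^ e ∣ vectorField a f - vectorField b h := by
  have hA : PowerSeries.X ^ i ∣ PowerSeries.mk a - PowerSeries.mk b := by
    rw [PowerSeries.X_pow_dvd_iff]
    intro m hm
    simp [hab m hm]
  obtain ⟨A, hA⟩ := hA
  obtain ⟨q, hq⟩ := X_pow_dvd_derivative hf
  obtain ⟨s, hs⟩ := X_pow_dvd_derivative hfh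
  have key : vectorField a f - vectorField b h =
      PowerSeries.X ^ (i + 2 + c) * (-(A * q)) +
        PowerSeries.X ^ (d + 2) * (-(PowerSeries.mk b * s)) := by
    rw [map_sub] at hs
    have : PowerSeries.derivative ℂ h = PowerSeries.derivative ℂ f - PowerSeries.X ^ d * s := by
      rw [← hs]; ring
    have h2 : PowerSeries.mk a = PowerSeries.mk b + PowerSeries.X ^ i * A := by rw [← hA]; ring
    rw [vectorField, vectorField, this, hq, h2]
    ring
  rw [key]
  exact dvd_add ((pow_dvd_pow _ hc).mul_right _) ((pow_dvd_pow _ hd).mul_right _)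

theorem iterate_sub_dvd {a b : ℕ → ℂ} {i : ℕ} (hab : ∀ t < i, a t = b t) (j : ℕ) :
    PowerSeries.X ^ (i + 3) ∣
      (vectorField a)^[j + 2] PowerSeries.X - (vectorField b)^[j + 2] PowerSeries.X := by
  induction j with
  | zero =>
    refine vectorField_sub_dvd (c := 1) (d := i + 1) hab ?_ (X_pow_dvd_iterate a 1)
      (by omega) (by omega)
    exact vectorField_sub_dvd (c := 0) (d := i + 1) hab (by simp) (by simp) (by omega) (by omega)
  | succ j ih =>
    rw [Function.iterate_succ_apply' _ (j + 2), Function.iterate_succ_apply' _ (j + 2)]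
    exact vectorField_sub_dvd (c := 1) (d := i + 2) hab ih
      ((pow_dvd_pow _ (by omega)).trans (X_pow_dvd_iterate a (j + 2))) (by omega) (by omega)

/-- The equation for the coefficient of `x^(i+2)`, solved for `a i`. -/
def deltaRec (k : ℕ) (a : ℕ → ℂ) (i : ℕ) : ℂ :=
  (∑ j ∈ Finset.range (i + 1), ((j + 2).factorial : ℂ)⁻¹ *
    PowerSeries.coeff (i + 2) ((vectorField a)^[j + 2] PowerSeries.X)) -
      PowerSeries.coeff (i + 2) (targetSeries k)

theorem deltaRec_congr (k : ℕ) {a b : ℕ → ℂ} {i : ℕ} (hab : ∀ t < i, a t = b t) :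
    deltaRec k a i = deltaRec k b i := by
  unfold deltaRec
  congr 1
  refine Finset.sum_congr rfl fun j _ => ?_
  have := PowerSeries.X_pow_dvd_iff.mp (iterate_sub_dvd hab j) (i + 2) (by omega)
  rw [map_sub, sub_eq_zero] at this
  rw [this]

theorem expVectorField_eq_iff (k : ℕ) [NeZero k] (a : ℕ → ℂ) :
    expVectorField a = targetSeries k ↔ ∀ i, a i = deltaRec k a i := by
  have hk : (k : ℂ) ≠ 0 := Nat.cast_ne_zero.mpr (NeZero.ne k)
  have h1 : vectorField a PowerSeries.X = -(PowerSeries.X ^ 2 * PowerSeries.mk a) := by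
    simp [vectorField]
  have h2 : ∀ i, PowerSeries.coeff (i + 2) (expVectorField a) =
      PowerSeries.coeff (i + 2) (targetSeries k) + (deltaRec k a i - a i) := by
    intro i
    rw [expVectorField, PowerSeries.coeff_mk, Finset.sum_range_succ', Finset.sum_range_succ']
    have h3 : PowerSeries.coeff (i + 2) (PowerSeries.X ^ 2 * PowerSeries.mk a) = a i := by
      rw [PowerSeries.coeff_X_pow_mul, PowerSeries.coeff_mk]
    simp [deltaRec, h1, h3, PowerSeries.coeff_X]
    ring
  constructor
  · intro h i
    have := h2 i
    rw [h] at this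
    linear_combination this
  · intro h
    ext m
    match m with
    | 0 => simp [expVectorField, targetSeries]
    | 1 =>
      have h4 : PowerSeries.coeff 1 ((1 + PowerSeries.X : PowerSeries ℂ) ^ k) = k := by
        rw [show (1 + PowerSeries.X : PowerSeries ℂ) ^ k =
          (((1 + Polynomial.X) ^ k : Polynomial ℂ) : PowerSeries ℂ) by simp,
          Polynomial.coeff_coe, Polynomial.coeff_one_add_X_pow]
        simp
      have h5 : PowerSeries.coeff 1 (PowerSeries.X ^ 2 * PowerSeries.mk a) = 0 := by
        rw [PowerSeries.coeff_X_pow_mul', if_neg (by omega)]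
      simp [expVectorField, targetSeries, Finset.sum_range_succ, h1, h4, h5, PowerSeries.coeff_one,
        PowerSeries.coeff_C_mul, inv_mul_cancel₀ hk]
    | i + 2 => rw [h2 i, ← h i, sub_self, add_zero]

/-- The numbers `a_n` with `exp (∑_{n ≥ 1} (-a_n) x^(n+1) d/dx) x = ((1 + x)^k - 1) / k` exist and
are unique. -/
theorem existsUnique_deltaSeq (k : ℕ) [NeZero k] :
    ∃! a : ℕ → ℂ, expVectorField a = targetSeries k := by
  simp only [expVectorField_eq_iff]
  let F : (i : ℕ) → (∀ t, t < i → ℂ) → ℂ := fun i r =>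
    deltaRec k (fun t => if h : t < i then r t h else 0) i
  let a : ℕ → ℂ := Nat.lt_wfRel.wf.fix F
  have ha : ∀ i, a i = deltaRec k a i := by
    intro i
    have h1 : a i = F i (fun t _ => a t) := Nat.lt_wfRel.wf.fix_eq F i
    rw [h1]
    exact deltaRec_congr k fun t ht => by simp [ht]
  refine ⟨a, ha, fun b hb => ?_⟩
  funext i
  induction i using Nat.strong_induction_on with
  | _ i ih => rw [hb i, ha i]; exact deltaRec_congr k ih

/-- The sequence `a` of the preceding theorem; `a_n` is `deltaSeq k (n - 1)`. -/
def deltaSeq (k : ℕ) [NeZero k] : ℕ → ℂ := (existsUnique_deltaSeq k).choose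

theorem deltaSeq_spec (k : ℕ) [NeZero k] : expVectorField (deltaSeq k) = targetSeries k :=
  (existsUnique_deltaSeq k).choose_spec.1

section Delta

variable {V : Type*} [AddCommGroup V] [Module ℂ V] (A : VertexData V) (k : ℕ) [NeZero k]

/-- The series `∑_{n ≥ 1} a_n L(n) y^n`, with coefficients in `End V`. -/
def deltaExponent : PowerSeries (Module.End ℂ V) :=
  PowerSeries.mk fun n => if n = 0 then 0 else deltaSeq k (n - 1) • A.L n

/-- The coefficient of `y^j` in `exp (∑_{n ≥ 1} a_n L(n) y^n)`. (The `m`-th power of the exponent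
is divisible by `y^m`.) -/
def deltaExpCoeff (j : ℕ) : Module.End ℂ V :=
  ∑ m ∈ Finset.range (j + 1),
    (m.factorial : ℂ)⁻¹ • PowerSeries.coeff j (deltaExponent A k ^ m)

/-- With `x = z^(1/k)` and for `u` of weight `n`,
`Δ_k(z) u = exp (∑_{i ≥ 1} a_i z^(-i/k) L(i)) k^(-L(0)) z^((1/k - 1) L(0)) u` is
`∑_{j ≥ 0} deltaCoeff n j u x^((1 - k) n - j)`; this is a Laurent polynomial in `x`, because
`deltaExpCoeff j` lowers weights by `j`. -/
def deltaCoeff (n : ℤ) (j : ℕ) : Module.End ℂ V :=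
  (k : ℂ) ^ (-n) • deltaExpCoeff A k j

/-- For `u` of weight `n`, the coefficient of `z^(-p/k-1)` in `Y_W(Δ_k(z) u, z^(1/k))`. -/
def deltaFieldMode {W : Type*} [AddCommGroup W] [Module ℂ W]
    (Y : V →ₗ[ℂ] (ℤ → Module.End ℂ W)) (n : ℤ) (u : V) (p : ℤ) : Module.End ℂ W :=
  ∑ᶠ j : ℕ, Y (deltaCoeff A k n j u) (p + k - 1 + (1 - k) * n - j)

end Delta

/-- `(W, Y_T)` is the twisted module `T_σ(W)` attached to the module `(W, Y_W)`, for a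
`k`-cycle `σ`: it is a (weak) `σ`-twisted `V^{⊗k}`-module on the space `W` with
`Y_T(u ⊗ 𝟏 ⊗ ⋯ ⊗ 𝟏, z) = Y_W(Δ_k(z) u, z^(1/k))` for all (homogeneous) `u`. These conditions
determine `Y_T`; it is ordinary when `(W, Y_W)` is. -/
structure IsCycleTwist {V W : Type*} [AddCommGroup V] [Module ℂ V] [AddCommGroup W] [Module ℂ W]
    (A : VOA V) (k : ℕ) [NeZero k] (σ : Equiv.Perm (Fin k))
    (YW : V →ₗ[ℂ] (ℤ → Module.End ℂ W))
    (YT : (⨂[ℂ] _ : Fin k, V) →ₗ[ℂ] (ℤ → Module.End ℂ W)) : Prop where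
  twisted : IsWeakTwistedModule (tensorPower A k) (permAction V σ) k YT
  field : ∀ (n : ℤ) (u : V), u ∈ A.wt n → ∀ p : ℤ,
    YT (inPosition A k 0 u) p = deltaFieldMode A.toVertexData k YW n u p

end

/-!
Both `T_g(W)'` and `T_{g⁻¹}(W')` live on the restricted dual of `W`, because `L(0)` of `T_g(W)` is
`L(0) / k` plus a constant. A `σ`-twisted module for a `k`-cycle `σ` is determined by its field at
`u ⊗ 𝟏 ⊗ ⋯ ⊗ 𝟏`: equivariance gives the fields at the other tensor factors, and the Jacobi identity
recovers the modes of `u_l v` from those of `u` and `v`. So the two generating fields have to agree,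
and comparing coefficients this is an identity of operators on `V`,
`exp(∑ aₙ L(n) xⁿ) exp(k x L(1)) = exp(x L(1)) exp(∑ aₙ L(n) (-x)ⁿ)`.

In the coordinate `ℓ = κ⁻¹ log (1 + κ x)` the vector field `κ⁻¹ (1 + κ x) log (1 + κ x) d/dx` is
`ℓ d/dℓ`. Let `ρ(κ)` be the series obtained from it by replacing `x^(n+1) d/dx` with `L(n) xⁿ`. The
substitution `φ(x) = ((1 + x)^k - 1) / k` which defines the `aₙ` satisfies
`k⁻¹ log (1 + k φ(x)) = log (1 + x)`, so `exp(∑ aₙ L(n) xⁿ)` conjugates `ρ(k)` to `ρ(1)`; likewise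
`-log (1 - x / (1 + x)) = log (1 + x)`, so `exp(x L(1))`, which is attached to the substitution
`x / (1 + x)`, conjugates `ρ(-1)` to `ρ(1)`. Rescaling `x`, both sides of the identity conjugate
`ρ(-k)` to `ρ(1)`. As these have constant term `L(0)`, a series that intertwines them and whose
`n`-th coefficient lowers the weight by `n` is determined by its constant term, which is `1` for
both sides.

That the contragredient of a `g`-twisted module is `g⁻¹`-twisted comes from the conjugation formula
for `exp(z L(1)) Y(v, x) exp(-z L(1))`: the operators `Y(e^(zL(1)) (-z⁻²)^L(0) v, z⁻¹)` satisfy the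
Jacobi identity with the order of products reversed, and transposition reverses it again.
-/

noncomputable section

open Finset hiding antidiagonal mem_antidiagonal mk
open Finset.HasAntidiagonal (antidiagonal mem_antidiagonal)
open PowerSeries
open Filter (atTop eventually_ge_atTop eventually_gt_atTop)

/-! ### Finite sums over pairs and triples of natural numbers -/

section Sums

variable {M : Type*} [AddCommMonoid M]

theorem sum_antidiagonal_assoc (f : ℕ → ℕ → ℕ → M) (s : ℕ) :
    ∑ p ∈ antidiagonal s, ∑ q ∈ antidiagonal p.1, f q.1 q.2 p.2 =
      ∑ p ∈ antidiagonal s, ∑ q ∈ antidiagonal p.2, f p.1 q.1 q.2 := by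
  rw [sum_sigma', sum_sigma']
  refine sum_nbij' (fun x => ⟨(x.2.1, x.2.2 + x.1.2), (x.2.2, x.1.2)⟩)
    (fun x => ⟨(x.1.1 + x.2.1, x.2.2), (x.1.1, x.2.1)⟩) ?_ ?_ ?_ ?_ ?_ <;>
    grind [mem_antidiagonal]

theorem sum_range_sum_range_eq_sum_antidiagonal {F : ℕ → ℕ → M} {N : ℕ}
    (h : ∀ i j, N ≤ i + j → F i j = 0) :
    ∑ i ∈ range N, ∑ j ∈ range N, F i j = ∑ s ∈ range N, ∑ p ∈ antidiagonal s, F p.1 p.2 := by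
  rw [← sum_product', sum_sigma']
  refine (sum_of_injOn (fun x : (_ : ℕ) × ℕ × ℕ => x.2) ?_ ?_ ?_ fun _ _ => rfl).symm
  · rintro ⟨a, x⟩ hx ⟨b, y⟩ hy (rfl : x = y)
    simp only [coe_sigma, Set.mem_sigma_iff, mem_coe, mem_antidiagonal] at hx hy
    rw [← hx.2, ← hy.2]
  · rintro ⟨a, x⟩ hx
    simp only [coe_sigma, Set.mem_sigma_iff, mem_coe, mem_antidiagonal, mem_range, coe_product,
      Set.mem_prod] at hx ⊢
    omega
  · rintro ⟨i, j⟩ _ hx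
    refine h i j (not_lt.mp fun hlt => hx ⟨⟨i + j, (i, j)⟩, ?_, rfl⟩)
    simpa using hlt

theorem sum_range_sum_range_sum_range_eq_sum_antidiagonal {F : ℕ → ℕ → ℕ → M} {N : ℕ}
    (h : ∀ i j l, N ≤ i + j + l → F i j l = 0) :
    ∑ i ∈ range N, ∑ j ∈ range N, ∑ l ∈ range N, F i j l =
      ∑ s ∈ range N, ∑ p ∈ antidiagonal s, ∑ q ∈ antidiagonal p.1, F q.1 q.2 p.2 := by
  calc
    _ = ∑ l ∈ range N, ∑ i ∈ range N, ∑ j ∈ range N, F i j l := by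
      exact (sum_congr rfl fun i _ => sum_comm).trans sum_comm
    _ = ∑ l ∈ range N, ∑ s ∈ range N, ∑ p ∈ antidiagonal s, F p.1 p.2 l :=
      sum_congr rfl fun l _ =>
        sum_range_sum_range_eq_sum_antidiagonal fun i j hij => h i j l (by omega)
    _ = _ := by
      rw [sum_comm]
      refine sum_range_sum_range_eq_sum_antidiagonal fun s l hsl => sum_eq_zero fun p hp => ?_
      exact h _ _ _ (by rwa [mem_antidiagonal.mp hp])

theorem finsum_eq_sum_range {f : ℕ → M} {N : ℕ} (h : ∀ j, N ≤ j → f j = 0) :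
    ∑ᶠ j, f j = ∑ j ∈ range N, f j :=
  finsum_eq_sum_of_support_subset f fun j hj => by
    simpa using not_le.mp (mt (h j) hj)

theorem sum_range_eq_of_le {f : ℕ → M} {N N' : ℕ} (h : ∀ j, N ≤ j → f j = 0) (hN : N ≤ N') :
    ∑ j ∈ range N', f j = ∑ j ∈ range N, f j := by
  rw [← finsum_eq_sum_range h, ← finsum_eq_sum_range fun j hj => h j (hN.trans hj)]

end Sums

/-! ### Divided powers and exponentials -/

section DividedPow

variable {R : Type*} [Ring R] [Algebra ℂ R]

/-- The divided power `x^m / m!`. -/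
def dividedPow (x : R) (m : ℕ) : R := (m.factorial : ℂ)⁻¹ • x ^ m

theorem dividedPow_zero (x : R) : dividedPow x 0 = 1 := by simp [dividedPow]

theorem succ_smul_dividedPow_succ (x : R) (m : ℕ) :
    ((m : ℂ) + 1) • dividedPow x (m + 1) = x * dividedPow x m := by
  have hm : (m : ℂ) + 1 ≠ 0 := by exact_mod_cast m.succ_ne_zero
  rw [dividedPow, dividedPow, smul_smul, Nat.factorial_succ, Nat.cast_mul, mul_inv, ← mul_assoc,
    Nat.cast_succ, mul_inv_cancel₀ hm, one_mul, mul_smul_comm, pow_succ']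

theorem dividedPow_add_of_commute {x y : R} (h : Commute x y) (m : ℕ) :
    dividedPow (x + y) m = ∑ p ∈ antidiagonal m, dividedPow x p.1 * dividedPow y p.2 := by
  rw [dividedPow, h.add_pow', smul_sum]
  refine sum_congr rfl fun p hp => ?_
  rw [dividedPow, dividedPow, smul_mul_smul_comm, ← Nat.cast_smul_eq_nsmul ℂ, smul_smul,
    ← mem_antidiagonal.mp hp, Nat.cast_add_choose]
  congr 1
  field_simp [Nat.factorial_ne_zero]

theorem dividedPow_apply_of_semiconj {M N : Type*} [AddCommGroup M] [Module ℂ M]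
    [AddCommGroup N] [Module ℂ N] {f : M →ₗ[ℂ] N} {S : Module.End ℂ M} {T : Module.End ℂ N}
    (h : ∀ x, f (S x) = T (f x)) (m : ℕ) (x : M) :
    f (dividedPow S m x) = dividedPow T m (f x) := by
  rw [dividedPow, dividedPow, LinearMap.smul_apply, LinearMap.smul_apply, map_smul,
    Module.End.pow_apply, Module.End.pow_apply, (show Function.Semiconj f S T from h).iterate_right]

/-- The Leibniz rule: on a tensor product, `B ⊗ 1` and `1 ⊗ C` commute. -/
theorem dividedPow_apply_bilinear {M N P : Type*} [AddCommGroup M] [Module ℂ M]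
    [AddCommGroup N] [Module ℂ N] [AddCommGroup P] [Module ℂ P] {μ : M →ₗ[ℂ] N →ₗ[ℂ] P}
    {A : Module.End ℂ P} {B : Module.End ℂ M} {C : Module.End ℂ N}
    (h : ∀ x y, A (μ x y) = μ (B x) y + μ x (C y)) (m : ℕ) (x : M) (y : N) :
    dividedPow A m (μ x y) =
      ∑ p ∈ antidiagonal m, μ (dividedPow B p.1 x) (dividedPow C p.2 y) := by
  have hcomm : Commute (B.rTensor N) (C.lTensor M) := by
    rw [Commute, SemiconjBy, Module.End.mul_eq_comp, Module.End.mul_eq_comp,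
      LinearMap.rTensor_comp_lTensor, LinearMap.lTensor_comp_rTensor]
  have hsemiconj : ∀ t, TensorProduct.lift μ ((B.rTensor N + C.lTensor M) t) =
      A (TensorProduct.lift μ t) := by
    intro t
    induction t with
    | zero => simp
    | tmul x y => simp [h]
    | add s t hs ht => rw [map_add, map_add, hs, ht, map_add, map_add]
  have key := dividedPow_apply_of_semiconj hsemiconj m (x ⊗ₜ[ℂ] y)
  rw [dividedPow_add_of_commute hcomm] at key
  rw [TensorProduct.lift.tmul] at key
  rw [← key, LinearMap.sum_apply, map_sum]
  refine sum_congr rfl fun p _ => ?_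
  simp only [dividedPow, LinearMap.rTensor_pow, LinearMap.lTensor_pow, Module.End.mul_apply,
    LinearMap.smul_apply, LinearMap.rTensor_tmul, LinearMap.lTensor_tmul, map_smul,
    TensorProduct.lift.tmul]

end DividedPow

section ExpEnd

variable {R S : Type*} [Ring R] [Algebra ℂ R] [Ring S] [Algebra ℂ S]

/-- The exponential `∑ Tʲ / j!` of an operator on power series that raises orders: only `j ≤ n`
contributes to the coefficient of degree `n`. -/
def expEnd (T : Module.End ℂ R⟦X⟧) : Module.End ℂ R⟦X⟧ where
  toFun f := mk fun n => ∑ j ∈ range (n + 1), coeff n (dividedPow T j f)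
  map_add' f g := by ext n; simp [sum_add_distrib]
  map_smul' c f := by ext n; simp [smul_sum]

theorem coeff_expEnd (T : Module.End ℂ R⟦X⟧) (f : R⟦X⟧) (n : ℕ) :
    coeff n (expEnd T f) = ∑ j ∈ range (n + 1), coeff n (dividedPow T j f) :=
  coeff_mk n fun n => ∑ j ∈ range (n + 1), coeff n (dividedPow T j f)

/-- The order of a series increases under `T`: the condition for `∑ Tʲ / j!` to converge. -/
def RaisesOrder (T : Module.End ℂ R⟦X⟧) : Prop := ∀ f, f.order + 1 ≤ (T f).order

theorem RaisesOrder.coeff_dividedPow_eq_zero {T : Module.End ℂ R⟦X⟧} (hT : RaisesOrder T)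
    (f : R⟦X⟧) {n j : ℕ} (h : n < j) : coeff n (dividedPow T j f) = 0 := by
  have horder : ∀ j : ℕ, (j : ℕ∞) ≤ ((T ^ j) f).order := by
    intro j
    induction j with
    | zero => simp
    | succ j ih =>
      rw [pow_succ', Module.End.mul_apply, Nat.cast_succ]
      exact (add_le_add_left ih 1).trans (hT _)
  rw [dividedPow, LinearMap.smul_apply, PowerSeries.coeff_smul, coeff_of_lt_order, smul_zero]
  exact lt_of_lt_of_le (by exact_mod_cast h) (horder j)

theorem RaisesOrder.coeff_expEnd_of_lt {T : Module.End ℂ R⟦X⟧} (hT : RaisesOrder T)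
    (f : R⟦X⟧) {n N : ℕ} (h : n < N) :
    coeff n (expEnd T f) = ∑ j ∈ range N, coeff n (dividedPow T j f) := by
  rw [coeff_expEnd]
  exact (sum_range_eq_of_le (fun j hj => hT.coeff_dividedPow_eq_zero f hj) h).symm

theorem RaisesOrder.expEnd_mul {A B C : Module.End ℂ R⟦X⟧} (hB : RaisesOrder B)
    (hC : RaisesOrder C) (h : ∀ f g, A (f * g) = B f * g + f * C g) (f g : R⟦X⟧) :
    expEnd A (f * g) = expEnd B f * expEnd C g := by
  ext n
  have hvanish : ∀ i j, n + 1 ≤ i + j → coeff n (dividedPow B i f * dividedPow C j g) = 0 := by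
    intro i j hij
    rw [coeff_mul]
    refine sum_eq_zero fun p hp => ?_
    rw [mem_antidiagonal] at hp
    obtain hi | hj : p.1 < i ∨ p.2 < j := by omega
    · rw [hB.coeff_dividedPow_eq_zero f hi, zero_mul]
    · rw [hC.coeff_dividedPow_eq_zero g hj, mul_zero]
  calc
    coeff n (expEnd A (f * g))
      = ∑ s ∈ range (n + 1), ∑ p ∈ antidiagonal s,
          coeff n (dividedPow B p.1 f * dividedPow C p.2 g) := by
        rw [coeff_expEnd]
        refine sum_congr rfl fun s _ => ?_
        rw [← map_sum]
        exact congrArg _ (dividedPow_apply_bilinear (μ := LinearMap.mul ℂ R⟦X⟧) h s f g)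
    _ = ∑ i ∈ range (n + 1), ∑ j ∈ range (n + 1),
          coeff n (dividedPow B i f * dividedPow C j g) :=
        (sum_range_sum_range_eq_sum_antidiagonal hvanish).symm
    _ = ∑ p ∈ antidiagonal n, (∑ i ∈ range (n + 1), coeff p.1 (dividedPow B i f)) *
          ∑ j ∈ range (n + 1), coeff p.2 (dividedPow C j g) := by
        simp only [coeff_mul, sum_mul_sum]
        rw [sum_comm (s := antidiagonal n)]
        exact sum_congr rfl fun i _ => sum_comm
    _ = coeff n (expEnd B f * expEnd C g) := by
        rw [coeff_mul]
        refine sum_congr rfl fun p hp => ?_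
        rw [mem_antidiagonal] at hp
        rw [hB.coeff_expEnd_of_lt f (show p.1 < n + 1 by omega),
          hC.coeff_expEnd_of_lt g (show p.2 < n + 1 by omega)]

theorem expEnd_apply_of_semiconj {φ : R⟦X⟧ →ₗ[ℂ] S⟦X⟧} {ℓ : ℕ → R →ₗ[ℂ] S}
    (hφ : ∀ n f, coeff n (φ f) = ℓ n (coeff n f)) {A : Module.End ℂ R⟦X⟧}
    {B : Module.End ℂ S⟦X⟧} (h : ∀ f, φ (A f) = B (φ f)) (f : R⟦X⟧) :
    φ (expEnd A f) = expEnd B (φ f) := by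
  ext n
  rw [hφ, coeff_expEnd, coeff_expEnd, map_sum]
  exact sum_congr rfl fun j _ => by rw [← hφ, dividedPow_apply_of_semiconj h]

theorem expEnd_apply_of_eq_zero {T : Module.End ℂ R⟦X⟧} {f : R⟦X⟧} (h : T f = 0) :
    expEnd T f = f := by
  ext n
  rw [coeff_expEnd, sum_range_succ', sum_eq_zero fun j _ => ?_, dividedPow_zero,
    Module.End.one_apply, zero_add]
  rw [dividedPow, LinearMap.smul_apply, pow_succ, Module.End.mul_apply, h, map_zero, smul_zero,
    map_zero]

theorem coeff_zero_expEnd (T : Module.End ℂ R⟦X⟧) (f : R⟦X⟧) :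
    coeff 0 (expEnd T f) = coeff 0 f := by
  simp [coeff_expEnd, dividedPow_zero]

end ExpEnd

section ExpSeries

variable {R : Type*} [Ring R] [Algebra ℂ R]

/-- The exponential of a power series without constant term. -/
def expSeries (F : R⟦X⟧) : R⟦X⟧ := expEnd (LinearMap.mulLeft ℂ F) 1

theorem coeff_expSeries (F : R⟦X⟧) (n : ℕ) :
    coeff n (expSeries F) = ∑ j ∈ range (n + 1), coeff n (dividedPow F j) := by
  simp [expSeries, coeff_expEnd, dividedPow, LinearMap.pow_mulLeft]

theorem raisesOrder_mulLeft {F : R⟦X⟧} (hF : constantCoeff F = 0) :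
    RaisesOrder (LinearMap.mulLeft ℂ F) := fun G => by
  have hF : 1 ≤ F.order := one_le_order_iff_constCoeff_eq_zero.mpr hF
  rw [add_comm]
  exact (add_le_add_left hF _).trans (le_order_mul F G)

theorem raisesOrder_commutator {F : R⟦X⟧} (hF : constantCoeff F = 0) :
    RaisesOrder (LinearMap.mulLeft ℂ F - LinearMap.mulRight ℂ F) := fun G => by
  have hF : 1 ≤ F.order := one_le_order_iff_constCoeff_eq_zero.mpr hF
  rw [LinearMap.sub_apply, LinearMap.mulLeft_apply, LinearMap.mulRight_apply, sub_eq_add_neg]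
  refine le_trans (le_min ?_ ?_) (min_order_le_order_add _ _)
  · rw [add_comm]
    exact (add_le_add_left hF _).trans (le_order_mul F G)
  · rw [order_neg]
    exact (add_le_add_right hF _).trans (le_order_mul G F)

theorem expSeries_mul {F : R⟦X⟧} (hF : constantCoeff F = 0) (G : R⟦X⟧) :
    expSeries F * G = expEnd (LinearMap.mulLeft ℂ F - LinearMap.mulRight ℂ F) G * expSeries F := by
  have hleft : expEnd (LinearMap.mulLeft ℂ F) (1 * G) = expSeries F * G := by
    rw [RaisesOrder.expEnd_mul (raisesOrder_mulLeft hF) (C := 0) (by simp [RaisesOrder])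
      (fun f g => by simp [mul_assoc]), expEnd_apply_of_eq_zero (T := 0) (by simp), expSeries]
  rw [← hleft, one_mul, ← mul_one G,
    RaisesOrder.expEnd_mul (raisesOrder_commutator hF) (raisesOrder_mulLeft hF)
      (fun f g => by simp [sub_mul, mul_assoc]), expSeries, mul_one]

end ExpSeries

/-! ### Formal vector fields -/

section VectorField

/-- The Euler derivation `x d/dx` of `ℂ⟦x⟧`. -/
def euler : Derivation ℂ ℂ⟦X⟧ ℂ⟦X⟧ := (X : ℂ⟦X⟧) • derivative ℂ

theorem euler_apply (f : ℂ⟦X⟧) : euler f = X * derivative ℂ f := rfl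

theorem euler_X : euler (X : ℂ⟦X⟧) = X := by rw [euler_apply, derivative_X, mul_one]

theorem coeff_euler (n : ℕ) (f : ℂ⟦X⟧) : coeff n (euler f) = n * coeff n f := by
  rw [euler_apply]
  cases n with
  | zero => simp
  | succ n => rw [coeff_succ_X_mul, coeff_derivative, Nat.cast_succ, mul_comm]

theorem order_le_order_euler (f : ℂ⟦X⟧) : f.order ≤ (euler f).order :=
  le_order _ _ fun n hn => by rw [coeff_euler, coeff_of_lt_order n hn, mul_zero]

/-- The bracket of the formal vector fields `P x d/dx` and `Q x d/dx`, divided by `x d/dx`, with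
the sign for which `x^(n+1) d/dx ↦ L n` respects brackets when
`[L m, L n] = (m - n) L (m + n)`. -/
def fieldBracket (P : ℂ⟦X⟧) : Module.End ℂ ℂ⟦X⟧ :=
  LinearMap.mulLeft ℂ (euler P) - LinearMap.mulLeft ℂ P ∘ₗ euler

theorem fieldBracket_apply (P Q : ℂ⟦X⟧) : fieldBracket P Q = euler P * Q - P * euler Q := rfl

/-- The vector field `-P x d/dx`, as an operator. -/
def fieldEnd (P : ℂ⟦X⟧) : Module.End ℂ ℂ⟦X⟧ := -(LinearMap.mulLeft ℂ P ∘ₗ euler)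

theorem fieldEnd_apply (P f : ℂ⟦X⟧) : fieldEnd P f = -(P * euler f) := rfl

theorem fieldEnd_mul (P f g : ℂ⟦X⟧) :
    fieldEnd P (f * g) = fieldEnd P f * g + f * fieldEnd P g := by
  simp only [fieldEnd_apply, Derivation.leibniz, smul_eq_mul]
  ring

theorem raisesOrder_fieldEnd {P : ℂ⟦X⟧} (hP : constantCoeff P = 0) :
    RaisesOrder (fieldEnd P) := fun f => by
  have hP : 1 ≤ P.order := one_le_order_iff_constCoeff_eq_zero.mpr hP
  rw [fieldEnd_apply, order_neg, add_comm]
  exact (add_le_add hP (order_le_order_euler f)).trans (le_order_mul _ _)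

theorem raisesOrder_fieldBracket {P : ℂ⟦X⟧} (hP : constantCoeff P = 0) :
    RaisesOrder (fieldBracket P) := fun Q => by
  have hP : 1 ≤ P.order := one_le_order_iff_constCoeff_eq_zero.mpr hP
  rw [fieldBracket_apply, sub_eq_add_neg, add_comm]
  refine le_trans (le_min ?_ ?_) (min_order_le_order_add _ _)
  · exact (add_le_add_left (hP.trans (order_le_order_euler P)) _).trans (le_order_mul _ _)
  · rw [order_neg]
    exact (add_le_add hP (order_le_order_euler Q)).trans (le_order_mul _ _)

variable {P : ℂ⟦X⟧}

theorem expEnd_fieldEnd_mul (hP : constantCoeff P = 0) (f g : ℂ⟦X⟧) :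
    expEnd (fieldEnd P) (f * g) = expEnd (fieldEnd P) f * expEnd (fieldEnd P) g :=
  (raisesOrder_fieldEnd hP).expEnd_mul (raisesOrder_fieldEnd hP) (fieldEnd_mul P) f g

theorem expEnd_fieldEnd_one : expEnd (fieldEnd P) 1 = 1 :=
  expEnd_apply_of_eq_zero (by rw [fieldEnd_apply, Derivation.map_one_eq_zero, mul_zero, neg_zero])

theorem expEnd_fieldEnd_mul_euler (hP : constantCoeff P = 0) (Q f : ℂ⟦X⟧) :
    expEnd (fieldEnd P) (Q * euler f) =
      expEnd (fieldBracket P) Q * euler (expEnd (fieldEnd P) f) := by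
  let V : Module.End ℂ ℂ⟦X⟧ := -(euler ∘ₗ LinearMap.mulLeft ℂ P)
  have hV_apply : ∀ f, V f = -euler (P * f) := fun _ => rfl
  have hV : RaisesOrder V := fun f => by
    rw [hV_apply, order_neg, add_comm]
    exact ((add_le_add_left (one_le_order_iff_constCoeff_eq_zero.mpr hP) _).trans
      (le_order_mul P f)).trans (order_le_order_euler _)
  have hLeibniz : ∀ Q h, fieldEnd P (Q * h) = fieldBracket P Q * h + Q * V h := fun Q h => by
    simp only [hV_apply, fieldEnd_apply, fieldBracket_apply, Derivation.leibniz, smul_eq_mul]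
    ring
  rw [RaisesOrder.expEnd_mul (raisesOrder_fieldBracket hP) hV hLeibniz]
  congr 1
  refine (expEnd_apply_of_semiconj (φ := euler.toLinearMap)
    (ℓ := fun n => (n : ℂ) • LinearMap.id) coeff_euler (fun f => ?_) f).symm
  change euler (-(P * euler f)) = -euler (P * euler f)
  rw [map_neg]

end VectorField

section LogField

/-- The series `log (1 + κ x) / (κ x)`. -/
def logQuotient (κ : ℂ) : ℂ⟦X⟧ := mk fun n => (-κ) ^ n / (n + 1)

/-- The series `Q` for which `Q x d/dx` is the vector field `κ⁻¹ (1 + κ x) log (1 + κ x) d/dx`. -/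
def logField (κ : ℂ) : ℂ⟦X⟧ := (1 + κ • X) * logQuotient κ

theorem coeff_logQuotient (κ : ℂ) (n : ℕ) : coeff n (logQuotient κ) = (-κ) ^ n / (n + 1) :=
  coeff_mk n fun n => (-κ) ^ n / ((n : ℂ) + 1)

theorem one_add_smul_X_mul_mk_neg_pow (κ : ℂ) :
    (1 + κ • X : ℂ⟦X⟧) * mk (fun n => (-κ) ^ n) = 1 := by
  ext n
  rw [add_mul, one_mul, smul_mul_assoc, map_add, PowerSeries.coeff_smul, coeff_mk, coeff_one]
  cases n with
  | zero => simp
  | succ n => simp [coeff_succ_X_mul, pow_succ, mul_comm]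

theorem one_add_smul_X_mul_derivative_X_mul_logQuotient (κ : ℂ) :
    (1 + κ • X) * derivative ℂ (X * logQuotient κ) = 1 := by
  have hderiv : derivative ℂ (X * logQuotient κ) = mk fun n => (-κ) ^ n := by
    ext n
    have hn : (n : ℂ) + 1 ≠ 0 := by exact_mod_cast n.succ_ne_zero
    rw [coeff_derivative, coeff_succ_X_mul, coeff_logQuotient, coeff_mk, div_mul_cancel₀ _ hn]
  rw [hderiv, one_add_smul_X_mul_mk_neg_pow]

theorem coeff_zero_logField (κ : ℂ) : coeff 0 (logField κ) = 1 := by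
  simp [logField, logQuotient]

variable {P φ : ℂ⟦X⟧} {κ : ℂ}

theorem expEnd_fieldEnd_one_add_smul_X (P : ℂ⟦X⟧) (κ : ℂ) :
    expEnd (fieldEnd P) (1 + κ • X) = 1 + κ • expEnd (fieldEnd P) X := by
  rw [map_add, map_smul, expEnd_fieldEnd_one]

theorem expEnd_X_mul_logQuotient (hP : constantCoeff P = 0)
    (hφ : expEnd (fieldEnd P) X = φ) (hode : (1 + X) * derivative ℂ φ = 1 + κ • φ) :
    expEnd (fieldEnd P) (X * logQuotient κ) = X * logQuotient 1 := by
  set g := expEnd (fieldEnd P) (X * logQuotient κ) with hg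
  set u := expEnd (fieldBracket P) 1
  have hφ₀ : constantCoeff φ = 0 := by
    rw [← hφ, ← coeff_zero_eq_constantCoeff_apply, coeff_zero_expEnd, coeff_zero_X]
  have hg₀ : constantCoeff g = 0 := by
    rw [← coeff_zero_eq_constantCoeff_apply, coeff_zero_expEnd, coeff_zero_X_mul]
  have hu : u ≠ 0 := fun h => by
    simpa using (congrArg (coeff 0) h).symm.trans (coeff_zero_expEnd _ _)
  have hκφ : 1 + κ • φ ≠ 0 := fun h => by simpa [hφ₀] using congrArg constantCoeff h
  have hφ_eq : φ = u * (X * derivative ℂ φ) := by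
    rw [← euler_apply, ← hφ, ← expEnd_fieldEnd_mul_euler hP, one_mul, euler_X]
  have hg_eq : φ = (1 + κ • φ) * (u * (X * derivative ℂ g)) := by
    rw [← euler_apply, hg, ← expEnd_fieldEnd_mul_euler hP, one_mul, ← hφ,
      ← expEnd_fieldEnd_one_add_smul_X, ← expEnd_fieldEnd_mul hP, euler_apply, mul_left_comm,
      one_add_smul_X_mul_derivative_X_mul_logQuotient, mul_one]
  have hg' : (1 + κ • φ) * derivative ℂ g = derivative ℂ φ :=
    mul_left_cancel₀ (mul_ne_zero hu X_ne_zero) (by linear_combination hφ_eq - hg_eq)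
  have hode_g : (1 + (1 : ℂ) • X) * derivative ℂ g = 1 :=
    mul_left_cancel₀ hκφ (by rw [one_smul]; linear_combination (1 + X) * hg' + hode)
  refine derivative.ext (mul_left_cancel₀ (a := 1 + (1 : ℂ) • X) (fun h => ?_) ?_) ?_
  · simpa using congrArg constantCoeff h
  · rw [hode_g, one_add_smul_X_mul_derivative_X_mul_logQuotient]
  · rw [hg₀, map_mul, constantCoeff_X, zero_mul]

/-- The flow `φ` of `-P x d/dx` carries `κ⁻¹ log (1 + κ x)` to `log (1 + x)`, hence the vector field
generating the scalings of the one coordinate to that of the other. -/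
theorem expEnd_fieldBracket_logField (hP : constantCoeff P = 0)
    (hφ : expEnd (fieldEnd P) X = φ)
    (hode : (1 + X) * derivative ℂ φ = 1 + κ • φ) :
    expEnd (fieldBracket P) (logField κ) = logField 1 := by
  have hφ_ne : euler φ ≠ 0 := fun h => by
    rcases mul_eq_zero.mp h with h | h
    · exact X_ne_zero h
    · have hφ₀ : constantCoeff φ = 0 := by
        rw [← hφ, ← coeff_zero_eq_constantCoeff_apply, coeff_zero_expEnd, coeff_zero_X]
      rw [show derivative ℂ φ = 0 from h, mul_zero] at hode
      simpa [hφ₀] using congrArg constantCoeff hode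
  refine mul_right_cancel₀ hφ_ne ?_
  calc
    expEnd (fieldBracket P) (logField κ) * euler φ
      = expEnd (fieldEnd P) ((1 + κ • X) * (X * logQuotient κ)) := by
        rw [← hφ, ← expEnd_fieldEnd_mul_euler hP, euler_X, logField, mul_assoc,
          mul_comm (logQuotient κ)]
    _ = (1 + κ • φ) * (X * logQuotient 1) := by
        rw [expEnd_fieldEnd_mul hP, expEnd_X_mul_logQuotient hP hφ hode,
          expEnd_fieldEnd_one_add_smul_X, hφ]
    _ = logField 1 * euler φ := by
        rw [← hode, logField, euler_apply, one_smul]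
        ring

end LogField

section DeltaFlow

theorem expVectorField_eq_expEnd (a : ℕ → ℂ) :
    expEnd (fieldEnd (X * mk a)) X = expVectorField a := by
  have hV : ⇑(fieldEnd (X * mk a)) = vectorField a := by
    funext f
    rw [fieldEnd_apply, euler_apply, vectorField]
    ring
  ext n
  rw [coeff_expEnd, expVectorField, coeff_mk]
  refine sum_congr rfl fun j _ => ?_
  rw [dividedPow, LinearMap.smul_apply, PowerSeries.coeff_smul, Module.End.pow_apply, smul_eq_mul,
    hV]

theorem targetSeries_ode (k : ℕ) [NeZero k] :
    (1 + X) * derivative ℂ (targetSeries k) = 1 + (k : ℂ) • targetSeries k := by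
  have hk : C (k : ℂ) * C (k : ℂ)⁻¹ = 1 := by
    rw [← map_mul, mul_inv_cancel₀ (Nat.cast_ne_zero.mpr (NeZero.ne k)), map_one]
  obtain ⟨m, hm⟩ := Nat.exists_eq_succ_of_ne_zero (NeZero.ne k)
  rw [smul_eq_C_mul, targetSeries, Derivation.leibniz, derivative_C, smul_zero, add_zero, map_sub,
    Derivation.leibniz_pow, map_add, derivative_X, Derivation.map_one_eq_zero]
  simp only [smul_eq_mul, nsmul_eq_mul, zero_add, sub_zero, mul_one]
  rw [hm] at hk ⊢
  rw [map_natCast] at hk ⊢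
  rw [Nat.succ_sub_one, pow_succ]
  linear_combination hk

theorem dividedPow_fieldEnd_X (j : ℕ) :
    dividedPow (fieldEnd X) j X =
      (-1 : ℂ) ^ j • X ^ (j + 1) := by
  induction j with
  | zero => simp [dividedPow_zero]
  | succ j ih =>
    have hj : (j : ℂ) + 1 ≠ 0 := by exact_mod_cast j.succ_ne_zero
    refine smul_right_injective _ hj ?_
    change ((j : ℂ) + 1) • _ = ((j : ℂ) + 1) • _
    rw [← LinearMap.smul_apply, succ_smul_dividedPow_succ, Module.End.mul_apply, ih, map_smul]
    rw [fieldEnd_apply, euler_apply, Derivation.leibniz_pow, derivative_X]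
    simp only [smul_eq_C_mul, map_pow, map_neg, map_one, map_add, map_natCast, smul_eq_mul,
      nsmul_eq_mul, Nat.cast_add, Nat.cast_one, Nat.add_sub_cancel]
    ring

theorem expEnd_fieldEnd_X : expEnd (fieldEnd X) X = X * mk fun n => (-1) ^ n := by
  ext n
  rw [coeff_expEnd]
  simp only [dividedPow_fieldEnd_X, PowerSeries.coeff_smul, coeff_X_pow]
  cases n with
  | zero => simp
  | succ n => simp [sum_range_succ _ (n + 1), coeff_succ_X_mul]

theorem expEnd_fieldEnd_X_ode :
    (1 + X) * derivative ℂ (expEnd (fieldEnd X) X) = 1 + (-1 : ℂ) • expEnd (fieldEnd X) X := by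
  have h : (1 + X : ℂ⟦X⟧) * expEnd (fieldEnd X) X = X := by
    have hgeom := one_add_smul_X_mul_mk_neg_pow 1
    rw [one_smul] at hgeom
    rw [expEnd_fieldEnd_X]
    linear_combination X * hgeom
  have h' := congrArg (derivative ℂ) h
  rw [Derivation.leibniz, map_add, derivative_X, Derivation.map_one_eq_zero, smul_eq_mul,
    smul_eq_mul] at h'
  rw [neg_one_smul]
  linear_combination h'

end DeltaFlow

/-! ### Representations of the vector fields `x^(n+1) d/dx`, `n ≥ 0` -/

section ScaleSeries

variable {R : Type*} [Ring R] [Algebra ℂ R]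

/-- The substitution `x ↦ c x` in a power series with coefficients in a noncommutative ring. -/
def scaleSeries (c : ℂ) (G : R⟦X⟧) : R⟦X⟧ := mk fun n => c ^ n • coeff n G

theorem coeff_scaleSeries (c : ℂ) (G : R⟦X⟧) (n : ℕ) :
    coeff n (scaleSeries c G) = c ^ n • coeff n G :=
  coeff_mk n fun n => c ^ n • coeff n G

theorem scaleSeries_mul (c : ℂ) (G H : R⟦X⟧) :
    scaleSeries c (G * H) = scaleSeries c G * scaleSeries c H := by
  ext n
  simp only [coeff_scaleSeries, coeff_mul, smul_sum, smul_mul_smul_comm, ← pow_add]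
  exact sum_congr rfl fun p hp => by rw [mem_antidiagonal.mp hp]

/-- The series `∑ Gₙ xⁿ` with `[h, Gₙ] = -n Gₙ`. -/
def weightSeries (h : R) : Subalgebra ℂ R⟦X⟧ where
  carrier := {G | ∀ n, h * coeff n G - coeff n G * h = -(n : ℂ) • coeff n G}
  add_mem' {G H} hG hH n := by
    rw [map_add, mul_add, add_mul, add_sub_add_comm, hG n, hH n, smul_add]
  mul_mem' {G H} hG hH n := by
    rw [coeff_mul, mul_sum, sum_mul, ← sum_sub_distrib, smul_sum]
    refine sum_congr rfl fun p hp => ?_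
    calc
      _ = (h * coeff p.1 G - coeff p.1 G * h) * coeff p.2 H +
          coeff p.1 G * (h * coeff p.2 H - coeff p.2 H * h) := by noncomm_ring
      _ = _ := by
        rw [hG p.1, hH p.2, smul_mul_assoc, mul_smul_comm, ← add_smul, ← mem_antidiagonal.mp hp]
        congr 1
        push_cast
        ring
  algebraMap_mem' c n := by
    rw [PowerSeries.algebraMap_apply, coeff_C]
    split_ifs with hn
    · rw [hn, Nat.cast_zero, neg_zero, zero_smul, Algebra.commutes, sub_self]
    · simp

variable {h : R}

theorem scaleSeries_mem_weightSeries {G : R⟦X⟧} (hG : G ∈ weightSeries h) (c : ℂ) :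
    scaleSeries c G ∈ weightSeries h := fun n => by
  rw [coeff_scaleSeries, mul_smul_comm, smul_mul_assoc, ← smul_sub, hG n, smul_comm]

theorem expSeries_mem_weightSeries {G : R⟦X⟧} (hG : G ∈ weightSeries h) :
    expSeries G ∈ weightSeries h := fun n => by
  rw [coeff_expSeries, mul_sum, sum_mul, ← sum_sub_distrib, smul_sum]
  exact sum_congr rfl fun j _ => (weightSeries h).smul_mem (pow_mem hG j) _ n

/-- Once the lower coefficients vanish, the intertwining relation in degree `n` says that `Gₙ`
commutes with `h`, while `[h, Gₙ] = -n Gₙ`. -/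
theorem eq_zero_of_mem_weightSeries_of_intertwining {G Q Q' : R⟦X⟧} (hG : G ∈ weightSeries h)
    (hG₀ : coeff 0 G = 0) (hQ : coeff 0 Q = h) (hQ' : coeff 0 Q' = h) (hGQ : G * Q = Q' * G) :
    G = 0 := by
  ext n
  rw [map_zero]
  induction n using Nat.strong_induction_on with
  | _ n ih =>
    obtain _ | n := n
    · exact hG₀
    have hcoeff := congrArg (coeff (n + 1)) hGQ
    rw [coeff_mul, coeff_mul, Nat.sum_antidiagonal_succ', Nat.sum_antidiagonal_succ, hQ, hQ',
      sum_eq_zero fun p hp => by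
        rw [ih p.1 (by have := mem_antidiagonal.mp hp; omega), zero_mul],
      sum_eq_zero fun p hp => by
        rw [ih p.2 (by have := mem_antidiagonal.mp hp; omega), mul_zero], add_zero, add_zero]
      at hcoeff
    have hweight := hG (n + 1)
    rw [hcoeff, sub_self] at hweight
    exact (smul_eq_zero.mp hweight.symm).resolve_left
      (neg_ne_zero.mpr (Nat.cast_ne_zero.mpr n.succ_ne_zero))

end ScaleSeries

section FieldSeries

variable {R : Type*} [Ring R] [Algebra ℂ R] (L : ℕ → R)

/-- The series `∑ Qₙ L(n) yⁿ` attached to the vector field `∑ Qₙ x^(n+1) d/dx`. -/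
def fieldSeries : ℂ⟦X⟧ →ₗ[ℂ] R⟦X⟧ where
  toFun Q := mk fun n => coeff n Q • L n
  map_add' P Q := by ext n; simp [add_smul]
  map_smul' c P := by ext n; simp [mul_smul]

theorem coeff_fieldSeries (Q : ℂ⟦X⟧) (n : ℕ) :
    coeff n (fieldSeries L Q) = coeff n Q • L n :=
  coeff_mk n fun n => coeff n Q • L n

theorem scaleSeries_fieldSeries_logField (c κ : ℂ) :
    scaleSeries c (fieldSeries L (logField κ)) = fieldSeries L (logField (c * κ)) := by
  have hscale : rescale c (logField κ) = logField (c * κ) := by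
    rw [logField, logField, map_mul, map_add, map_one, smul_eq_C_mul, map_mul, rescale_X,
      smul_eq_C_mul, map_mul C]
    congr 1
    · have hC : rescale c (C κ) = C κ := by
        ext n
        cases n <;> simp [coeff_rescale, coeff_C]
      rw [hC]
      ring
    · ext n
      rw [coeff_rescale, coeff_logQuotient, coeff_logQuotient]
      ring
  ext n
  rw [coeff_scaleSeries, coeff_fieldSeries, coeff_fieldSeries, ← hscale, coeff_rescale, mul_smul]

theorem expSeries_fieldSeries_X (n : ℕ) :
    coeff n (expSeries (fieldSeries L X)) = dividedPow (L 1) n := by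
  have hX : fieldSeries L X = X * C (L 1) := by
    ext n
    rw [coeff_fieldSeries, coeff_mul_C, coeff_X, coeff_X]
    split_ifs with hn
    · rw [hn, one_smul, one_mul]
    · rw [zero_smul, zero_mul]
  have hcoeff : ∀ j, coeff n (dividedPow (fieldSeries L X) j) =
      if n = j then dividedPow (L 1) j else 0 := by
    intro j
    rw [hX, dividedPow, (commute_X (C (L 1))).symm.mul_pow, ← map_pow, PowerSeries.coeff_smul,
      coeff_mul_C, coeff_X_pow, ite_mul, one_mul, zero_mul, smul_ite, smul_zero, dividedPow]
  simp only [coeff_expSeries, hcoeff, sum_ite_eq, self_mem_range_succ, if_true]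

variable {L}
variable (hL : ∀ m n, L m * L n - L n * L m = ((m : ℂ) - n) • L (m + n))
include hL

theorem fieldSeries_commutator (P Q : ℂ⟦X⟧) :
    fieldSeries L P * fieldSeries L Q - fieldSeries L Q * fieldSeries L P =
      fieldSeries L (fieldBracket P Q) := by
  ext n
  have hQP : coeff n (fieldSeries L Q * fieldSeries L P) =
      ∑ p ∈ antidiagonal n, coeff p.2 (fieldSeries L Q) * coeff p.1 (fieldSeries L P) := by
    rw [coeff_mul, ← Nat.sum_antidiagonal_swap]
    rfl
  rw [map_sub, coeff_mul, hQP, ← sum_sub_distrib, coeff_fieldSeries, fieldBracket_apply, map_sub,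
    coeff_mul, coeff_mul, ← sum_sub_distrib, sum_smul]
  refine sum_congr rfl fun p hp => ?_
  simp only [coeff_fieldSeries, coeff_euler, smul_mul_smul_comm]
  rw [mul_comm (coeff p.2 Q), ← smul_sub, hL, smul_smul, mem_antidiagonal.mp hp]
  congr 1
  ring

theorem fieldSeries_mem_weightSeries (P : ℂ⟦X⟧) : fieldSeries L P ∈ weightSeries (L 0) :=
  fun n => by
    rw [coeff_fieldSeries, mul_smul_comm, smul_mul_assoc, ← smul_sub, hL, smul_comm]
    simp

theorem expSeries_fieldSeries_mul {P : ℂ⟦X⟧} (hP : constantCoeff P = 0) (Q : ℂ⟦X⟧) :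
    expSeries (fieldSeries L P) * fieldSeries L Q =
      fieldSeries L (expEnd (fieldBracket P) Q) * expSeries (fieldSeries L P) := by
  have hρP : constantCoeff (fieldSeries L P) = 0 := by
    rw [← coeff_zero_eq_constantCoeff_apply, coeff_fieldSeries, coeff_zero_eq_constantCoeff_apply,
      hP, zero_smul]
  rw [expSeries_mul hρP, expEnd_apply_of_semiconj
    (ℓ := fun n => LinearMap.toSpanSingleton ℂ R (L n)) (fun n Q => coeff_fieldSeries L Q n)
    (B := LinearMap.mulLeft ℂ (fieldSeries L P) - LinearMap.mulRight ℂ (fieldSeries L P))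
    (fun Q => (fieldSeries_commutator hL P Q).symm)]

theorem expSeries_fieldSeries_mul_logField {P φ : ℂ⟦X⟧} {κ : ℂ} (hP : constantCoeff P = 0)
    (hφ : expEnd (fieldEnd P) X = φ) (hode : (1 + X) * derivative ℂ φ = 1 + κ • φ) :
    expSeries (fieldSeries L P) * fieldSeries L (logField κ) =
      fieldSeries L (logField 1) * expSeries (fieldSeries L P) := by
  rw [expSeries_fieldSeries_mul hL hP, expEnd_fieldBracket_logField hP hφ hode]

/-- Both sides carry the vector field of `log (1 - k x)` to that of `log (1 + x)`. -/
theorem expSeries_deltaSeq_mul_scaleSeries (k : ℕ) [NeZero k] :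
    expSeries (fieldSeries L (X * mk (deltaSeq k))) *
        scaleSeries k (expSeries (fieldSeries L X)) =
      expSeries (fieldSeries L X) *
        scaleSeries (-1) (expSeries (fieldSeries L (X * mk (deltaSeq k)))) := by
  set E := expSeries (fieldSeries L (X * mk (deltaSeq k))) with hE
  set F := expSeries (fieldSeries L X) with hF
  let ρ := fun κ => fieldSeries L (logField κ)
  have hEρ : E * ρ k = ρ 1 * E :=
    expSeries_fieldSeries_mul_logField hL (by simp) (expVectorField_eq_expEnd _)
      (by rw [deltaSeq_spec, targetSeries_ode])
  have hFρ : F * ρ (-1) = ρ 1 * F :=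
    expSeries_fieldSeries_mul_logField hL (by simp) rfl expEnd_fieldEnd_X_ode
  have hscale : ∀ {G : R⟦X⟧} {κ : ℂ} (c : ℂ), G * ρ κ = ρ 1 * G →
      scaleSeries c G * ρ (c * κ) = ρ c * scaleSeries c G := by
    intro G κ c hG
    have hGc := congrArg (scaleSeries c) hG
    rwa [scaleSeries_mul, scaleSeries_mul, scaleSeries_fieldSeries_logField,
      scaleSeries_fieldSeries_logField, mul_one] at hGc
  have hE' : scaleSeries (-1) E * ρ (-k) = ρ (-1) * scaleSeries (-1) E := by
    simpa only [neg_one_mul] using hscale (-1) hEρ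
  have hF' : scaleSeries (k : ℂ) F * ρ (-k) = ρ k * scaleSeries (k : ℂ) F := by
    simpa only [mul_neg_one] using hscale k hFρ
  have hρ₀ : ∀ κ, coeff 0 (ρ κ) = L 0 := fun κ => by
    rw [coeff_fieldSeries, coeff_zero_logField, one_smul]
  have hEmem : E ∈ weightSeries (L 0) :=
    expSeries_mem_weightSeries (fieldSeries_mem_weightSeries hL _)
  have hFmem : F ∈ weightSeries (L 0) :=
    expSeries_mem_weightSeries (fieldSeries_mem_weightSeries hL _)
  refine sub_eq_zero.mp (eq_zero_of_mem_weightSeries_of_intertwining (h := L 0)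
    (sub_mem (mul_mem hEmem (scaleSeries_mem_weightSeries hFmem _))
      (mul_mem hFmem (scaleSeries_mem_weightSeries hEmem _))) ?_ (hρ₀ (-k)) (hρ₀ 1) ?_)
  · simp only [hE, hF, map_sub, coeff_mul, coeff_scaleSeries, expSeries, coeff_zero_expEnd,
      HasAntidiagonal.antidiagonal_zero, sum_singleton, pow_zero, one_smul, sub_self]
  · rw [sub_mul, mul_sub, mul_assoc, mul_assoc, hF', hE', ← mul_assoc, ← mul_assoc, hEρ, hFρ,
      mul_assoc, mul_assoc]

end FieldSeries

/-! ### Binomial coefficients -/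

theorem binom_eq_choose (a : ℂ) (i : ℕ) : binom a i = Ring.choose a i := by
  have hprod : (descPochhammer ℤ i).smeval a = ∏ j ∈ range i, (a - j) := by
    induction i with
    | zero => simp
    | succ i ih =>
      rw [descPochhammer_succ_right, Polynomial.smeval_mul, ih, prod_range_succ,
        Polynomial.smeval_sub, Polynomial.smeval_X, Polynomial.smeval_natCast]
      simp
  rw [Ring.choose_eq_smul, binom, smul_eq_mul, div_eq_inv_mul, hprod]

theorem binom_zero_right (a : ℂ) : binom a 0 = 1 := by
  rw [binom_eq_choose, Ring.choose_zero_right]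

theorem binom_one_right (a : ℂ) : binom a 1 = a := by
  rw [binom_eq_choose, Ring.choose_one_right]

theorem binom_natCast_of_lt {m i : ℕ} (h : m < i) : binom m i = 0 := by
  rw [binom_eq_choose, Ring.choose_natCast, Nat.choose_eq_zero_of_lt h, Nat.cast_zero]

theorem succ_mul_binom_succ (a : ℂ) (i : ℕ) :
    ((i : ℂ) + 1) * binom a (i + 1) = (a - i) * binom a i := by
  have hi : (i : ℂ) + 1 ≠ 0 := Nat.cast_add_one_ne_zero i
  have hfac : (i.factorial : ℂ) ≠ 0 := Nat.cast_ne_zero.mpr i.factorial_ne_zero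
  rw [binom, binom, prod_range_succ, Nat.factorial_succ]
  push_cast
  field_simp

theorem binom_add_one (a : ℂ) (i : ℕ) : binom (a + 1) (i + 1) = binom a (i + 1) + binom a i := by
  simp only [binom_eq_choose, Ring.choose_succ_succ, add_comm]

theorem binom_add (a b : ℂ) (q : ℕ) :
    binom (a + b) q = ∑ p ∈ antidiagonal q, binom a p.1 * binom b p.2 := by
  simp only [binom_eq_choose]
  exact Ring.add_choose_eq q (Commute.all a b)

theorem binom_reflect (a : ℂ) (n : ℕ) : binom (n - 1 - a) n = (-1) ^ n * binom a n := by
  rw [binom, binom, ← mul_div_assoc, ← prod_range_reflect, ← card_range n, ← prod_const, card_range,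
    ← prod_mul_distrib]
  congr 1
  refine prod_congr rfl fun j hj => ?_
  have := mem_range.mp hj
  rw [Nat.cast_sub (by omega), Nat.cast_sub (by omega)]
  push_cast
  ring

theorem sum_neg_one_pow_mul_binom (a b : ℂ) (q : ℕ) :
    ∑ p ∈ antidiagonal q, (-1 : ℂ) ^ p.1 * binom b p.1 * binom (a - p.1) p.2 =
      binom (a - b) q := by
  have hreflect : binom (a - b) q = (-1) ^ q * binom (b + (q - 1 - a)) q := by
    rw [← binom_reflect]
    congr 1
    ring
  rw [hreflect, binom_add, mul_sum]
  refine sum_congr rfl fun p hp => ?_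
  have hq : (q : ℂ) - 1 - a = p.2 - 1 - (a - p.1) := by
    rw [← mem_antidiagonal.mp hp]
    push_cast
    ring
  have hsign : (-1 : ℂ) ^ q * (-1) ^ p.2 = (-1) ^ p.1 := by
    rw [← mem_antidiagonal.mp hp, pow_add, mul_assoc, ← mul_pow, neg_one_mul, neg_neg, one_pow,
      mul_one]
  rw [hq, binom_reflect, ← hsign]
  ring

section DividedPow

variable {M : Type*} [AddCommGroup M] [Module ℂ M] {B : Module.End ℂ M}

theorem dividedPow_apply_of_succ_smul {c : ℕ → M} (h : ∀ s, B (c s) = ((s : ℂ) + 1) • c (s + 1))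
    (s : ℕ) : dividedPow B s (c 0) = c s := by
  induction s with
  | zero => rw [dividedPow_zero, Module.End.one_apply]
  | succ s ih =>
    have hs : (s : ℂ) + 1 ≠ 0 := Nat.cast_add_one_ne_zero s
    rw [← smul_right_inj hs, ← LinearMap.smul_apply, succ_smul_dividedPow_succ,
      Module.End.mul_apply, ih, h]

theorem apply_sum_binom_smul {a : ℂ} {Z : ℕ → ℕ → M}
    (hZ : ∀ i j, B (Z i j) = ((j : ℂ) + 1) • Z i (j + 1) + (a - 2 * j - i) • Z (i + 1) j)
    (s : ℕ) :
    B (∑ r ∈ antidiagonal s, binom (a - r.2) r.1 • Z r.1 r.2) =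
      ((s : ℂ) + 1) • ∑ r ∈ antidiagonal (s + 1), binom (a - r.2) r.1 • Z r.1 r.2 := by
  have hright : ∑ r ∈ antidiagonal s, (binom (a - r.2) r.1 * ((r.2 : ℂ) + 1)) • Z r.1 (r.2 + 1) =
      ∑ r ∈ antidiagonal (s + 1), (r.2 * binom (a - r.2 + 1) r.1) • Z r.1 r.2 := by
    rw [Nat.sum_antidiagonal_succ', Nat.cast_zero, zero_mul, zero_smul, zero_add]
    refine sum_congr rfl fun r _ => ?_
    push_cast
    rw [sub_add_eq_sub_sub, sub_add_cancel, mul_comm]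
  have hleft : ∑ r ∈ antidiagonal s,
        (binom (a - r.2) r.1 * (a - 2 * r.2 - r.1)) • Z (r.1 + 1) r.2 =
      ∑ r ∈ antidiagonal (s + 1), (r.1 * binom (a - r.2) r.1 -
        r.2 * (binom (a - r.2 + 1) r.1 - binom (a - r.2) r.1)) • Z r.1 r.2 := by
    rw [Nat.sum_antidiagonal_succ]
    simp only [binom_zero_right, Nat.cast_zero, zero_mul, sub_self, mul_zero, zero_smul, zero_add]
    refine sum_congr rfl fun r _ => ?_
    rw [binom_add_one]
    push_cast
    rw [succ_mul_binom_succ]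
    congr 1
    ring
  simp only [map_sum, map_smul, hZ, smul_add, smul_smul, sum_add_distrib]
  rw [hright, hleft, ← sum_add_distrib, smul_sum]
  refine sum_congr rfl fun r hr => ?_
  have hs : (s : ℂ) + 1 = r.1 + r.2 := by exact_mod_cast (mem_antidiagonal.mp hr).symm
  rw [← add_smul, smul_smul, hs]
  congr 1
  ring

theorem dividedPow_apply_eq_sum_binom_smul {a : ℂ} {Z : ℕ → ℕ → M}
    (hZ : ∀ i j, B (Z i j) = ((j : ℂ) + 1) • Z i (j + 1) + (a - 2 * j - i) • Z (i + 1) j)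
    (s : ℕ) :
    dividedPow B s (Z 0 0) = ∑ r ∈ antidiagonal s, binom (a - r.2) r.1 • Z r.1 r.2 := by
  rw [← dividedPow_apply_of_succ_smul (apply_sum_binom_smul hZ)]
  simp [binom_zero_right]

end DividedPow

/-! ### Graded vector spaces -/

section Graded

variable {ι M N : Type*} [AddCommGroup M] [Module ℂ M] [AddCommGroup N] [Module ℂ N]

theorem exists_linearMap_of_iSup_eq_top {S : ι → Submodule ℂ M} (hS : iSupIndep S)
    (htop : ⨆ i, S i = ⊤) (φ : ∀ i, S i →ₗ[ℂ] N) :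
    ∃ Φ : M →ₗ[ℂ] N, ∀ i (x : S i), Φ x = φ i x := by
  classical
  let e := LinearEquiv.ofBijective (DirectSum.coeLinearMap S)
    ((DirectSum.isInternal_submodule_iff_iSupIndep_and_iSup_eq_top S).mpr ⟨hS, htop⟩)
  refine ⟨DirectSum.toModule ℂ ι N φ ∘ₗ e.symm.toLinearMap, fun i x => ?_⟩
  have hx : e.symm (x : M) = DirectSum.lof ℂ ι (fun i => S i) i x := by
    rw [LinearEquiv.symm_apply_eq]
    exact (DirectSum.coeLinearMap_lof S i x).symm
  rw [LinearMap.comp_apply, LinearEquiv.coe_coe, hx, DirectSum.toModule_lof]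

theorem linearMap_ext_of_iSup_eq_top {S : ι → Submodule ℂ M} (htop : ⨆ i, S i = ⊤)
    {f g : M →ₗ[ℂ] N} (h : ∀ i, ∀ x ∈ S i, f x = g x) : f = g := by
  have hle : ⨆ i, S i ≤ LinearMap.eqLocus f g := iSup_le h
  rw [htop] at hle
  exact LinearMap.ext fun x => hle Submodule.mem_top

theorem mem_iSup_inf_ker {S : ι → Submodule ℂ M} (hS : iSupIndep S) (htop : ⨆ i, S i = ⊤)
    {g : M →ₗ[ℂ] M} (hg : ∀ i, ∀ x ∈ S i, g x ∈ S i) {x : M} (hx : g x = 0) :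
    x ∈ ⨆ i, S i ⊓ LinearMap.ker g := by
  classical
  obtain ⟨y, rfl⟩ := (Submodule.mem_iSup_iff_exists_dfinsupp S x).mp (htop ▸ Submodule.mem_top)
  let z : Π₀ i, S i := DFinsupp.mapRange.linearMap (fun i => g.restrict (hg i)) y
  have hcomm : DFinsupp.lsum ℂ (fun i => (S i).subtype) ∘ₗ
      DFinsupp.mapRange.linearMap (fun i => g.restrict (hg i)) =
        g ∘ₗ DFinsupp.lsum ℂ fun i => (S i).subtype := by
    ext i x
    simp
  have hz : DFinsupp.lsum ℕ (fun i => (S i).subtype) z = g _ := LinearMap.congr_fun hcomm y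
  have hcomp : ∀ i, g (y i) = 0 := fun i => by
    have := hS.dfinsupp_lsum_injective (hz.trans (hx.trans (map_zero _).symm))
    simpa [z] using congrArg Subtype.val (DFunLike.congr_fun this i)
  rw [DFinsupp.lsum_apply_apply, DFinsupp.sumAddHom_apply]
  exact Submodule.sum_mem _ fun i _ => Submodule.mem_iSup_of_mem i ⟨(y i).2, hcomp i⟩

theorem iSup_eigenspace_eq_ker_aeval_prod (g : Module.End ℂ M) (s : Finset ℂ) :
    ⨆ ζ ∈ s, g.eigenspace ζ =
      LinearMap.ker (Polynomial.aeval g (∏ ζ ∈ s, (Polynomial.X - Polynomial.C ζ))) := by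
  induction s using Finset.induction_on with
  | empty => simp [Module.End.one_eq_id]
  | insert ζ s hζ ih =>
    have hcoprime : IsCoprime (Polynomial.X - Polynomial.C ζ)
        (∏ ξ ∈ s, (Polynomial.X - Polynomial.C ξ)) :=
      IsCoprime.prod_right fun ξ hξ =>
        Polynomial.isCoprime_X_sub_C_of_isUnit_sub
          (sub_ne_zero.mpr (ne_of_mem_of_not_mem hξ hζ).symm).isUnit
    rw [Finset.iSup_insert, ih, prod_insert hζ,
      ← Polynomial.sup_ker_aeval_eq_ker_aeval_mul_of_coprime g hcoprime, map_sub,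
      Polynomial.aeval_X, Polynomial.aeval_C, Module.End.eigenspace_def,
      Algebra.algebraMap_eq_smul_one]

theorem iSup_eigenspace_eq_top_of_pow_eq_one {g : Module.End ℂ M} {T : ℕ} (hT : 0 < T)
    (hg : g ^ T = 1) :
    ⨆ r : ℤ, g.eigenspace (Complex.exp (2 * Real.pi * Complex.I * r / T)) = ⊤ := by
  have hprim := Complex.isPrimitiveRoot_exp T hT.ne'
  have htop : ⨆ ζ ∈ Polynomial.nthRootsFinset T (1 : ℂ), g.eigenspace ζ = ⊤ := by
    rw [iSup_eigenspace_eq_ker_aeval_prod, ← Polynomial.X_pow_sub_one_eq_prod hT hprim, map_sub,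
      map_pow, Polynomial.aeval_X, map_one, hg, sub_self, LinearMap.ker_zero]
  rw [eq_top_iff, ← htop]
  refine iSup₂_le fun ζ hζ => ?_
  have : NeZero T := ⟨hT.ne'⟩
  obtain ⟨r, -, rfl⟩ :=
    hprim.eq_pow_of_pow_eq_one ((Polynomial.mem_nthRootsFinset hT _).mp hζ)
  refine le_iSup_of_le (r : ℤ) (le_of_eq ?_)
  rw [← Complex.exp_nat_mul]
  congr 2
  push_cast
  ring

theorem le_iSup_inf_eigenspace_of_pow_eq_one {g : Module.End ℂ M} {T : ℕ} (hT : 0 < T)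
    (hg : g ^ T = 1) {K : Submodule ℂ M} (hK : ∀ x ∈ K, g x ∈ K) :
    K ≤ ⨆ r : ℤ, K ⊓ g.eigenspace (Complex.exp (2 * Real.pi * Complex.I * r / T)) := by
  have hrestrict : (g.restrict hK : Module.End ℂ K) ^ T = 1 := by
    rw [Module.End.pow_restrict]
    ext x
    simp [hg]
  conv_lhs => rw [← K.map_subtype_top, ← iSup_eigenspace_eq_top_of_pow_eq_one hT hrestrict,
    Submodule.map_iSup]
  refine iSup_mono fun r => ?_
  rintro _ ⟨x, hx, rfl⟩
  exact ⟨x.2, Module.End.mem_eigenspace_iff.mpr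
    (congrArg Subtype.val (Module.End.mem_eigenspace_iff.mp hx))⟩

end Graded

/-! ### The operators `L(0)` and `L(1)` -/

namespace VertexData

section IsConformal

variable {V : Type*} [AddCommGroup V] [Module ℂ V]

/-- The part of the structure of a vertex operator algebra on which its twisted modules depend,
apart from the Jacobi identity: the product of two vertex operators only enters through the
commutators with the modes `ω_m`, for `m ≥ 0`. Unlike the Jacobi identity, these properties are
easily inherited by `V^{⊗k}`. -/
structure IsConformal (A : VertexData V) : Prop where
  truncation : ∀ u v : V, ∃ N : ℤ, ∀ p : ℤ, N ≤ p → A.Y u p v = 0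
  creation : ∀ v : V, A.Y v (-1) A.vac = v ∧ ∀ n : ℤ, 0 ≤ n → A.Y v n A.vac = 0
  derivative : ∀ (v : V) (n : ℤ), A.Y (A.L (-1) v) n = -(n : ℂ) • A.Y v (n - 1)
  commutator : ∀ (m : ℕ) (v : V) (n : ℤ) (x : V), A.Y A.conf m (A.Y v n x) =
    A.Y v n (A.Y A.conf m x) +
      ∑ i ∈ range (m + 1), binom m i • A.Y (A.Y A.conf i v) (m + n - i) x
  conf_mem : A.conf ∈ A.wt 2
  L_one_conf : A.L 1 A.conf = 0
  graded : ⨆ n : ℤ, A.wt n = ⊤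
  lower_bound : ∃ N : ℤ, ∀ n : ℤ, n < N → A.wt n = ⊥

theorem mem_wt_iff {A : VertexData V} {n : ℤ} {v : V} : v ∈ A.wt n ↔ A.L 0 v = (n : ℂ) • v :=
  Module.End.mem_eigenspace_iff

theorem eq_zero_of_wt_eq_bot {A : VertexData V} {h : ℤ} {v : V} (hv : v ∈ A.wt h)
    (hbot : A.wt h = ⊥) : v = 0 := by
  rwa [hbot, Submodule.mem_bot] at hv

theorem wt_iSupIndep (A : VertexData V) : iSupIndep A.wt :=
  (Module.End.eigenspaces_iSupIndep (A.L 0)).comp Int.cast_injective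

namespace IsConformal

variable {A : VertexData V} (hA : A.IsConformal)
include hA

theorem mode_neg_two_vac (v : V) : A.Y v (-2) A.vac = A.L (-1) v := by
  have hderiv := hA.derivative v (-1)
  rw [Int.cast_neg, Int.cast_one, neg_neg, one_smul] at hderiv
  rw [← (hA.creation (A.L (-1) v)).1, hderiv]
  rfl

theorem L_zero_mode {h : ℤ} {v : V} (hv : v ∈ A.wt h) (p : ℤ) (x : V) :
    A.L 0 (A.Y v p x) = ((h : ℂ) - p - 1) • A.Y v p x + A.Y v p (A.L 0 x) := by
  have hcomm : A.L 0 (A.Y v p x) = A.Y v p (A.L 0 x) + (A.Y (A.L (-1) v) (1 + p) x +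
      A.Y (A.L 0 v) (1 + p - 1) x) := by
    have h1 := hA.commutator 1 v p x
    simp only [sum_range_succ, sum_range_zero, zero_add, binom_zero_right, binom_one_right,
      one_smul, Nat.cast_one, Nat.cast_zero, sub_zero] at h1
    exact h1
  rw [hcomm, hA.derivative, mem_wt_iff.mp hv, map_smul, Pi.smul_apply, LinearMap.smul_apply,
    LinearMap.smul_apply, add_sub_cancel_left]
  push_cast
  module

theorem L_one_mode {h : ℤ} {v : V} (hv : v ∈ A.wt h) (p : ℤ) (x : V) :
    A.L 1 (A.Y v p x) =
      A.Y (A.L 1 v) p x + A.Y v p (A.L 1 x) + (2 * (h : ℂ) - p - 2) • A.Y v (p + 1) x := by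
  have hcomm : A.L 1 (A.Y v p x) = A.Y v p (A.L 1 x) + (A.Y (A.L (-1) v) (2 + p) x +
      (2 : ℂ) • A.Y (A.L 0 v) (2 + p - 1) x + A.Y (A.L 1 v) (2 + p - 2) x) := by
    have h2 := hA.commutator 2 v p x
    have hbinom : binom 2 2 = 1 := by norm_num [binom, prod_range_succ]
    simp only [sum_range_succ, sum_range_zero, zero_add, binom_zero_right, binom_one_right,
      hbinom, one_smul, Nat.cast_ofNat, Nat.cast_one, Nat.cast_zero, sub_zero] at h2
    exact h2
  rw [hcomm, hA.derivative, mem_wt_iff.mp hv, map_smul, Pi.smul_apply, LinearMap.smul_apply,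
    LinearMap.smul_apply, add_sub_cancel_left, show 2 + p - 1 = p + 1 by ring]
  push_cast
  module

theorem mode_mem {h h' : ℤ} {u v : V} (hu : u ∈ A.wt h) (hv : v ∈ A.wt h') (p : ℤ) :
    A.Y u p v ∈ A.wt (h + h' - p - 1) := by
  rw [mem_wt_iff, hA.L_zero_mode hu, mem_wt_iff.mp hv, map_smul]
  push_cast
  module

theorem L_mem {h : ℤ} {v : V} (hv : v ∈ A.wt h) (n : ℤ) : A.L n v ∈ A.wt (h - n) := by
  have hmem := hA.mode_mem hA.conf_mem hv (n + 1)
  rwa [show 2 + h - (n + 1) - 1 = h - n by ring] at hmem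

theorem dividedPow_L_one_mem {h : ℤ} {v : V} (hv : v ∈ A.wt h) (j : ℕ) :
    dividedPow (A.L 1) j v ∈ A.wt (h - j) := by
  refine Submodule.smul_mem _ _ ?_
  induction j with
  | zero => simpa
  | succ j ih =>
    rw [pow_succ', Module.End.mul_apply, Nat.cast_succ, ← sub_sub]
    exact hA.L_mem ih 1

theorem exists_wt_eq_bot (h : ℤ) : ∃ N : ℕ, ∀ j : ℕ, N ≤ j → A.wt (h - j) = ⊥ := by
  obtain ⟨B, hB⟩ := hA.lower_bound
  exact ⟨(h - B + 1).toNat, fun j hj => hB _ (by omega)⟩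

/-- The coefficients of `exp(t L(1)) Y(v, z) exp(-t L(1))`, for `v` of weight `h`, are found from
the action of `ad L(1)` on the modes of the vectors `L(1)^j v`. -/
theorem dividedPow_L_one_mode {h : ℤ} {v : V} (hv : v ∈ A.wt h) (p : ℤ) (s : ℕ) (x : V) :
    dividedPow (A.L 1) s (A.Y v p x) = ∑ q ∈ antidiagonal s, ∑ r ∈ antidiagonal q.1,
      binom (2 * h - p - 2 - r.2) r.1 •
        A.Y (dividedPow (A.L 1) r.2 v) (p + r.1) (dividedPow (A.L 1) q.2 x) := by
  let ad : Module.End ℂ (Module.End ℂ V) :=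
    LinearMap.mulLeft ℂ (A.L 1) - LinearMap.mulRight ℂ (A.L 1)
  have had : ∀ i j : ℕ, ad (A.Y (dividedPow (A.L 1) j v) (p + i)) =
      ((j : ℂ) + 1) • A.Y (dividedPow (A.L 1) (j + 1) v) (p + i) +
        (2 * h - p - 2 - 2 * j - i : ℂ) •
          A.Y (dividedPow (A.L 1) j v) (p + (i + 1 : ℕ)) := by
    intro i j
    ext1 y
    have hbracket := hA.L_one_mode (hA.dividedPow_L_one_mem hv j) (p + i) y
    have hsucc : A.L 1 (dividedPow (A.L 1) j v) = ((j : ℂ) + 1) • dividedPow (A.L 1) (j + 1) v := by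
      rw [← Module.End.mul_apply, ← succ_smul_dividedPow_succ, LinearMap.smul_apply]
    rw [hsucc, map_smul, Pi.smul_apply, LinearMap.smul_apply, add_assoc p] at hbracket
    simp only [ad, LinearMap.sub_apply, LinearMap.mulLeft_apply, LinearMap.mulRight_apply,
      Module.End.mul_apply, LinearMap.add_apply, LinearMap.smul_apply]
    rw [hbracket]
    push_cast
    module
  have hleibniz := dividedPow_apply_bilinear (μ := LinearMap.id (R := ℂ) (M := Module.End ℂ V))
    (A := A.L 1) (B := ad) (C := A.L 1) (fun y z => by simp [ad]) s (A.Y v p) x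
  refine hleibniz.trans (sum_congr rfl fun q _ => ?_)
  have hsum := dividedPow_apply_eq_sum_binom_smul had q.1
  rw [dividedPow_zero, Module.End.one_apply, Nat.cast_zero, add_zero] at hsum
  rw [hsum, LinearMap.id_apply, LinearMap.sum_apply]
  rfl

theorem sum_binom_dividedPow_L_one_mode {h : ℤ} {u : V} (hu : u ∈ A.wt h) (v : V) (μ : ℂ) (l : ℤ)
    (s : ℕ) :
    ∑ p ∈ antidiagonal s,
        ((-1 : ℂ) ^ p.1 * binom μ p.1) • dividedPow (A.L 1) p.2 (A.Y u (l + p.1) v) =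
      ∑ p ∈ antidiagonal s, ∑ q ∈ antidiagonal p.1, binom (2 * h - l - 2 - q.2 - μ) q.1 •
        A.Y (dividedPow (A.L 1) q.2 u) (l + q.1) (dividedPow (A.L 1) p.2 v) := by
  let term (i i' j j' : ℕ) : V :=
    ((-1 : ℂ) ^ i * binom μ i * binom (2 * h - l - 2 - j - i) i') •
      A.Y (dividedPow (A.L 1) j u) (l + (i + i' : ℕ)) (dividedPow (A.L 1) j' v)
  calc
    _ = ∑ p ∈ antidiagonal s, ∑ q ∈ antidiagonal p.2, ∑ r ∈ antidiagonal q.1,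
        term p.1 r.1 r.2 q.2 := by
      refine sum_congr rfl fun p _ => ?_
      rw [hA.dividedPow_L_one_mode hu]
      simp only [smul_sum, smul_smul, term]
      refine sum_congr rfl fun q _ => sum_congr rfl fun r _ => ?_
      push_cast
      rw [add_assoc]
      congr 3
      ring
    _ = ∑ p ∈ antidiagonal s, ∑ q ∈ antidiagonal p.1, ∑ r ∈ antidiagonal q.2,
        term q.1 r.1 r.2 p.2 :=
      (sum_antidiagonal_assoc (fun i j j' => ∑ r ∈ antidiagonal j, term i r.1 r.2 j') s).symm
    _ = ∑ p ∈ antidiagonal s, ∑ q ∈ antidiagonal p.1, ∑ r ∈ antidiagonal q.1,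
        term r.1 r.2 q.2 p.2 :=
      sum_congr rfl fun p _ => (sum_antidiagonal_assoc (fun i i' j => term i i' j p.2) p.1).symm
    _ = _ := by
      refine sum_congr rfl fun p _ => sum_congr rfl fun q _ => ?_
      rw [← sum_neg_one_pow_mul_binom, sum_smul]
      refine sum_congr rfl fun r hr => ?_
      rw [← mem_antidiagonal.mp hr]

end IsConformal

end IsConformal

end VertexData

/-! ### Commutators with the modes of the conformal vector -/

namespace IsWeakTwistedModule

variable {V M : Type*} [AddCommGroup V] [Module ℂ V] [AddCommGroup M] [Module ℂ M]
  {A : VertexData V} {g : V →ₗ[ℂ] V} {T : ℕ} {Y : V →ₗ[ℂ] (ℤ → Module.End ℂ M)}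

theorem commutator (hY : IsWeakTwistedModule A g T Y) (hT : 0 < T) {u : V} (hu : g u = u) (m : ℕ)
    (v : V) (n : ℤ) (w : M) :
    Y u (T * m) (Y v n w) = Y v n (Y u (T * m) w) +
      ∑ i ∈ range (m + 1), binom m i • Y (A.Y u i v) (T * m + n - T * i) w := by
  have hm : (((T * m : ℤ) : ℂ) / T) = m := by
    push_cast
    exact mul_div_cancel_left₀ _ (Nat.cast_ne_zero.mpr hT.ne')
  have hjacobi := hY.jacobi 0 u (by simp [hu]) v w 0 (T * m) n (by simp [Int.ModEq])
  rw [hm, finsum_eq_sum_range (N := m + 1) fun i hi => by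
      rw [binom_natCast_of_lt hi, zero_smul],
    finsum_eq_sum_range (N := 1) fun i hi => by
      rw [Int.cast_zero, ← Nat.cast_zero, binom_natCast_of_lt hi, mul_zero, zero_smul]] at hjacobi
  rw [← sub_eq_iff_eq_add']
  simpa [binom_zero_right] using hjacobi.symm

end IsWeakTwistedModule

namespace VOA

variable {V : Type*} [AddCommGroup V] [Module ℂ V] (A : VOA V)

theorem L_vac {n : ℤ} (hn : -1 ≤ n) : A.L n A.vac = 0 :=
  (A.creation A.conf).2 (n + 1) (by omega)

theorem L_neg_two_vac : A.L (-2) A.vac = A.conf :=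
  (A.creation A.conf).1

theorem exists_L_conf : ∃ c : ℂ, ∀ n : ℤ, -1 ≤ n →
    A.L n A.conf = ((n : ℂ) + 2) • A.L (n - 2) A.vac + (if n = 2 then c else 0) • A.vac := by
  obtain ⟨c, hc⟩ := A.virasoro
  refine ⟨c / 2, fun n hn => ?_⟩
  have hvac := LinearMap.congr_fun (hc n (-2)) A.vac
  simp only [LinearMap.sub_apply, Module.End.mul_apply, LinearMap.add_apply, LinearMap.smul_apply,
    Module.End.one_apply, A.L_neg_two_vac, A.L_vac hn, map_zero, sub_zero] at hvac
  rw [hvac, Int.cast_neg, Int.cast_ofNat, sub_neg_eq_add, ← sub_eq_add_neg]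
  congr 2
  by_cases h : n = 2
  · subst h
    norm_num
    ring
  · rw [if_neg h, if_neg (sub_ne_zero.mpr h)]

theorem commutator (u : V) (m : ℕ) (v : V) (n : ℤ) (w : V) :
    A.Y u m (A.Y v n w) = A.Y v n (A.Y u m w) +
      ∑ i ∈ range (m + 1), binom m i • A.Y (A.Y u i v) (m + n - i) w := by
  simpa only [Nat.cast_one, one_mul] using A.adjoint.commutator one_pos rfl m v n w

theorem isConformal : A.toVertexData.IsConformal where
  truncation := A.adjoint.truncation
  creation := A.creation
  derivative := A.derivative
  commutator := A.commutator A.conf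
  conf_mem := by
    obtain ⟨c, hc⟩ := A.exists_L_conf
    rw [VertexData.mem_wt_iff, hc 0 (by norm_num), zero_sub, A.L_neg_two_vac]
    norm_num
  L_one_conf := by
    obtain ⟨c, hc⟩ := A.exists_L_conf
    rw [hc 1 (by norm_num), A.L_vac (by norm_num)]
    norm_num
  graded := A.graded
  lower_bound := A.lower_bound

end VOA

/-! ### Weak twisted modules -/

section Twisted

variable {V M : Type*} [AddCommGroup V] [Module ℂ V] [AddCommGroup M] [Module ℂ M]

/-- `g` is a linear automorphism of period `T` which fixes the conformal vector and commutes with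
the operators `L(n)`: what is used of an automorphism by which the modules are twisted. -/
structure IsConformalAut (A : VertexData V) (g : V →ₗ[ℂ] V) (T : ℕ) : Prop where
  pos : 0 < T
  pow_eq_one : (g : Module.End ℂ V) ^ T = 1
  map_conf : g A.conf = A.conf
  map_L : ∀ (n : ℤ) (v : V), g (A.L n v) = A.L n (g v)

theorem eventually_finsum_jacobi_eq {A : VertexData V} (hA : A.IsConformal) {T : ℕ} (hT : 0 < T)
    {Y : V →ₗ[ℂ] (ℤ → Module.End ℂ M)} (hY : ∀ u w, ∃ N : ℤ, ∀ p, N ≤ p → Y u p w = 0)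
    (u v : V) (w : M) (l m n : ℤ) : ∀ᶠ N in atTop,
      ∑ᶠ i : ℕ, binom ((m : ℂ) / T) i • Y (A.Y u (l + i) v) (m + n - T * i) w =
        ∑ i ∈ range N, binom ((m : ℂ) / T) i • Y (A.Y u (l + i) v) (m + n - T * i) w ∧
      ∑ᶠ i : ℕ, ((-1 : ℂ) ^ i * binom l i) •
          (Y u (m + T * l - T * i) (Y v (n + T * i) w) -
            (-1 : ℂ) ^ l • Y v (n + T * l - T * i) (Y u (m + T * i) w)) =
        ∑ i ∈ range N, ((-1 : ℂ) ^ i * binom l i) •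
          (Y u (m + T * l - T * i) (Y v (n + T * i) w) -
            (-1 : ℂ) ^ l • Y v (n + T * l - T * i) (Y u (m + T * i) w)) := by
  obtain ⟨N₁, h₁⟩ := hA.truncation u v
  obtain ⟨N₂, h₂⟩ := hY u w
  obtain ⟨N₃, h₃⟩ := hY v w
  have hle_mul (i : ℕ) : (i : ℤ) ≤ T * i := by
    exact_mod_cast Nat.le_mul_of_pos_left i hT
  filter_upwards [eventually_ge_atTop (N₁ - l).toNat, eventually_ge_atTop (N₂ - m).toNat,
    eventually_ge_atTop (N₃ - n).toNat] with N hN₁ hN₂ hN₃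
  constructor <;> refine finsum_eq_sum_range fun i hi => ?_
  · rw [h₁ _ (by omega), map_zero, Pi.zero_apply, LinearMap.zero_apply, smul_zero]
  · have := hle_mul i
    rw [h₂ _ (by omega), h₃ _ (by omega), map_zero, map_zero, smul_zero, sub_zero, smul_zero]

namespace IsWeakTwistedModule

variable {A : VertexData V} {g : V →ₗ[ℂ] V} {T : ℕ} {Y : V →ₗ[ℂ] (ℤ → Module.End ℂ M)}
  (hY : IsWeakTwistedModule A g T Y) (hA : A.IsConformal)
include hY hA

theorem eventually_jacobi_sum (hT : 0 < T) {r : ℤ} {u : V}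
    (hu : g u = Complex.exp (2 * Real.pi * Complex.I * r / T) • u) (v : V) (w : M)
    (l m n : ℤ) (hm : m ≡ r [ZMOD T]) : ∀ᶠ N in atTop,
      ∑ i ∈ range N, binom ((m : ℂ) / T) i • Y (A.Y u (l + i) v) (m + n - T * i) w =
      ∑ i ∈ range N, ((-1 : ℂ) ^ i * binom l i) •
        (Y u (m + T * l - T * i) (Y v (n + T * i) w) -
          (-1 : ℂ) ^ l • Y v (n + T * l - T * i) (Y u (m + T * i) w)) := by
  filter_upwards [eventually_finsum_jacobi_eq hA hT hY.truncation u v w l m n] with N hN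
  rw [← hN.1, ← hN.2]
  exact hY.jacobi r u hu v w l m n hm

theorem mode_L_neg_one_of_modEq {r : ℤ} {u : V}
    (hu : g u = Complex.exp (2 * Real.pi * Complex.I * r / T) • u) {p : ℤ} (hT : 0 < T)
    (hp : p ≡ r [ZMOD T]) : Y (A.L (-1) u) p = -((p : ℂ) / T) • Y u (p - T) := by
  ext1 w
  have hjacobi := hY.jacobi r u hu A.vac w (-2) p 0 hp
  rw [finsum_eq_sum_range (N := 2) fun i hi => by
      rw [(hA.creation u).2 _ (by omega), map_zero, Pi.zero_apply, LinearMap.zero_apply,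
        smul_zero],
    finsum_eq_sum_range (N := 0) fun i _ => by
      have hTi : (0 : ℤ) ≤ T * i := by positivity
      rw [hY.vacuum, hY.vacuum, if_neg (by omega), if_neg (by omega)]
      simp] at hjacobi
  simp only [sum_range_succ, sum_range_zero, Nat.cast_zero, Nat.cast_one, binom_zero_right,
    binom_one_right, one_smul, zero_add, mul_zero, mul_one, sub_zero, add_zero,
    hA.mode_neg_two_vac, show (-2 : ℤ) + 1 = -1 by norm_num, (hA.creation u).1] at hjacobi
  rw [neg_smul, LinearMap.neg_apply, LinearMap.smul_apply]
  exact eq_neg_of_add_eq_zero_left hjacobi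

variable (hg : IsConformalAut A g T)
include hg

theorem mode_L_neg_one (v : V) (p : ℤ) :
    Y (A.L (-1) v) p = -((p : ℂ) / T) • Y v (p - T) := by
  suffices heq : (LinearMap.proj p : (ℤ → Module.End ℂ M) →ₗ[ℂ] _) ∘ₗ Y ∘ₗ A.L (-1) =
      -((p : ℂ) / T) • ((LinearMap.proj (p - T) : (ℤ → Module.End ℂ M) →ₗ[ℂ] _) ∘ₗ Y) from
    LinearMap.congr_fun heq v
  refine linearMap_ext_of_iSup_eq_top
    (iSup_eigenspace_eq_top_of_pow_eq_one hg.pos hg.pow_eq_one) fun r u hu => ?_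
  rw [Module.End.mem_eigenspace_iff] at hu
  change Y (A.L (-1) u) p = -((p : ℂ) / T) • Y u (p - T)
  by_cases hp : p ≡ r [ZMOD T]
  · exact hY.mode_L_neg_one_of_modEq hA hu hg.pos hp
  · rw [hY.support r _ (by rw [hg.map_L, hu, map_smul]) p hp,
      hY.support r u hu (p - T) (by simpa [Int.ModEq] using hp), smul_zero]

theorem L_zero_mode {h : ℤ} {v : V} (hv : v ∈ A.wt h) (p : ℤ) (w : M) :
    Y A.conf T (Y v p w) = ((h : ℂ) - p / T - 1) • Y v p w + Y v p (Y A.conf T w) := by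
  have hT : (T : ℂ) ≠ 0 := Nat.cast_ne_zero.mpr hg.pos.ne'
  have hcomm : Y A.conf T (Y v p w) = Y v p (Y A.conf T w) +
      (Y (A.L (-1) v) (T + p) w + Y (A.L 0 v) (T + p - T) w) := by
    have h1 := hY.commutator hg.pos hg.map_conf 1 v p w
    simp only [sum_range_succ, sum_range_zero, zero_add, binom_zero_right, binom_one_right,
      one_smul, Nat.cast_one, Nat.cast_zero, mul_one, mul_zero, sub_zero] at h1
    exact h1
  have hcoeff : -(((T + p : ℤ) : ℂ) / T) = -(p / T) - 1 := by
    push_cast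
    field_simp
    ring
  rw [hcomm, hY.mode_L_neg_one hA hg, VertexData.mem_wt_iff.mp hv, map_smul, Pi.smul_apply,
    LinearMap.smul_apply, LinearMap.smul_apply, add_sub_cancel_left, hcoeff]
  module

theorem mode_mem_eigenspace {h : ℤ} {v : V} (hv : v ∈ A.wt h) {p : ℤ} {μ ν : ℂ}
    (hν : ν = μ + h - p / T - 1) {w : M} (hw : w ∈ Module.End.eigenspace (Y A.conf T) μ) :
    Y v p w ∈ Module.End.eigenspace (Y A.conf T) ν := by
  rw [Module.End.mem_eigenspace_iff] at hw ⊢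
  rw [hY.L_zero_mode hA hg hv, hw, map_smul, hν]
  module

end IsWeakTwistedModule

end Twisted

/-! ### Opposite vertex operators -/

section Opposite

variable {V M : Type*} [AddCommGroup V] [Module ℂ V] [AddCommGroup M] [Module ℂ M]

theorem contragredientMode_eq_sum (A : VertexData V) (T : ℕ) (Y : V →ₗ[ℂ] (ℤ → Module.End ℂ M))
    (n p : ℤ) {v : V} {N : ℕ} (hN : ∀ j, N ≤ j → dividedPow (A.L 1) j v = 0) :
    contragredientMode A T Y n v p = (-1 : ℂ) ^ n • ∑ j ∈ range N,
      Y (dividedPow (A.L 1) j v) (-p + T * (2 * n - j - 2)) := by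
  have hterm : ∀ j : ℕ, (j.factorial : ℂ)⁻¹ • Y ((A.L 1 ^ j) v) (-p + T * (2 * n - j - 2)) =
      Y (dividedPow (A.L 1) j v) (-p + T * (2 * n - j - 2)) := by
    intro j
    rw [dividedPow, LinearMap.smul_apply, map_smul, Pi.smul_apply]
  simp only [contragredientMode, hterm]
  rw [finsum_eq_sum_range fun j hj => by rw [hN j hj, map_zero, Pi.zero_apply]]

theorem contragredientMode_of_L_one_eq_zero (A : VertexData V) (T : ℕ)
    (Y : V →ₗ[ℂ] (ℤ → Module.End ℂ M)) (n p : ℤ) {v : V} (hv : A.L 1 v = 0) :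
    contragredientMode A T Y n v p = (-1 : ℂ) ^ n • Y v (-p + T * (2 * n - 2)) := by
  rw [contragredientMode_eq_sum A T Y n p (N := 1)]
  · rw [sum_range_one, dividedPow_zero, Module.End.one_apply, Nat.cast_zero, sub_zero]
  · intro j hj
    obtain ⟨j, rfl⟩ := Nat.exists_eq_add_of_le' hj
    rw [dividedPow, LinearMap.smul_apply, pow_succ, Module.End.mul_apply, hv, map_zero, smul_zero]

theorem VertexData.IsConformal.exists_dividedPow_L_one_eq_zero {A : VertexData V}
    (hA : A.IsConformal) {h : ℤ} {v : V} (hv : v ∈ A.wt h) :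
    ∃ N, ∀ j, N ≤ j → dividedPow (A.L 1) j v = 0 := by
  obtain ⟨N, hN⟩ := hA.exists_wt_eq_bot h
  exact ⟨N, fun j hj => eq_zero_of_wt_eq_bot (hA.dividedPow_L_one_mem hv j) (hN j hj)⟩

/-- `S` is the opposite `v ↦ Y(e^(z L(1)) (-z⁻²)^(L(0)) v, z⁻¹)` of the vertex operator map `Y`:
the vertex operators of the contragredient module are the transposes of those in `S`. -/
def IsOppositeMap (A : VertexData V) (T : ℕ) (Y S : V →ₗ[ℂ] (ℤ → Module.End ℂ M)) : Prop :=
  ∀ n, ∀ v ∈ A.wt n, ∀ p, S v p = contragredientMode A T Y n v p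

theorem exists_isOppositeMap {A : VertexData V} (hA : A.IsConformal) (T : ℕ)
    (Y : V →ₗ[ℂ] (ℤ → Module.End ℂ M)) : ∃ S, IsOppositeMap A T Y S := by
  choose N hN using hA.exists_wt_eq_bot
  obtain ⟨S, hS⟩ := exists_linearMap_of_iSup_eq_top A.wt_iSupIndep hA.graded
    (fun n => (LinearMap.pi fun p : ℤ => (-1 : ℂ) ^ n • ∑ j ∈ range (N n),
      (LinearMap.proj (-p + T * (2 * n - j - 2)) : (ℤ → Module.End ℂ M) →ₗ[ℂ] _) ∘ₗ Y ∘ₗ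
        dividedPow (A.L 1) j) ∘ₗ (A.wt n).subtype)
  refine ⟨S, fun n v hv p => ?_⟩
  rw [contragredientMode_eq_sum A T Y n p fun j hj =>
    VertexData.eq_zero_of_wt_eq_bot (hA.dividedPow_L_one_mem hv j) (hN n j hj)]
  refine (congrFun (hS n ⟨v, hv⟩) p).trans ?_
  simp [LinearMap.sum_apply]

namespace IsOppositeMap

variable {A : VertexData V} {T : ℕ} {Y S : V →ₗ[ℂ] (ℤ → Module.End ℂ M)}
  (hS : IsOppositeMap A T Y S)
include hS

theorem mode_mode_eq_sum {h h' : ℤ} {u v : V} (hu : u ∈ A.wt h) (hv : v ∈ A.wt h') {N : ℕ}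
    (hNu : ∀ j, N ≤ j → dividedPow (A.L 1) j u = 0)
    (hNv : ∀ j, N ≤ j → dividedPow (A.L 1) j v = 0) (p q : ℤ) (w : M) :
    S u p (S v q w) = (-1 : ℂ) ^ (h + h') • ∑ i ∈ range N, ∑ j ∈ range N,
      Y (dividedPow (A.L 1) i u) (-p + T * (2 * h - i - 2))
        (Y (dividedPow (A.L 1) j v) (-q + T * (2 * h' - j - 2)) w) := by
  rw [hS h u hu, hS h' v hv, contragredientMode_eq_sum A T Y h p hNu,
    contragredientMode_eq_sum A T Y h' q hNv, zpow_add₀ (neg_ne_zero.mpr one_ne_zero)]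
  simp only [LinearMap.smul_apply, LinearMap.sum_apply, map_smul, map_sum, smul_sum, smul_smul]
  rw [sum_comm, mul_comm]

variable (hA : A.IsConformal)
include hA

theorem mode_mem_eigenspace {g : V →ₗ[ℂ] V} (hY : IsWeakTwistedModule A g T Y)
    (hg : IsConformalAut A g T) {n : ℤ} {v : V} (hv : v ∈ A.wt n) (p : ℤ) {μ : ℂ} {w : M}
    (hw : w ∈ Module.End.eigenspace (Y A.conf T) μ) :
    S v p w ∈ Module.End.eigenspace (Y A.conf T) (μ + (p / T - n + 1)) := by
  have hT : (T : ℂ) ≠ 0 := Nat.cast_ne_zero.mpr hg.pos.ne'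
  obtain ⟨N, hN⟩ := hA.exists_dividedPow_L_one_eq_zero hv
  rw [hS n v hv, contragredientMode_eq_sum A T Y n p hN, LinearMap.smul_apply,
    LinearMap.sum_apply]
  refine Submodule.smul_mem _ _ (Submodule.sum_mem _ fun j _ => ?_)
  refine hY.mode_mem_eigenspace hA hg (hA.dividedPow_L_one_mem hv j) ?_ hw
  push_cast
  field_simp
  ring

theorem mode_conf (p : ℤ) : S A.conf p = Y A.conf (-p + T * 2) := by
  rw [hS 2 _ hA.conf_mem, contragredientMode_of_L_one_eq_zero A T Y 2 p hA.L_one_conf,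
    even_two.neg_one_zpow, one_smul, show (2 : ℤ) * 2 - 2 = 2 by norm_num]

theorem mode_vac (p : ℤ) : S A.vac p = Y A.vac (-p + T * (-2)) := by
  have hvac : A.vac ∈ A.wt 0 := by
    rw [VertexData.mem_wt_iff, Int.cast_zero, zero_smul]
    exact (hA.creation A.conf).2 _ (by omega)
  rw [hS 0 _ hvac, contragredientMode_of_L_one_eq_zero A T Y 0 p
    ((hA.creation A.conf).2 _ (by omega)), zpow_zero, one_smul, mul_zero, zero_sub]

end IsOppositeMap

/-- The terms of a triple sum to which both sides of the Jacobi identity for opposite vertex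
operators are expanded, up to a sign: they are indexed by the `i` of the Jacobi identity of
`L(1)^j u / j!` and `L(1)^(j') v / j'!`. -/
def oppositeJacobiTerm (A : VertexData V) (T : ℕ) (Y : V →ₗ[ℂ] (ℤ → Module.End ℂ M))
    (h h' : ℤ) (u v : V) (l m n : ℤ) (w : M) (i j j' : ℕ) : M :=
  binom (2 * h - l - 2 - j - m / T) i •
    Y (A.Y (dividedPow (A.L 1) j u) (l + i) (dividedPow (A.L 1) j' v))
      (-m - n + T * (2 * h + 2 * h' - 2 * l - 4) - T * (i + j + j' : ℕ)) w

section Jacobi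

variable {A : VertexData V} (hA : A.IsConformal) {T : ℕ} {Y S : V →ₗ[ℂ] (ℤ → Module.End ℂ M)}
  {h h' : ℤ} {u v : V} (hu : u ∈ A.wt h) (hv : v ∈ A.wt h') {l : ℤ} {N : ℕ}
  (hN : ∀ j : ℕ, N ≤ j → A.wt (h + h' - l - 1 - j) = ⊥)
include hA hu hv

include hN in
theorem dividedPow_L_one_mode_eq_zero {i s : ℕ} (his : N ≤ i + s) :
    dividedPow (A.L 1) s (A.Y u (l + i) v) = 0 := by
  have hmem := hA.dividedPow_L_one_mem (hA.mode_mem hu hv (l + i)) s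
  rw [show h + h' - (l + i) - 1 - s = h + h' - l - 1 - (i + s : ℕ) by push_cast; ring] at hmem
  exact VertexData.eq_zero_of_wt_eq_bot hmem (hN _ his)

include hN in
theorem oppositeJacobiTerm_eq_zero {m n : ℤ} {w : M} {i j j' : ℕ} (hij : N ≤ i + j + j') :
    oppositeJacobiTerm A T Y h h' u v l m n w i j j' = 0 := by
  have hmem := hA.mode_mem (hA.dividedPow_L_one_mem hu j) (hA.dividedPow_L_one_mem hv j') (l + i)
  rw [show h - j + (h' - j') - (l + i) - 1 = h + h' - l - 1 - (i + j + j' : ℕ) by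
    push_cast; ring] at hmem
  rw [oppositeJacobiTerm, VertexData.eq_zero_of_wt_eq_bot hmem (hN _ hij), map_zero,
    Pi.zero_apply, LinearMap.zero_apply, smul_zero]

omit hv in
theorem sum_oppositeJacobiTerm_antidiagonal (m n : ℤ) (w : M) (s : ℕ) :
    ∑ p ∈ antidiagonal s, ∑ q ∈ antidiagonal p.1,
        oppositeJacobiTerm A T Y h h' u v l m n w q.1 q.2 p.2 =
      ∑ p ∈ antidiagonal s, ((-1 : ℂ) ^ p.1 * binom ((m : ℂ) / T) p.1) •
        Y (dividedPow (A.L 1) p.2 (A.Y u (l + p.1) v))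
          (-m - n + T * (2 * h + 2 * h' - 2 * l - 4) - T * s) w := by
  have hbinom := congrArg
    (fun x => Y x (-m - n + T * (2 * h + 2 * h' - 2 * l - 4) - T * s) w)
    (hA.sum_binom_dividedPow_L_one_mode hu v ((m : ℂ) / T) l s)
  simp only [map_sum, Finset.sum_apply, LinearMap.sum_apply, map_smul, Pi.smul_apply,
    LinearMap.smul_apply] at hbinom
  rw [hbinom]
  refine sum_congr rfl fun p hp => sum_congr rfl fun q hq => ?_
  rw [oppositeJacobiTerm, mem_antidiagonal.mp hq, mem_antidiagonal.mp hp]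

namespace IsOppositeMap

variable (hS : IsOppositeMap A T Y S)
include hS hN

theorem mode_mode (m n : ℤ) (w : M) (i : ℕ) : S (A.Y u (l + i) v) (m + n - T * i) w =
    ((-1 : ℂ) ^ (h + h' - l - 1) * (-1) ^ i) • ∑ s ∈ range N,
      Y (dividedPow (A.L 1) s (A.Y u (l + i) v))
        (-m - n + T * (2 * h + 2 * h' - 2 * l - 4) - T * (i + s : ℕ)) w := by
  have hsign : (-1 : ℂ) ^ (h + h' - (l + i) - 1) = (-1) ^ (h + h' - l - 1) * (-1) ^ i := by
    rw [← zpow_natCast, ← zpow_add₀ (neg_ne_zero.mpr one_ne_zero),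
      show h + h' - (l + i) - 1 = h + h' - l - 1 + i - 2 * i by ring,
      zpow_sub₀ (neg_ne_zero.mpr one_ne_zero), (even_two_mul _).neg_one_zpow, div_one]
  rw [hS _ _ (hA.mode_mem hu hv (l + i)), contragredientMode_eq_sum A T Y _ _ (N := N) fun s hs =>
      dividedPow_L_one_mode_eq_zero hA hu hv hN (by omega),
    hsign, LinearMap.smul_apply, LinearMap.sum_apply]
  have hindex (s : ℕ) : -(m + n - T * i) + T * (2 * (h + h' - (l + i) - 1) - s - 2) =
      -m - n + T * (2 * h + 2 * h' - 2 * l - 4) - T * (i + s : ℕ) := by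
    push_cast
    ring
  simp only [hindex]

theorem sum_binom_smul_mode (m n : ℤ) (w : M) :
    ∑ i ∈ range N, binom ((m : ℂ) / T) i • S (A.Y u (l + i) v) (m + n - T * i) w =
      (-1 : ℂ) ^ (h + h' - l - 1) • ∑ i ∈ range N, ∑ j ∈ range N, ∑ j' ∈ range N,
        oppositeJacobiTerm A T Y h h' u v l m n w i j j' := by
  have hexpand (i : ℕ) : binom ((m : ℂ) / T) i • S (A.Y u (l + i) v) (m + n - T * i) w =
      (-1 : ℂ) ^ (h + h' - l - 1) • ∑ s ∈ range N, ((-1 : ℂ) ^ i * binom ((m : ℂ) / T) i) •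
        Y (dividedPow (A.L 1) s (A.Y u (l + i) v))
          (-m - n + T * (2 * h + 2 * h' - 2 * l - 4) - T * (i + s : ℕ)) w := by
    rw [hS.mode_mode hA hu hv hN, ← smul_sum]
    module
  rw [sum_congr rfl fun i _ => hexpand i, ← smul_sum,
    sum_range_sum_range_sum_range_eq_sum_antidiagonal fun i j j' =>
      oppositeJacobiTerm_eq_zero hA hu hv hN,
    sum_range_sum_range_eq_sum_antidiagonal fun i s his => by
      rw [dividedPow_L_one_mode_eq_zero hA hu hv hN his, map_zero, Pi.zero_apply,
        LinearMap.zero_apply, smul_zero]]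
  congr 1
  refine sum_congr rfl fun s _ => ?_
  rw [sum_oppositeJacobiTerm_antidiagonal hA hu]
  exact sum_congr rfl fun p hp => by rw [mem_antidiagonal.mp hp]

end IsOppositeMap

end Jacobi

end Opposite

section OppositeJacobi

variable {V M : Type*} [AddCommGroup V] [Module ℂ V] [AddCommGroup M] [Module ℂ M]
  {A : VertexData V} (hA : A.IsConformal) {g : V →ₗ[ℂ] V} {T : ℕ}
  {Y S : V →ₗ[ℂ] (ℤ → Module.End ℂ M)} (hY : IsWeakTwistedModule A g T Y)
  (hg : IsConformalAut A g T) (hS : IsOppositeMap A T Y S)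

theorem IsConformalAut.map_dividedPow_L_one (hg : IsConformalAut A g T) (j : ℕ) (v : V) :
    g (dividedPow (A.L 1) j v) = dividedPow (A.L 1) j (g v) :=
  dividedPow_apply_of_semiconj (hg.map_L 1) j v

include hA hY hg in
theorem eventually_sum_oppositeJacobiTerm_eq {r : ℤ} {u : V}
    (hu : g u = Complex.exp (2 * Real.pi * Complex.I * (-r : ℤ) / T) • u) (h h' : ℤ) (v : V)
    (l m n : ℤ) (hm : m ≡ r [ZMOD T]) (w : M) (j j' : ℕ) : ∀ᶠ N in atTop,
      ∑ i ∈ range N, oppositeJacobiTerm A T Y h h' u v l m n w i j j' =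
      ∑ i ∈ range N, ((-1 : ℂ) ^ i * binom l i) •
        (Y (dividedPow (A.L 1) j u) (-(m + T * i) + T * (2 * h - j - 2))
            (Y (dividedPow (A.L 1) j' v) (-(n + T * l - T * i) + T * (2 * h' - j' - 2)) w) -
          (-1 : ℂ) ^ l • Y (dividedPow (A.L 1) j' v) (-(n + T * i) + T * (2 * h' - j' - 2))
            (Y (dividedPow (A.L 1) j u) (-(m + T * l - T * i) + T * (2 * h - j - 2)) w)) := by
  have hT : (T : ℂ) ≠ 0 := Nat.cast_ne_zero.mpr hg.pos.ne'
  have hgu : g (dividedPow (A.L 1) j u) =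
      Complex.exp (2 * Real.pi * Complex.I * (-r : ℤ) / T) • dividedPow (A.L 1) j u := by
    rw [hg.map_dividedPow_L_one, hu, map_smul]
  have hmod : -(m + T * l) + T * (2 * h - j - 2) ≡ -r [ZMOD T] :=
    Int.ModEq.trans (Int.modEq_iff_dvd.mpr ⟨l - (2 * h - j - 2), by ring⟩) hm.neg
  filter_upwards [hY.eventually_jacobi_sum hA hg.pos hgu (dividedPow (A.L 1) j' v) w l
    (-(m + T * l) + T * (2 * h - j - 2)) (-(n + T * l) + T * (2 * h' - j' - 2)) hmod] with N hN
  have hbinom (i : ℕ) : oppositeJacobiTerm A T Y h h' u v l m n w i j j' =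
      binom (((-(m + T * l) + T * (2 * h - j - 2) : ℤ) : ℂ) / T) i •
        Y (A.Y (dividedPow (A.L 1) j u) (l + i) (dividedPow (A.L 1) j' v))
          (-(m + T * l) + T * (2 * h - j - 2) + (-(n + T * l) + T * (2 * h' - j' - 2)) - T * i)
          w := by
    rw [oppositeJacobiTerm]
    congr 2
    · push_cast
      field_simp
      ring
    · exact congrArg (Y _) (by push_cast; ring)
  simp only [hbinom, hN]
  refine sum_congr rfl fun i _ => ?_
  congr 3 <;> ring_nf

namespace IsOppositeMap

variable {h h' : ℤ} {u v : V} (hu : u ∈ A.wt h) (hv : v ∈ A.wt h')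
include hS hu hv

theorem mode_mode_sub_mode_mode {N : ℕ} (hNu : ∀ j, N ≤ j → dividedPow (A.L 1) j u = 0)
    (hNv : ∀ j, N ≤ j → dividedPow (A.L 1) j v = 0) (l p p' q q' : ℤ) (w : M) :
    S v q (S u p w) - (-1 : ℂ) ^ l • S u p' (S v q' w) =
      (-1 : ℂ) ^ (h + h' - l - 1) • ∑ j ∈ range N, ∑ j' ∈ range N,
        (Y (dividedPow (A.L 1) j u) (-p' + T * (2 * h - j - 2))
            (Y (dividedPow (A.L 1) j' v) (-q' + T * (2 * h' - j' - 2)) w) -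
          (-1 : ℂ) ^ l • Y (dividedPow (A.L 1) j' v) (-q + T * (2 * h' - j' - 2))
            (Y (dividedPow (A.L 1) j u) (-p + T * (2 * h - j - 2)) w)) := by
  have hneg : (-1 : ℂ) ≠ 0 := neg_ne_zero.mpr one_ne_zero
  have hsq : (-1 : ℂ) ^ l * (-1) ^ l = 1 := by rw [← mul_zpow]; simp
  have hsign : (-1 : ℂ) ^ (h + h' - l - 1) = -((-1) ^ l * (-1) ^ (h + h')) := by
    rw [zpow_sub₀ hneg, zpow_sub₀ hneg, zpow_one, div_neg, div_one, neg_inj,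
      div_eq_iff (zpow_ne_zero l hneg)]
    linear_combination -(-1 : ℂ) ^ (h + h') * hsq
  rw [hS.mode_mode_eq_sum hu hv hNu hNv, hS.mode_mode_eq_sum hv hu hNv hNu, add_comm h' h,
    sum_comm, hsign]
  simp only [sum_sub_distrib, ← smul_sum]
  match_scalars
  · linear_combination -(-1 : ℂ) ^ (h + h') * hsq
  · ring

include hA hY hg in
theorem eventually_jacobi_of_mem {r : ℤ}
    (hgu : g u = Complex.exp (2 * Real.pi * Complex.I * (-r : ℤ) / T) • u) (l m n : ℤ)
    (hm : m ≡ r [ZMOD T]) (w : M) : ∀ᶠ N in atTop,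
      ∑ i ∈ range N, binom ((m : ℂ) / T) i • S (A.Y u (l + i) v) (m + n - T * i) w =
      ∑ i ∈ range N, ((-1 : ℂ) ^ i * binom l i) •
        (S v (n + T * i) (S u (m + T * l - T * i) w) -
          (-1 : ℂ) ^ l • S u (m + T * i) (S v (n + T * l - T * i) w)) := by
  obtain ⟨N₁, h₁⟩ := hA.exists_dividedPow_L_one_eq_zero hu
  obtain ⟨N₂, h₂⟩ := hA.exists_dividedPow_L_one_eq_zero hv
  obtain ⟨N₃, h₃⟩ := hA.exists_wt_eq_bot (h + h' - l - 1)
  have hevent := (Filter.eventually_all_finset (range N₁)).mpr fun j _ =>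
    (Filter.eventually_all_finset (range N₂)).mpr fun j' _ =>
      eventually_sum_oppositeJacobiTerm_eq hA hY hg hgu h h' v l m n hm w j j'
  filter_upwards [hevent, eventually_ge_atTop N₁, eventually_ge_atTop N₂,
    eventually_ge_atTop N₃] with N hN hN₁ hN₂ hN₃
  have hswap (F : ℕ → ℕ → ℕ → M) : ∑ i ∈ range N, ∑ j ∈ range N, ∑ j' ∈ range N, F i j j' =
      ∑ j ∈ range N, ∑ j' ∈ range N, ∑ i ∈ range N, F i j j' :=
    sum_comm.trans (sum_congr rfl fun j _ => sum_comm)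
  rw [hS.sum_binom_smul_mode hA hu hv fun j hj => h₃ j (hN₃.trans hj)]
  simp only [hS.mode_mode_sub_mode_mode hu hv (N := N) (fun j hj => h₁ j (hN₁.trans hj))
    (fun j hj => h₂ j (hN₂.trans hj)) l, smul_comm _ ((-1 : ℂ) ^ (h + h' - l - 1)), ← smul_sum]
  congr 1
  simp only [smul_sum (s := range N)]
  refine (hswap _).trans (Eq.trans ?_ (hswap _).symm)
  refine sum_congr rfl fun j _ => sum_congr rfl fun j' _ => ?_
  by_cases hj : j < N₁
  · by_cases hj' : j' < N₂
    · exact hN j (mem_range.mpr hj) j' (mem_range.mpr hj')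
    · simp [oppositeJacobiTerm, h₂ j' (not_lt.mp hj')]
  · simp [oppositeJacobiTerm, h₁ j (not_lt.mp hj)]

end IsOppositeMap

end OppositeJacobi

/-! ### Contragredient modules -/

section Contragredient

variable {V M : Type*} [AddCommGroup V] [Module ℂ V] [AddCommGroup M] [Module ℂ M]
  {A : VertexData V} {g g' : V →ₗ[ℂ] V} {T : ℕ}

theorem IsConformalAut.mem_iSup_wt_inf_ker (hg : IsConformalAut A g T) (hA : A.IsConformal)
    {c : ℂ} {u : V} (hu : g u = c • u) :
    u ∈ ⨆ n, A.wt n ⊓ LinearMap.ker (g - c • LinearMap.id) := by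
  refine mem_iSup_inf_ker A.wt_iSupIndep hA.graded (fun n x hx => ?_) ?_
  · rw [VertexData.mem_wt_iff] at hx ⊢
    rw [LinearMap.sub_apply, map_sub, ← hg.map_L, hx, LinearMap.smul_apply, map_smul, map_smul,
      LinearMap.id_apply, hx, smul_sub, smul_comm]
  · rw [LinearMap.sub_apply, LinearMap.smul_apply, LinearMap.id_apply, hu, sub_self]

theorem apply_eq_exp_neg_smul (hgg' : ∀ v, g (g' v) = v) {r : ℤ} {u : V}
    (hu : g' u = Complex.exp (2 * Real.pi * Complex.I * r / T) • u) :
    g u = Complex.exp (2 * Real.pi * Complex.I * (-r : ℤ) / T) • u := by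
  have hexp : Complex.exp (2 * Real.pi * Complex.I * (-r : ℤ) / T) *
      Complex.exp (2 * Real.pi * Complex.I * r / T) = 1 := by
    rw [← Complex.exp_add, ← Complex.exp_zero]
    push_cast
    ring_nf
  calc g u = (Complex.exp (2 * Real.pi * Complex.I * (-r : ℤ) / T) *
        Complex.exp (2 * Real.pi * Complex.I * r / T)) • g u := by rw [hexp, one_smul]
    _ = Complex.exp (2 * Real.pi * Complex.I * (-r : ℤ) / T) • g (g' u) := by
        rw [hu, map_smul, smul_smul]
    _ = _ := by rw [hgg']

section Transpose

variable {Y S : V →ₗ[ℂ] (ℤ → Module.End ℂ M)} (hS : IsOppositeMap A T Y S)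
  (hA : A.IsConformal) (hg : IsConformalAut A g T)

namespace IsOppositeMap
include hS hA hg

theorem mode_eq_zero (hY : IsWeakTwistedModule A g T Y) {r : ℤ} {u : V}
    (hu : g u = Complex.exp (2 * Real.pi * Complex.I * (-r : ℤ) / T) • u) {p : ℤ}
    (hp : ¬ p ≡ r [ZMOD T]) : S u p = 0 := by
  have hmem := hg.mem_iSup_wt_inf_ker hA hu
  clear hu
  induction hmem using Submodule.iSup_induction' with
  | mem n u hmem =>
    obtain ⟨hun, hker⟩ := hmem
    have hgu : g u = Complex.exp (2 * Real.pi * Complex.I * (-r : ℤ) / T) • u :=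
      sub_eq_zero.mp hker
    obtain ⟨N, hN⟩ := hA.exists_dividedPow_L_one_eq_zero hun
    rw [hS n u hun, contragredientMode_eq_sum A T Y n p hN, sum_eq_zero, smul_zero]
    intro j _
    refine hY.support (-r) _ (by rw [hg.map_dividedPow_L_one, hgu, map_smul]) _ fun hmod => hp ?_
    have hneg := hmod.neg
    rw [neg_neg] at hneg
    exact Int.ModEq.trans (Int.modEq_iff_dvd.mpr ⟨-(2 * n - j - 2), by ring⟩) hneg
  | zero => rw [map_zero, Pi.zero_apply]
  | add x y _ _ ihx ihy => rw [map_add, Pi.add_apply, ihx, ihy, add_zero]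

theorem eventually_jacobi (hY : IsWeakTwistedModule A g T Y) {r : ℤ} {u : V}
    (hu : g u = Complex.exp (2 * Real.pi * Complex.I * (-r : ℤ) / T) • u) (v : V) (l m n : ℤ)
    (hm : m ≡ r [ZMOD T]) (w : M) : ∀ᶠ N in atTop,
      ∑ i ∈ range N, binom ((m : ℂ) / T) i • S (A.Y u (l + i) v) (m + n - T * i) w =
      ∑ i ∈ range N, ((-1 : ℂ) ^ i * binom l i) •
        (S v (n + T * i) (S u (m + T * l - T * i) w) -
          (-1 : ℂ) ^ l • S u (m + T * i) (S v (n + T * l - T * i) w)) := by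
  have hmem := hg.mem_iSup_wt_inf_ker hA hu
  clear hu
  induction hmem using Submodule.iSup_induction' with
  | mem h u hmem =>
    obtain ⟨hun, hker⟩ := hmem
    have hv : v ∈ ⨆ n, A.wt n := hA.graded ▸ Submodule.mem_top
    induction hv using Submodule.iSup_induction' with
    | mem h' v hv =>
      exact hS.eventually_jacobi_of_mem hA hY hg hun hv (sub_eq_zero.mp hker) l m n hm w
    | zero => simp
    | add x y _ _ ihx ihy =>
      filter_upwards [ihx, ihy] with N hx hy
      simp only [map_add, Pi.add_apply, LinearMap.add_apply, smul_add, sum_add_distrib, hx, hy]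
      rw [← sum_add_distrib]
      exact sum_congr rfl fun i _ => by module
  | zero => simp
  | add x y _ _ ihx ihy =>
    filter_upwards [ihx, ihy] with N hx hy
    simp only [map_add, Pi.add_apply, LinearMap.add_apply, smul_add, sum_add_distrib, hx, hy]
    rw [← sum_add_distrib]
    exact sum_congr rfl fun i _ => by module

theorem dualMap_mem_restrictedDual (hY : IsWeakTwistedModule A g T Y) (v : V) (p : ℤ)
    {f : Module.Dual ℂ M} (hf : f ∈ restrictedDual (Y A.conf T)) :
    (S v p).dualMap f ∈ restrictedDual (Y A.conf T) := by
  have hv : v ∈ ⨆ n, A.wt n := hA.graded ▸ Submodule.mem_top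
  induction hv using Submodule.iSup_induction' with
  | mem n v hv =>
    have hfin : {μ : ℂ | ∃ w ∈ Module.End.eigenspace (Y A.conf T) μ, f w ≠ 0}.Finite := hf
    refine (hfin.preimage (add_left_injective ((p : ℂ) / T - n + 1)).injOn).subset ?_
    rintro μ ⟨w, hw, hne⟩
    exact ⟨S v p w, hS.mode_mem_eigenspace hA hY hg hv p hw, hne⟩
  | zero =>
    rw [map_zero, Pi.zero_apply, LinearMap.dualMap_apply', LinearMap.comp_zero]
    exact Submodule.zero_mem _
  | add x y _ _ ihx ihy =>
    rw [map_add, Pi.add_apply, LinearMap.dualMap_apply', LinearMap.comp_add]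
    exact Submodule.add_mem _ ihx ihy

theorem exists_transpose (hY : IsWeakTwistedModule A g T Y) :
    ∃ Y' : V →ₗ[ℂ] (ℤ → Module.End ℂ (restrictedDual (Y A.conf T))),
      ∀ v p (f : restrictedDual (Y A.conf T)) (w : M),
        (Y' v p f : Module.Dual ℂ M) w = (f : Module.Dual ℂ M) (S v p w) := by
  refine ⟨{ toFun := fun v p => (S v p).dualMap.restrict fun f hf =>
              hS.dualMap_mem_restrictedDual hA hg hY v p hf
            map_add' := fun v v' => ?_, map_smul' := fun c v => ?_ }, fun v p f w => rfl⟩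
  all_goals
    ext p f w
    simp [LinearMap.restrict_apply]

end IsOppositeMap

variable (hY : IsTwistedModule A g T Y)

include hY in
theorem IsTwistedModule.exists_lower_bound_restrictedDual
    (f : restrictedDual (Y A.conf T)) : ∃ C : ℤ, ∀ ν,
      (∃ w ∈ Module.End.eigenspace (Y A.conf T) ν, (f : Module.Dual ℂ M) w ≠ 0) →
        ∀ n < C, Module.End.eigenspace (Y A.conf T) (ν + n / T) = ⊥ := by
  choose B hB using hY.lower_bound
  have hfin : {ν | ∃ w ∈ Module.End.eigenspace (Y A.conf T) ν,
    (f : Module.Dual ℂ M) w ≠ 0}.Finite := f.2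
  obtain ⟨C, hC⟩ := (hfin.image B).bddBelow
  exact ⟨C, fun ν hν n hn => hB ν n (hn.trans_le (hC (Set.mem_image_of_mem B hν)))⟩

variable {Y' : V →ₗ[ℂ] (ℤ → Module.End ℂ (restrictedDual (Y A.conf T)))}
  (hY' : ∀ v p (f : restrictedDual (Y A.conf T)) (w : M),
    (Y' v p f : Module.Dual ℂ M) w = (f : Module.Dual ℂ M) (S v p w))
include hY' hS hA

include hY hg in
theorem transpose_truncation (v : V) (f : restrictedDual (Y A.conf T)) :
    ∃ N : ℤ, ∀ p, N ≤ p → Y' v p f = 0 := by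
  have hT : (T : ℂ) ≠ 0 := Nat.cast_ne_zero.mpr hg.pos.ne'
  have hv : v ∈ ⨆ n, A.wt n := hA.graded ▸ Submodule.mem_top
  induction hv using Submodule.iSup_induction' with
  | mem n v hv =>
    obtain ⟨C, hC⟩ := hY.exists_lower_bound_restrictedDual f
    refine ⟨T * (n - 1) - C + 1, fun p hp => Subtype.ext ?_⟩
    refine linearMap_ext_of_iSup_eq_top hY.graded fun μ w hw => ?_
    rw [hY']
    by_contra hne
    have hbot := hC _ ⟨_, hS.mode_mem_eigenspace hA hY.toIsWeakTwistedModule hg hv p hw, hne⟩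
      (-p + T * (n - 1)) (by omega)
    rw [show μ + ((p : ℂ) / T - n + 1) + ((-p + T * (n - 1) : ℤ) : ℂ) / T = μ by
      push_cast; field_simp; ring] at hbot
    rw [hbot, Submodule.mem_bot] at hw
    exact hne (by rw [hw, map_zero, map_zero, ZeroMemClass.coe_zero, LinearMap.zero_apply])
  | zero => exact ⟨0, fun p _ => by rw [map_zero, Pi.zero_apply, LinearMap.zero_apply]⟩
  | add x y _ _ ihx ihy =>
    obtain ⟨N₁, h₁⟩ := ihx
    obtain ⟨N₂, h₂⟩ := ihy
    refine ⟨max N₁ N₂, fun p hp => ?_⟩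
    rw [map_add, Pi.add_apply, LinearMap.add_apply, h₁ p (le_of_max_le_left hp),
      h₂ p (le_of_max_le_right hp), add_zero]

include hY hg in
theorem transpose_isWeakTwistedModule (hgg' : ∀ v, g (g' v) = v) :
    IsWeakTwistedModule A g' T Y' where
  support r u hu p hp := by
    ext f w
    rw [hY', hS.mode_eq_zero hA hg hY.toIsWeakTwistedModule (apply_eq_exp_neg_smul hgg' hu) hp]
    simp
  truncation := transpose_truncation hS hA hg hY hY'
  vacuum p := by
    ext f w
    rw [hY', hS.mode_vac hA, hY.vacuum]
    simp only [show -p + (T : ℤ) * (-2) = -T ↔ p = -T by constructor <;> intro h <;> linarith]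
    split_ifs <;> simp
  jacobi r u hu v f l m n hm := by
    refine Subtype.ext (LinearMap.ext fun w => ?_)
    obtain ⟨N, ⟨hleft, hright⟩, hN⟩ := ((eventually_finsum_jacobi_eq hA hg.pos
      (transpose_truncation hS hA hg hY hY') u v f l m n).and (hS.eventually_jacobi hA hg
        hY.toIsWeakTwistedModule (apply_eq_exp_neg_smul hgg' hu) v l m n hm w)).exists
    rw [hleft, hright]
    simpa only [map_sum, map_smul, map_sub, AddSubmonoidClass.coe_finsetSum,
      LinearMap.sum_apply, Submodule.coe_smul, LinearMap.smul_apply, hY',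
      AddSubgroupClass.coe_sub, LinearMap.sub_apply] using congrArg (f : Module.Dual ℂ M) hN

theorem transpose_conf (f : restrictedDual (Y A.conf T)) (w : M) :
    (Y' A.conf T f : Module.Dual ℂ M) w = (f : Module.Dual ℂ M) (Y A.conf T w) := by
  rw [hY', hS.mode_conf hA, show -(T : ℤ) + T * 2 = T by ring]

end Transpose

section Transpose

variable {L : Module.End ℂ M} {L' : Module.End ℂ (restrictedDual L)}
  (hL' : ∀ (f : restrictedDual L) w, (L' f : Module.Dual ℂ M) w = (f : Module.Dual ℂ M) (L w))
include hL'

theorem apply_eq_zero_of_mem_eigenspace {μ ν : ℂ} {f : restrictedDual L} {w : M}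
    (hf : f ∈ Module.End.eigenspace L' μ) (hw : w ∈ Module.End.eigenspace L ν) (hne : μ ≠ ν) :
    (f : Module.Dual ℂ M) w = 0 := by
  rw [Module.End.mem_eigenspace_iff] at hf hw
  have heq := hL' f w
  rw [hf, hw, map_smul, Submodule.coe_smul, LinearMap.smul_apply, ← sub_eq_zero,
    ← sub_smul] at heq
  exact (smul_eq_zero.mp heq).resolve_left (sub_ne_zero.mpr hne)

variable (htop : ⨆ μ, Module.End.eigenspace L μ = ⊤)
include htop

theorem mem_eigenspace_of_apply_eq_zero {μ : ℂ} {f : restrictedDual L}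
    (hf : ∀ ν ≠ μ, ∀ w ∈ Module.End.eigenspace L ν, (f : Module.Dual ℂ M) w = 0) :
    f ∈ Module.End.eigenspace L' μ := by
  rw [Module.End.mem_eigenspace_iff]
  refine Subtype.ext (linearMap_ext_of_iSup_eq_top htop fun ν w hw => ?_)
  rw [hL', Submodule.coe_smul, LinearMap.smul_apply, Module.End.mem_eigenspace_iff.mp hw,
    map_smul]
  obtain rfl | hne := eq_or_ne ν μ
  · rfl
  · rw [hf ν hne w hw, smul_zero, smul_zero]

theorem iSup_eigenspace_transpose : ⨆ μ, Module.End.eigenspace L' μ = ⊤ := by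
  classical
  rw [eq_top_iff]
  intro f _
  have hπ (μ : ℂ) : ∃ fμ : Module.Dual ℂ M, ∀ ν, ∀ w ∈ Module.End.eigenspace L ν,
      fμ w = if ν = μ then (f : Module.Dual ℂ M) w else 0 := by
    obtain ⟨fμ, hfμ⟩ := exists_linearMap_of_iSup_eq_top (Module.End.eigenspaces_iSupIndep L) htop
      fun ν => if ν = μ then (f : Module.Dual ℂ M) ∘ₗ (Module.End.eigenspace L ν).subtype else 0
    refine ⟨fμ, fun ν w hw => (hfμ ν ⟨w, hw⟩).trans ?_⟩
    split_ifs <;> rfl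
  choose F hF using hπ
  have hmem (μ : ℂ) : F μ ∈ restrictedDual L := by
    refine (Set.finite_singleton μ).subset ?_
    rintro ν ⟨w, hw, hne⟩
    rw [hF μ ν w hw] at hne
    exact of_not_not fun h => hne (if_neg h)
  have hfin : {μ : ℂ | ∃ w ∈ Module.End.eigenspace L μ, (f : Module.Dual ℂ M) w ≠ 0}.Finite := f.2
  have hsum : f = ∑ μ ∈ hfin.toFinset, ⟨F μ, hmem μ⟩ := by
    refine Subtype.ext (linearMap_ext_of_iSup_eq_top htop fun ν w hw => ?_)
    simp only [AddSubmonoidClass.coe_finsetSum, LinearMap.sum_apply, hF _ ν w hw]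
    rw [sum_ite_eq, eq_comm, ite_eq_left_iff]
    exact fun hν => of_not_not fun h => hν (hfin.mem_toFinset.mpr ⟨w, hw, Ne.symm h⟩)
  rw [hsum]
  refine Submodule.sum_mem _ fun μ _ => Submodule.mem_iSup_of_mem μ ?_
  refine mem_eigenspace_of_apply_eq_zero hL' htop fun ν hne w hw => ?_
  rw [hF μ ν w hw, if_neg hne]

theorem finiteDimensional_eigenspace_transpose {μ : ℂ}
    [FiniteDimensional ℂ (Module.End.eigenspace L μ)] :
    FiniteDimensional ℂ (Module.End.eigenspace L' μ) := by
  let φ : Module.End.eigenspace L' μ →ₗ[ℂ] Module.Dual ℂ (Module.End.eigenspace L μ) :=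
    (Module.End.eigenspace L μ).subtype.dualMap ∘ₗ (restrictedDual L).subtype ∘ₗ
      (Module.End.eigenspace L' μ).subtype
  refine Module.Finite.of_injective φ fun f f' hff => ?_
  refine Subtype.ext (Subtype.ext (linearMap_ext_of_iSup_eq_top htop fun ν w hw => ?_))
  obtain rfl | hne := eq_or_ne μ ν
  · exact LinearMap.congr_fun hff ⟨w, hw⟩
  · rw [apply_eq_zero_of_mem_eigenspace hL' f.2 hw hne,
      apply_eq_zero_of_mem_eigenspace hL' f'.2 hw hne]

theorem eigenspace_transpose_eq_bot {μ : ℂ} (hμ : Module.End.eigenspace L μ = ⊥) :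
    Module.End.eigenspace L' μ = ⊥ := by
  refine (Submodule.eq_bot_iff _).mpr fun f hf => Subtype.ext ?_
  refine linearMap_ext_of_iSup_eq_top htop fun ν w hw => ?_
  obtain rfl | hne := eq_or_ne μ ν
  · rw [hμ, Submodule.mem_bot] at hw
    rw [hw, map_zero, map_zero]
  · exact apply_eq_zero_of_mem_eigenspace hL' hf hw hne

end Transpose

theorem IsTwistedModule.exists_isContragredient {Y : V →ₗ[ℂ] (ℤ → Module.End ℂ M)}
    (hY : IsTwistedModule A g T Y) (hA : A.IsConformal) (hg : IsConformalAut A g T)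
    (hgg' : ∀ v, g (g' v) = v) {D : Submodule ℂ (Module.Dual ℂ M)}
    (hD : D = restrictedDual (Y A.conf T)) :
    ∃ Y' : V →ₗ[ℂ] (ℤ → Module.End ℂ D),
      IsContragredient A T Y D Y' ∧ IsTwistedModule A g' T Y' := by
  subst hD
  obtain ⟨S, hS⟩ := exists_isOppositeMap hA T Y
  obtain ⟨Y', hY'⟩ := hS.exists_transpose hA hg hY.toIsWeakTwistedModule
  have hconf := transpose_conf hS hA hY'
  refine ⟨Y', ⟨rfl, fun n v hv p f w => by rw [hY', hS n v hv]⟩,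
    transpose_isWeakTwistedModule hS hA hg hY hY' hgg',
    iSup_eigenspace_transpose hconf hY.graded, fun μ => ?_, fun μ => ?_⟩
  · have := hY.finite μ
    exact finiteDimensional_eigenspace_transpose hconf hY.graded
  · obtain ⟨N, hN⟩ := hY.lower_bound μ
    exact ⟨N, fun n hn => eigenspace_transpose_eq_bot hconf hY.graded (hN n hn)⟩

end Contragredient

/-! ### Tensor powers -/

section PositionOp

variable {V : Type*} [AddCommGroup V] [Module ℂ V] {k : ℕ}

theorem tensor_ext {N : Type*} [AddCommGroup N] [Module ℂ N] {f g : (⨂[ℂ] _ : Fin k, V) →ₗ[ℂ] N}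
    (h : ∀ v, f (PiTensorProduct.tprod ℂ v) = g (PiTensorProduct.tprod ℂ v)) : f = g :=
  PiTensorProduct.ext (MultilinearMap.ext h)

/-- The operator `1 ⊗ ⋯ ⊗ φ ⊗ ⋯ ⊗ 1` with `φ` in position `i`. -/
def positionOp (i : Fin k) (φ : Module.End ℂ V) : Module.End ℂ (⨂[ℂ] _ : Fin k, V) :=
  PiTensorProduct.map (Function.update (fun _ => LinearMap.id) i φ)

theorem positionOp_tprod (i : Fin k) (φ : Module.End ℂ V) (v : Fin k → V) :
    positionOp i φ (PiTensorProduct.tprod ℂ v) =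
      PiTensorProduct.tprod ℂ (Function.update v i (φ (v i))) := by
  rw [positionOp, PiTensorProduct.map_tprod]
  congr 1
  ext1 j
  obtain rfl | hj := eq_or_ne j i
  · simp
  · simp [hj]

theorem positionOp_id (i : Fin k) : positionOp i (LinearMap.id : Module.End ℂ V) = LinearMap.id :=
  tensor_ext fun v => by simp [positionOp_tprod]

theorem positionOp_inPosition (A : VOA V) (i : Fin k) (φ : Module.End ℂ V) (u : V) :
    positionOp i φ (inPosition A k i u) = inPosition A k i (φ u) := by
  simp [inPosition, positionOp_tprod]

theorem positionOp_inPosition_of_ne {A : VOA V} {i j : Fin k} (hij : i ≠ j) {φ : Module.End ℂ V}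
    (hφ : φ A.vac = 0) (u : V) : positionOp i φ (inPosition A k j u) = 0 := by
  rw [inPosition, positionOp_tprod]
  exact MultilinearMap.map_coord_zero _ i (by simp [hij, hφ])

theorem sum_positionOp_inPosition {A : VOA V} {φ : Module.End ℂ V} (hφ : φ A.vac = 0)
    (i : Fin k) (u : V) :
    (∑ j, positionOp j φ) (inPosition A k i u) = inPosition A k i (φ u) := by
  rw [LinearMap.sum_apply, sum_eq_single i
    (fun j _ hj => positionOp_inPosition_of_ne hj hφ u) (by simp), positionOp_inPosition]

theorem eq_top_of_forall_tprod_mem {ι : Type*} {G : ι → Submodule ℂ V} (htop : ⨆ i, G i = ⊤)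
    {S : Submodule ℂ (⨂[ℂ] _ : Fin k, V)}
    (hS : ∀ v : Fin k → V, (∀ i, ∃ n, v i ∈ G n) → PiTensorProduct.tprod ℂ v ∈ S) : S = ⊤ := by
  have hspan : Submodule.span ℂ (Set.range (Subtype.val : {x : V // ∃ n, x ∈ G n} → V)) = ⊤ := by
    rw [eq_top_iff, ← htop, iSup_le_iff]
    exact fun n x hx => Submodule.subset_span ⟨⟨x, n, hx⟩, rfl⟩
  rw [eq_top_iff, ← PiTensorProduct.submodule_span_eq_top fun _ : Fin k => hspan,
    Submodule.span_le]
  rintro _ ⟨v, rfl⟩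
  exact hS _ fun i => (v i).2

end PositionOp

section MultiMode

variable {V : Type*} [AddCommGroup V] [Module ℂ V] (A : VOA V) {k : ℕ}

theorem multiMode_positionOp_tprod (n : Fin k → ℤ) (i : Fin k) (e : ℤ) (φ ψ : Module.End ℂ V)
    (u v : Fin k → V) :
    multiMode A k (n + Pi.single i e) (positionOp i φ (PiTensorProduct.tprod ℂ u))
        (positionOp i ψ (PiTensorProduct.tprod ℂ v)) =
      PiTensorProduct.tprod ℂ (Function.update (fun j => A.Y (u j) (n j) (v j)) i
        (A.Y (φ (u i)) (n i + e) (ψ (v i)))) := by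
  rw [positionOp_tprod, positionOp_tprod, multiMode_tprod]
  congr 1
  ext1 j
  obtain rfl | hj := eq_or_ne j i
  · simp
  · simp [hj]

theorem positionOp_multiMode (n : Fin k → ℤ) (i : Fin k) (a : V) (m : ℕ)
    (u v : ⨂[ℂ] _ : Fin k, V) :
    positionOp i (A.Y a m) (multiMode A k n u v) =
      multiMode A k n u (positionOp i (A.Y a m) v) +
        ∑ j ∈ range (m + 1), binom m j •
          multiMode A k (n + Pi.single i (m - j : ℤ)) (positionOp i (A.Y a j) u) v := by
  induction u using PiTensorProduct.induction_on with
  | add x y hx hy =>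
    simp only [map_add, LinearMap.add_apply, hx, hy, smul_add, sum_add_distrib]
    abel
  | smul_tprod r u =>
    induction v using PiTensorProduct.induction_on with
    | add x y hx hy =>
      simp only [map_add, hx, hy, smul_add, sum_add_distrib]
      abel
    | smul_tprod r' v =>
      have hv := multiMode_positionOp_tprod A n i 0 LinearMap.id (A.Y a m) u v
      have hu (j : ℕ) := multiMode_positionOp_tprod A n i (m - j) (A.Y a j) LinearMap.id u v
      simp only [positionOp_id, LinearMap.id_apply, Pi.single_zero, add_zero] at hv hu
      simp only [map_smul, LinearMap.smul_apply, smul_comm (binom _ _) (_ : ℂ), ← smul_sum,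
        ← smul_add, hv, hu]
      have hindex (j : ℕ) : (m : ℤ) + n i - j = n i + (m - j) := by ring
      rw [multiMode_tprod, positionOp_tprod, A.commutator, MultilinearMap.map_update_add,
        MultilinearMap.map_update_sum]
      simp only [MultilinearMap.map_update_smul, hindex]

theorem multiMode_positionOp_L_neg_one (n : Fin k → ℤ) (i : Fin k) (u v : ⨂[ℂ] _ : Fin k, V) :
    multiMode A k n (positionOp i (A.L (-1)) u) v =
      -(n i : ℂ) • multiMode A k (n + Pi.single i (-1)) u v := by
  induction u using PiTensorProduct.induction_on with
  | add x y hx hy => simp only [map_add, LinearMap.add_apply, hx, hy, smul_add]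
  | smul_tprod r u =>
    induction v using PiTensorProduct.induction_on with
    | add x y hx hy => simp only [map_add, hx, hy, smul_add]
    | smul_tprod r' v =>
      have hu := multiMode_positionOp_tprod A n i 0 (A.L (-1)) LinearMap.id u v
      have hn := multiMode_positionOp_tprod A n i (-1) LinearMap.id LinearMap.id u v
      simp only [positionOp_id, LinearMap.id_apply, Pi.single_zero, add_zero] at hu hn
      simp only [map_smul, LinearMap.smul_apply, smul_comm (-(n i : ℂ)), hu, hn]
      rw [A.derivative, LinearMap.smul_apply, MultilinearMap.map_update_smul, sub_eq_add_neg]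

/-- The translation `n ↦ n + e • δᵢ` between the index sets of the sums defining two modes of a
vector of the tensor power. -/
def addSingleEquiv (i : Fin k) {s e t : ℤ} (h : s + e = t) :
    {n : Fin k → ℤ // ∑ j, (n j + 1) = s} ≃ {n : Fin k → ℤ // ∑ j, (n j + 1) = t} :=
  (Equiv.addRight (Pi.single i e)).subtypeEquiv fun n => by
    simp only [Equiv.coe_addRight, Pi.add_apply, add_right_comm, sum_add_distrib,
      sum_pi_single', mem_univ, if_true]
    omega

theorem finsum_add_single {M : Type*} [AddCommMonoid M] (F : (Fin k → ℤ) → M) (i : Fin k)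
    {s e t : ℤ} (h : s + e = t) :
    ∑ᶠ n : {n : Fin k → ℤ // ∑ j, (n j + 1) = s}, F (n.1 + Pi.single i e) =
      ∑ᶠ n : {n : Fin k → ℤ // ∑ j, (n j + 1) = t}, F n.1 :=
  finsum_comp_equiv (addSingleEquiv i h) (f := fun n => F n.1)

theorem multiMode_add_single_finite (i : Fin k) (s e : ℤ) (u v : ⨂[ℂ] _ : Fin k, V) :
    (Function.support fun n : {n : Fin k → ℤ // ∑ j, (n j + 1) = s} =>
      multiMode A k (n.1 + Pi.single i e) u v).Finite :=
  (multiMode_finite A k (s + e) u v).preimage (addSingleEquiv i rfl).injective.injOn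

end MultiMode

section TensorPower

variable {V : Type*} [AddCommGroup V] [Module ℂ V] (A : VOA V) (k : ℕ)

theorem tensorPower_Y_apply (u v : ⨂[ℂ] _ : Fin k, V) {p s : ℤ} (h : p + 1 = s) :
    (tensorPower A k).Y u p v =
      ∑ᶠ n : {n : Fin k → ℤ // ∑ i, (n i + 1) = s}, multiMode A k n.1 u v := by
  subst h
  rfl

theorem tensorPower_conf : (tensorPower A k).conf = ∑ i, inPosition A k i A.conf := rfl

variable {A k}

theorem multiMode_inPosition_update (i : Fin k) (u : V) (p : ℤ) (v : Fin k → V) :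
    multiMode A k (Function.update (fun _ => -1) i p) (inPosition A k i u)
      (PiTensorProduct.tprod ℂ v) = positionOp i (A.Y u p) (PiTensorProduct.tprod ℂ v) := by
  have hvac : A.Y A.vac (-1) = 1 := by simpa using A.adjoint.vacuum (-1)
  rw [inPosition, multiMode_tprod, positionOp_tprod]
  congr 1
  ext1 j
  obtain rfl | hj := eq_or_ne j i
  · simp
  · simp [hj, hvac]

theorem multiMode_inPosition_of_ne {i j : Fin k} (hji : j ≠ i) {n : Fin k → ℤ} (hj : n j ≠ -1)
    (u : V) (v : Fin k → V) :
    multiMode A k n (inPosition A k i u) (PiTensorProduct.tprod ℂ v) = 0 := by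
  have hvac : A.Y A.vac (n j) = 0 := by simpa [hj] using A.adjoint.vacuum (n j)
  rw [inPosition, multiMode_tprod]
  exact MultilinearMap.map_coord_zero _ j (by simp [hji, hvac])

theorem tensorPower_Y_inPosition (i : Fin k) (u : V) (p : ℤ) :
    (tensorPower A k).Y (inPosition A k i u) p = positionOp i (A.Y u p) := by
  refine tensor_ext fun v => ?_
  have hsum (q : ℤ) : ∑ j, ((Function.update (fun _ => -1) i q : Fin k → ℤ) j + 1) = q + 1 := by
    rw [sum_eq_single i (fun j _ hj => by simp [hj]) (by simp), Function.update_self]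
  rw [tensorPower_Y_apply A k _ _ rfl,
    finsum_eq_single _ ⟨Function.update (fun _ => -1) i p, hsum p⟩,
    multiMode_inPosition_update]
  rintro ⟨n, hn⟩ hne
  obtain ⟨j, hji, hj⟩ : ∃ j, j ≠ i ∧ n j ≠ -1 := by
    by_contra! hvac
    have hupdate : n = Function.update (fun _ => -1) i (n i) :=
      (Function.eq_update_iff).mpr ⟨rfl, hvac⟩
    rw [hupdate, hsum, add_left_inj] at hn
    exact hne (Subtype.ext (hn ▸ hupdate))
  exact multiMode_inPosition_of_ne hji hj u v

theorem tensorPower_L (n : ℤ) : (tensorPower A k).L n = ∑ i, positionOp i (A.L n) := by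
  rw [VertexData.L, tensorPower_conf, map_sum, Finset.sum_apply]
  exact sum_congr rfl fun i _ => tensorPower_Y_inPosition i A.conf (n + 1)

theorem tensorPower_L_inPosition {n : ℤ} (hn : -1 ≤ n) (i : Fin k) (u : V) :
    (tensorPower A k).L n (inPosition A k i u) = inPosition A k i (A.L n u) := by
  rw [tensorPower_L, sum_positionOp_inPosition (A.L_vac hn)]

theorem tensorPower_truncation (u v : ⨂[ℂ] _ : Fin k, V) :
    ∃ N : ℤ, ∀ p : ℤ, N ≤ p → (tensorPower A k).Y u p v = 0 := by
  induction u using PiTensorProduct.induction_on with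
  | add x y hx hy =>
    obtain ⟨N, hN⟩ := hx
    obtain ⟨N', hN'⟩ := hy
    refine ⟨max N N', fun p hp => ?_⟩
    rw [map_add, Pi.add_apply, LinearMap.add_apply, hN p (le_of_max_le_left hp),
      hN' p (le_of_max_le_right hp), add_zero]
  | smul_tprod r u =>
    induction v using PiTensorProduct.induction_on with
    | add x y hx hy =>
      obtain ⟨N, hN⟩ := hx
      obtain ⟨N', hN'⟩ := hy
      refine ⟨max N N', fun p hp => ?_⟩
      rw [map_add, hN p (le_of_max_le_left hp), hN' p (le_of_max_le_right hp), add_zero]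
    | smul_tprod r' v =>
      choose N hN using fun i => A.adjoint.truncation (u i) (v i)
      refine ⟨∑ i, N i, fun p hp => ?_⟩
      rw [tensorPower_Y_apply A k _ _ rfl]
      refine finsum_eq_zero_of_forall_eq_zero fun n => ?_
      obtain ⟨i, hi⟩ : ∃ i, N i ≤ n.1 i := by
        by_contra! hlt
        have hle := sum_le_sum fun i (_ : i ∈ univ) => Int.add_one_le_iff.mpr (hlt i)
        rw [n.2] at hle
        omega
      rw [map_smul, map_smul, LinearMap.smul_apply, multiMode_tprod,
        MultilinearMap.map_coord_zero _ i (hN i _ hi), smul_zero, smul_zero]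

theorem exists_nonneg_of_sum_add_one_nonneg {ι : Type*} [Fintype ι] {n : ι → ℤ}
    (hsum : 0 ≤ ∑ i, (n i + 1)) (hne : n ≠ fun _ => -1) : ∃ i, 0 ≤ n i := by
  by_contra! hneg
  have hle (i : ι) (_ : i ∈ univ) : n i + 1 ≤ 0 := Int.add_one_le_iff.mpr (hneg i)
  have hzero := (sum_eq_zero_iff_of_nonpos hle).mp (le_antisymm (sum_nonpos hle) hsum)
  exact hne (funext fun i => eq_neg_of_add_eq_zero_left (hzero i (mem_univ i)))

theorem multiMode_tprod_vac_of_ne {n : Fin k → ℤ} (hsum : 0 ≤ ∑ i, (n i + 1))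
    (hne : n ≠ fun _ => -1) (v : Fin k → V) :
    multiMode A k n (PiTensorProduct.tprod ℂ v) (tensorPower A k).vac = 0 := by
  obtain ⟨i, hi⟩ := exists_nonneg_of_sum_add_one_nonneg hsum hne
  refine (multiMode_tprod A k n v _).trans (MultilinearMap.map_coord_zero _ i ?_)
  exact (A.creation (v i)).2 _ hi

theorem tensorPower_creation (v : ⨂[ℂ] _ : Fin k, V) :
    (tensorPower A k).Y v (-1) (tensorPower A k).vac = v ∧
      ∀ n : ℤ, 0 ≤ n → (tensorPower A k).Y v n (tensorPower A k).vac = 0 := by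
  induction v using PiTensorProduct.induction_on with
  | add x y hx hy =>
    refine ⟨?_, fun n hn => ?_⟩
    · rw [map_add, Pi.add_apply, LinearMap.add_apply, hx.1, hy.1]
    · rw [map_add, Pi.add_apply, LinearMap.add_apply, hx.2 n hn, hy.2 n hn, add_zero]
  | smul_tprod r v =>
    simp only [map_smul, Pi.smul_apply, LinearMap.smul_apply]
    refine ⟨congrArg (r • ·) ?_, fun p hp => smul_eq_zero_of_right r ?_⟩
    · rw [tensorPower_Y_apply A k _ _ (neg_add_cancel 1),
        finsum_eq_single _ ⟨fun _ => -1, by simp⟩ fun n hn =>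
          multiMode_tprod_vac_of_ne n.2.ge (fun h => hn (Subtype.ext h)) v]
      refine (multiMode_tprod A k _ v _).trans (congrArg _ ?_)
      exact funext fun i => (A.creation (v i)).1
    · rw [tensorPower_Y_apply A k _ _ rfl]
      refine finsum_eq_zero_of_forall_eq_zero fun n => multiMode_tprod_vac_of_ne ?_ ?_ v
      · rw [n.2]
        omega
      · intro hn
        have hsum := n.2
        simp only [hn, neg_add_cancel, sum_const_zero] at hsum
        omega

theorem positionOp_tensorPower_mode (i : Fin k) (a : V) (m : ℕ) (u : ⨂[ℂ] _ : Fin k, V) (p : ℤ)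
    (v : ⨂[ℂ] _ : Fin k, V) :
    positionOp i (A.Y a m) ((tensorPower A k).Y u p v) =
      (tensorPower A k).Y u p (positionOp i (A.Y a m) v) + ∑ j ∈ range (m + 1),
        binom m j • (tensorPower A k).Y (positionOp i (A.Y a j) u) (m + p - j) v := by
  rw [tensorPower_Y_apply A k _ _ rfl, map_finsum _ (multiMode_finite A k _ u v)]
  simp only [positionOp_multiMode]
  have hfinite (j : ℕ) :=
    multiMode_add_single_finite A i (p + 1) (m - j) (positionOp i (A.Y a j) u) v
  have hfinite_smul (j : ℕ) : (Function.support
      fun n : {n : Fin k → ℤ // ∑ i, (n i + 1) = p + 1} => binom m j •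
        multiMode A k (n.1 + Pi.single i (m - j : ℤ)) (positionOp i (A.Y a j) u) v).Finite :=
    (hfinite j).subset fun n hn h => hn (smul_eq_zero_of_right _ h)
  rw [finsum_add_distrib (multiMode_finite A k _ _ _)
      (((range (m + 1)).finite_toSet.biUnion fun j _ => hfinite_smul j).subset
        (Finset.support_sum _ _)), finsum_sum_comm _ _ fun j _ => hfinite_smul j,
    tensorPower_Y_apply A k _ _ rfl]
  congr 1
  refine sum_congr rfl fun j _ => ?_
  rw [← smul_finsum' _ (hfinite j), tensorPower_Y_apply A k _ _ rfl]
  congr 1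
  exact finsum_add_single (fun n => multiMode A k n (positionOp i (A.Y a j) u) v) i (by ring)

theorem tensorPower_commutator (m : ℕ) (u : ⨂[ℂ] _ : Fin k, V) (p : ℤ) (v : ⨂[ℂ] _ : Fin k, V) :
    (tensorPower A k).Y (tensorPower A k).conf m ((tensorPower A k).Y u p v) =
      (tensorPower A k).Y u p ((tensorPower A k).Y (tensorPower A k).conf m v) +
        ∑ j ∈ range (m + 1), binom m j • (tensorPower A k).Y
          ((tensorPower A k).Y (tensorPower A k).conf j u) (m + p - j) v := by
  have hconf (q : ℤ) :
      (tensorPower A k).Y (tensorPower A k).conf q = ∑ i, positionOp i (A.Y A.conf q) := by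
    rw [← sub_add_cancel q 1]
    exact tensorPower_L (q - 1)
  simp only [hconf, LinearMap.sum_apply, positionOp_tensorPower_mode, sum_add_distrib, map_sum,
    Finset.sum_apply, smul_sum]
  rw [sum_comm]

theorem tensorPower_Y_positionOp_L_neg_one (i : Fin k) (u : ⨂[ℂ] _ : Fin k, V) (p : ℤ)
    (v : ⨂[ℂ] _ : Fin k, V) :
    (tensorPower A k).Y (positionOp i (A.L (-1)) u) p v =
      ∑ᶠ n : {n : Fin k → ℤ // ∑ j, (n j + 1) = p}, -((n.1 i : ℂ) + 1) • multiMode A k n.1 u v := by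
  rw [tensorPower_Y_apply A k _ _ rfl,
    ← finsum_add_single (fun n => -((n i : ℂ) + 1) • multiMode A k n u v) i
      (add_neg_cancel_right p 1)]
  refine finsum_congr fun n => ?_
  rw [multiMode_positionOp_L_neg_one]
  simp

theorem tensorPower_derivative (u : ⨂[ℂ] _ : Fin k, V) (p : ℤ) :
    (tensorPower A k).Y ((tensorPower A k).L (-1) u) p =
      -(p : ℂ) • (tensorPower A k).Y u (p - 1) := by
  refine LinearMap.ext fun v => ?_
  have hfinite := multiMode_finite A k p u v
  rw [tensorPower_L, LinearMap.sum_apply, map_sum, Finset.sum_apply, LinearMap.sum_apply,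
    LinearMap.smul_apply, tensorPower_Y_apply A k _ _ (sub_add_cancel p 1), smul_finsum' _ hfinite]
  simp only [tensorPower_Y_positionOp_L_neg_one]
  rw [← finsum_sum_comm _ _ fun i _ =>
    hfinite.subset fun n hn h => hn (smul_eq_zero_of_right _ h)]
  refine finsum_congr fun n => ?_
  have hp : (p : ℂ) = ∑ i, ((n.1 i : ℂ) + 1) := by exact_mod_cast n.2.symm
  rw [← sum_smul, sum_neg_distrib, hp]

theorem tprod_mem_wt {v : Fin k → V} {h : Fin k → ℤ} (hv : ∀ i, v i ∈ A.wt (h i)) :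
    PiTensorProduct.tprod ℂ v ∈ (tensorPower A k).wt (∑ i, h i) := by
  rw [VertexData.mem_wt_iff, tensorPower_L, LinearMap.sum_apply]
  push_cast
  rw [sum_smul]
  refine sum_congr rfl fun i _ => ?_
  rw [positionOp_tprod, VertexData.mem_wt_iff.mp (hv i), MultilinearMap.map_update_smul,
    Function.update_eq_self]

theorem exists_iSup_tensorPower_wt_eq_top :
    ∃ N : ℤ, ⨆ n : {n : ℤ // N ≤ n}, (tensorPower A k).wt n = ⊤ := by
  obtain ⟨B, hB⟩ := A.lower_bound
  refine ⟨k * B, eq_top_of_forall_tprod_mem A.graded fun v hv => ?_⟩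
  choose h hv using hv
  by_cases hlt : ∃ i, h i < B
  · obtain ⟨i, hi⟩ := hlt
    rw [MultilinearMap.map_coord_zero _ i (VertexData.eq_zero_of_wt_eq_bot (hv i)
      (hB _ hi))]
    exact Submodule.zero_mem _
  · push Not at hlt
    have hle : k * B ≤ ∑ i, h i := by
      simpa using sum_le_sum fun i (_ : i ∈ univ) => hlt i
    exact Submodule.mem_iSup_of_mem (⟨_, hle⟩ : {n : ℤ // k * B ≤ n}) (tprod_mem_wt hv)

theorem tensorPower_lower_bound : ∃ N : ℤ, ∀ n : ℤ, n < N → (tensorPower A k).wt n = ⊥ := by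
  obtain ⟨N, hN⟩ := exists_iSup_tensorPower_wt_eq_top (A := A) (k := k)
  refine ⟨N, fun n hn => disjoint_top.mp (((tensorPower A k).wt_iSupIndep n).mono_right ?_)⟩
  rw [← hN]
  exact iSup_le fun m => le_iSup₂_of_le (m : ℤ) (hn.trans_le m.2).ne' le_rfl

variable (A k)

theorem tensorPower_isConformal : (tensorPower A k).IsConformal where
  truncation := tensorPower_truncation
  creation := tensorPower_creation
  derivative := tensorPower_derivative
  commutator := tensorPower_commutator
  conf_mem := by
    rw [tensorPower_conf]
    refine Submodule.sum_mem _ fun i _ => ?_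
    rw [VertexData.mem_wt_iff, tensorPower_L_inPosition (by norm_num),
      VertexData.mem_wt_iff.mp A.isConformal.conf_mem]
    exact MultilinearMap.map_update_smul _ _ _ _ _
  L_one_conf := by
    rw [tensorPower_conf, map_sum]
    refine sum_eq_zero fun i _ => ?_
    rw [tensorPower_L_inPosition (by norm_num), A.isConformal.L_one_conf]
    exact MultilinearMap.map_update_zero _ _ _
  graded := by
    obtain ⟨N, hN⟩ := exists_iSup_tensorPower_wt_eq_top (A := A) (k := k)
    rw [eq_top_iff, ← hN]
    exact iSup_le fun n => le_iSup (tensorPower A k).wt n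
  lower_bound := tensorPower_lower_bound

end TensorPower

section PermAction

variable {V : Type*} [AddCommGroup V] [Module ℂ V] {k : ℕ}

theorem permAction_tprod (σ : Equiv.Perm (Fin k)) (v : Fin k → V) :
    permAction V σ (PiTensorProduct.tprod ℂ v) =
      PiTensorProduct.tprod ℂ (fun i => v (σ.symm i)) :=
  PiTensorProduct.reindex_tprod _ _

theorem permAction_one : permAction V (1 : Equiv.Perm (Fin k)) = LinearMap.id :=
  tensor_ext fun v => permAction_tprod 1 v

theorem permAction_mul (σ τ : Equiv.Perm (Fin k)) :
    permAction V (σ * τ) = (permAction V σ * permAction V τ : Module.End ℂ _) :=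
  tensor_ext fun v => by
    rw [Module.End.mul_apply, permAction_tprod, permAction_tprod, permAction_tprod]
    rfl

theorem permAction_pow (σ : Equiv.Perm (Fin k)) (n : ℕ) :
    permAction V (σ ^ n) = (permAction V σ : Module.End ℂ _) ^ n := by
  induction n with
  | zero => exact permAction_one
  | succ n ih => rw [pow_succ, pow_succ, permAction_mul, ih]

theorem permAction_tprod_update (σ : Equiv.Perm (Fin k)) (v : Fin k → V) (i : Fin k) (x : V) :
    permAction V σ (PiTensorProduct.tprod ℂ (Function.update v i x)) =
      PiTensorProduct.tprod ℂ (Function.update (fun j => v (σ.symm j)) (σ i) x) := by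
  rw [permAction_tprod]
  exact congrArg _ (Function.update_comp_equiv v σ.symm i x)

theorem permAction_inPosition (A : VOA V) (σ : Equiv.Perm (Fin k)) (i : Fin k) (u : V) :
    permAction V σ (inPosition A k i u) = inPosition A k (σ i) u :=
  permAction_tprod_update σ _ i u

theorem permAction_positionOp (σ : Equiv.Perm (Fin k)) (i : Fin k) (φ : Module.End ℂ V)
    (x : ⨂[ℂ] _ : Fin k, V) :
    permAction V σ (positionOp i φ x) = positionOp (σ i) φ (permAction V σ x) := by
  suffices hcomp : permAction V σ ∘ₗ positionOp i φ = positionOp (σ i) φ ∘ₗ permAction V σ from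
    LinearMap.congr_fun hcomp x
  refine tensor_ext fun v => ?_
  rw [LinearMap.comp_apply, LinearMap.comp_apply, permAction_tprod, positionOp_tprod,
    positionOp_tprod, permAction_tprod_update, Equiv.symm_apply_apply]

theorem permAction_tensorPower_L (A : VOA V) (σ : Equiv.Perm (Fin k)) (n : ℤ)
    (x : ⨂[ℂ] _ : Fin k, V) :
    permAction V σ ((tensorPower A k).L n x) = (tensorPower A k).L n (permAction V σ x) := by
  simp only [tensorPower_L, LinearMap.sum_apply, map_sum, permAction_positionOp]
  exact Equiv.sum_comp σ fun i => positionOp i (A.L n) (permAction V σ x)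

theorem permAction_isConformalAut (A : VOA V) (hk : 0 < k) {σ : Equiv.Perm (Fin k)}
    (hσ : σ ^ k = 1) : IsConformalAut (tensorPower A k) (permAction V σ) k where
  pos := hk
  pow_eq_one := by
    rw [← permAction_pow, hσ, permAction_one]
    rfl
  map_conf := by
    rw [tensorPower_conf, map_sum, ← Equiv.sum_comp σ fun i => inPosition A k i A.conf]
    exact sum_congr rfl fun i _ => permAction_inPosition A σ i _
  map_L := permAction_tensorPower_L A σ

end PermAction

/-! ### Uniqueness of `T_σ(W)` -/

section Uniqueness

variable {V M : Type*} [AddCommGroup V] [Module ℂ V] [AddCommGroup M] [Module ℂ M]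

theorem exp_two_pi_mul_I_mul_div_eq_of_modEq {T : ℕ} (hT : 0 < T) {p r : ℤ} (h : p ≡ r [ZMOD T]) :
    Complex.exp (2 * Real.pi * Complex.I * p / T) =
      Complex.exp (2 * Real.pi * Complex.I * r / T) := by
  obtain ⟨c, hc⟩ := Int.modEq_iff_dvd.mp h
  have hT' : (T : ℂ) ≠ 0 := Nat.cast_ne_zero.mpr hT.ne'
  refine Complex.exp_eq_exp_iff_exists_int.mpr ⟨-c, ?_⟩
  rw [eq_add_of_sub_eq hc]
  push_cast
  field_simp
  ring

namespace IsWeakTwistedModule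

variable {A : VertexData V} {g : V →ₗ[ℂ] V} {T : ℕ} {Y Y₁ Y₂ : V →ₗ[ℂ] (ℤ → Module.End ℂ M)}

theorem mode_aut (hY : IsWeakTwistedModule A g T Y) (hg : IsConformalAut A g T) (v : V) (p : ℤ) :
    Y (g v) p = Complex.exp (2 * Real.pi * Complex.I * p / T) • Y v p := by
  suffices heq : (LinearMap.proj p : (ℤ → Module.End ℂ M) →ₗ[ℂ] _) ∘ₗ Y ∘ₗ g =
      Complex.exp (2 * Real.pi * Complex.I * p / T) •
        ((LinearMap.proj p : (ℤ → Module.End ℂ M) →ₗ[ℂ] _) ∘ₗ Y) from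
    LinearMap.congr_fun heq v
  refine linearMap_ext_of_iSup_eq_top
    (iSup_eigenspace_eq_top_of_pow_eq_one hg.pos hg.pow_eq_one) fun r u hu => ?_
  rw [Module.End.mem_eigenspace_iff] at hu
  change Y (g u) p = Complex.exp (2 * Real.pi * Complex.I * p / T) • Y u p
  by_cases hp : p ≡ r [ZMOD T]
  · rw [hu, map_smul, Pi.smul_apply, exp_two_pi_mul_I_mul_div_eq_of_modEq hg.pos hp]
  · rw [hu, map_smul, Pi.smul_apply, hY.support r u hu p hp, smul_zero, smul_zero]

variable (hY₁ : IsWeakTwistedModule A g T Y₁) (hY₂ : IsWeakTwistedModule A g T Y₂)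
  (hA : A.IsConformal)
include hY₁ hY₂ hA

theorem mode_eq_of_mode_add_succ_eq (hT : 0 < T) {r : ℤ} {u v : V}
    (hgu : g u = Complex.exp (2 * Real.pi * Complex.I * r / T) • u) (hu : Y₁ u = Y₂ u)
    (hv : Y₁ v = Y₂ v) {l : ℤ}
    (hl : ∀ i : ℕ, Y₁ (A.Y u (l + (i + 1 : ℕ)) v) = Y₂ (A.Y u (l + (i + 1 : ℕ)) v)) :
    Y₁ (A.Y u l v) = Y₂ (A.Y u l v) := by
  ext q w
  obtain ⟨N, ⟨h₁, h₂⟩, hN⟩ :=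
    (((hY₁.eventually_jacobi_sum hA hT hgu v w l r (q - r) (Int.ModEq.refl r)).and
      (hY₂.eventually_jacobi_sum hA hT hgu v w l r (q - r) (Int.ModEq.refl r))).and
      (eventually_gt_atTop 0)).exists
  obtain ⟨N, rfl⟩ := Nat.exists_eq_add_of_le' hN
  simp only [← hu, ← hv] at h₂
  have hsum := h₁.trans h₂.symm
  simp only [sum_range_succ', hl] at hsum
  simpa [binom_zero_right] using add_left_cancel hsum

theorem mode_eq_of_apply_eq_exp_smul (hT : 0 < T) {r : ℤ} {u v : V}
    (hgu : g u = Complex.exp (2 * Real.pi * Complex.I * r / T) • u) (hu : Y₁ u = Y₂ u)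
    (hv : Y₁ v = Y₂ v) (l : ℤ) : Y₁ (A.Y u l v) = Y₂ (A.Y u l v) := by
  obtain ⟨N, hN⟩ := hA.truncation u v
  suffices hind : ∀ (j : ℕ) (l : ℤ), N - j ≤ l → Y₁ (A.Y u l v) = Y₂ (A.Y u l v) from
    hind (N - l).toNat l (by omega)
  intro j
  induction j with
  | zero =>
    intro l hl
    rw [hN l (by omega), map_zero, map_zero]
  | succ j ih =>
    intro l hl
    exact hY₁.mode_eq_of_mode_add_succ_eq hY₂ hA hT hgu hu hv fun i => ih _ (by omega)

theorem mode_mem_eqLocus (hg : IsConformalAut A g T) {u v : V} (hu : u ∈ LinearMap.eqLocus Y₁ Y₂)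
    (hv : v ∈ LinearMap.eqLocus Y₁ Y₂) (l : ℤ) : A.Y u l v ∈ LinearMap.eqLocus Y₁ Y₂ := by
  have hgK : ∀ x ∈ LinearMap.eqLocus Y₁ Y₂, g x ∈ LinearMap.eqLocus Y₁ Y₂ := by
    intro x hx
    rw [LinearMap.mem_eqLocus] at hx ⊢
    ext1 p
    rw [hY₁.mode_aut hg, hY₂.mode_aut hg, hx]
  let evalMode : V →ₗ[ℂ] V := LinearMap.applyₗ v ∘ₗ LinearMap.proj l ∘ₗ A.Y
  suffices hle : LinearMap.eqLocus Y₁ Y₂ ≤ (LinearMap.eqLocus Y₁ Y₂).comap evalMode from hle hu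
  refine (le_iSup_inf_eigenspace_of_pow_eq_one hg.pos hg.pow_eq_one hgK).trans
    (iSup_le fun r x hx => ?_)
  exact hY₁.mode_eq_of_apply_eq_exp_smul hY₂ hA hg.pos (Module.End.mem_eigenspace_iff.mp hx.2)
    hx.1 hv l

end IsWeakTwistedModule

end Uniqueness

section InPosition

variable {V : Type*} [AddCommGroup V] [Module ℂ V] (A : VOA V) (k : ℕ)

/-- The inclusion `u ↦ 𝟏 ⊗ ⋯ ⊗ u ⊗ ⋯ ⊗ 𝟏` of the `i`-th tensor factor, as a linear map. -/
def inPositionLinear (i : Fin k) : V →ₗ[ℂ] ⨂[ℂ] _ : Fin k, V :=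
  (PiTensorProduct.tprod ℂ).toLinearMap (fun _ => A.vac) i

theorem inPositionLinear_apply (i : Fin k) (u : V) :
    inPositionLinear A k i u = inPosition A k i u :=
  rfl

theorem tprod_mem_of_inPosition_mem [NeZero k] {S : Submodule ℂ (⨂[ℂ] _ : Fin k, V)}
    (hpos : ∀ i u, inPosition A k i u ∈ S)
    (hmode : ∀ u ∈ S, ∀ v ∈ S, ∀ l, (tensorPower A k).Y u l v ∈ S) (s : Finset (Fin k)) :
    ∀ v : Fin k → V, (∀ i ∉ s, v i = A.vac) → PiTensorProduct.tprod ℂ v ∈ S := by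
  induction s using Finset.induction_on with
  | empty =>
    intro v hv
    obtain rfl : v = fun _ => A.vac := funext fun i => hv i (notMem_empty i)
    simpa [inPosition] using hpos 0 A.vac
  | insert i s _ ih =>
    intro v hv
    have hmem := hmode _ (hpos i (v i)) _ (ih (Function.update v i A.vac) fun j hj => by
      obtain rfl | h := eq_or_ne j i
      · rw [Function.update_self]
      · rw [Function.update_of_ne h, hv j (by simp [h, hj])]) (-1)
    rwa [tensorPower_Y_inPosition, positionOp_tprod, Function.update_self, (A.creation _).1,
      Function.update_idem, Function.update_eq_self] at hmem

theorem eq_top_of_inPosition_mem [NeZero k] {S : Submodule ℂ (⨂[ℂ] _ : Fin k, V)}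
    (hpos : ∀ i u, inPosition A k i u ∈ S)
    (hmode : ∀ u ∈ S, ∀ v ∈ S, ∀ l, (tensorPower A k).Y u l v ∈ S) : S = ⊤ := by
  rw [eq_top_iff, ← PiTensorProduct.span_tprod_eq_top, Submodule.span_le]
  rintro _ ⟨v, rfl⟩
  exact tprod_mem_of_inPosition_mem A k hpos hmode univ v fun i hi => absurd (mem_univ i) hi

variable {A k}

theorem tensorPower_dividedPow_L_one_inPosition (i : Fin k) (j : ℕ) (u : V) :
    dividedPow ((tensorPower A k).L 1) j (inPosition A k i u) =
      inPosition A k i (dividedPow (A.L 1) j u) :=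
  (dividedPow_apply_of_semiconj (f := inPositionLinear A k i)
    (fun x => (tensorPower_L_inPosition (by norm_num) i x).symm) j u).symm

theorem inPosition_mem_wt (i : Fin k) {n : ℤ} {u : V} (hu : u ∈ A.wt n) :
    inPosition A k i u ∈ (tensorPower A k).wt n := by
  rw [VertexData.mem_wt_iff, tensorPower_L_inPosition (by norm_num), VertexData.mem_wt_iff.mp hu,
    ← inPositionLinear_apply, map_smul]
  rfl

end InPosition

section CycleTwist

theorem pow_eq_one_of_isCycleOn_univ {k : ℕ} {σ : Equiv.Perm (Fin k)}
    (hσ : σ.IsCycleOn Set.univ) : σ ^ k = 1 := by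
  rw [← coe_univ] at hσ
  ext i
  simpa using congrArg Fin.val (hσ.pow_card_apply (mem_univ i))

theorem isCycleOn_univ_induction {α : Type*} [Finite α] {σ : Equiv.Perm α}
    (hσ : σ.IsCycleOn Set.univ) {a : α} {P : α → Prop} (base : P a)
    (step : ∀ x, P x → P (σ x)) (x : α) : P x := by
  obtain ⟨n, rfl⟩ := hσ.exists_pow_eq' Set.finite_univ (Set.mem_univ a) (Set.mem_univ x)
  rw [← Equiv.Perm.iterate_eq_pow]
  exact Function.Iterate.rec P base (fun x hx => step x hx) n

namespace IsCycleTwist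

variable {V W : Type*} [AddCommGroup V] [Module ℂ V] [AddCommGroup W] [Module ℂ W]
  {A : VOA V} {k : ℕ} [NeZero k] {σ : Equiv.Perm (Fin k)} {YW : V →ₗ[ℂ] (ℤ → Module.End ℂ W)}
  {YT Y₁ Y₂ : (⨂[ℂ] _ : Fin k, V) →ₗ[ℂ] (ℤ → Module.End ℂ W)}

theorem inPosition_zero_mem_eqLocus (h₁ : IsCycleTwist A k σ YW Y₁)
    (h₂ : IsCycleTwist A k σ YW Y₂) (u : V) :
    inPosition A k 0 u ∈ LinearMap.eqLocus Y₁ Y₂ := by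
  suffices heq : Y₁ ∘ₗ inPositionLinear A k 0 = Y₂ ∘ₗ inPositionLinear A k 0 from
    LinearMap.congr_fun heq u
  refine linearMap_ext_of_iSup_eq_top A.graded fun n v hv => funext fun p => ?_
  exact (h₁.field n v hv p).trans (h₂.field n v hv p).symm

variable (hσ : σ.IsCycleOn Set.univ)
include hσ

theorem mode_inPosition_apply (hT : IsCycleTwist A k σ YW YT) (i : Fin k) (u : V) (p : ℤ) :
    YT (inPosition A k (σ i) u) p =
      Complex.exp (2 * Real.pi * Complex.I * p / k) • YT (inPosition A k i u) p := by
  rw [← permAction_inPosition, hT.twisted.mode_aut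
    (permAction_isConformalAut A (NeZero.pos k) (pow_eq_one_of_isCycleOn_univ hσ))]

theorem unique (h₁ : IsCycleTwist A k σ YW Y₁) (h₂ : IsCycleTwist A k σ YW Y₂) : Y₁ = Y₂ := by
  rw [← LinearMap.eqLocus_eq_top]
  refine eq_top_of_inPosition_mem A k (fun i u => ?_) fun u hu v hv l =>
    h₁.twisted.mode_mem_eqLocus h₂.twisted (tensorPower_isConformal A k)
      (permAction_isConformalAut A (NeZero.pos k) (pow_eq_one_of_isCycleOn_univ hσ)) hu hv l
  refine isCycleOn_univ_induction hσ (P := fun i => inPosition A k i u ∈ LinearMap.eqLocus Y₁ Y₂)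
    (h₁.inPosition_zero_mem_eqLocus h₂ u) (fun i hi => ?_) i
  rw [LinearMap.mem_eqLocus] at hi ⊢
  ext1 p
  rw [h₁.mode_inPosition_apply hσ, h₂.mode_inPosition_apply hσ, hi]

end IsCycleTwist

end CycleTwist

/-! ### The coefficients of `Δ_k` -/

section Delta

variable {V W : Type*} [AddCommGroup V] [Module ℂ V] [AddCommGroup W] [Module ℂ W]

section VertexData

variable (A : VertexData V) (k : ℕ) [NeZero k]

theorem deltaExponent_eq_fieldSeries :
    deltaExponent A k = fieldSeries (fun n : ℕ => A.L n) (X * mk (deltaSeq k)) := by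
  ext1 n
  rw [deltaExponent, coeff_mk, coeff_fieldSeries]
  obtain _ | n := n
  · simp
  · rw [if_neg n.succ_ne_zero, coeff_succ_X_mul, coeff_mk, Nat.add_sub_cancel]

theorem deltaExpCoeff_eq_coeff_expSeries (j : ℕ) :
    deltaExpCoeff A k j = coeff j (expSeries (deltaExponent A k)) := by
  simp only [deltaExpCoeff, coeff_expSeries, dividedPow, PowerSeries.coeff_smul]

theorem deltaExpCoeff_zero : deltaExpCoeff A k 0 = 1 := by
  simp [deltaExpCoeff]

variable {A k}

theorem deltaFieldMode_eq_sum (Y : V →ₗ[ℂ] (ℤ → Module.End ℂ W)) (n p : ℤ) {u : V} {N : ℕ}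
    (hN : ∀ j, N ≤ j → deltaExpCoeff A k j u = 0) :
    deltaFieldMode A k Y n u p = (k : ℂ) ^ (-n) • ∑ j ∈ range N,
      Y (deltaExpCoeff A k j u) (p + k - 1 + (1 - k) * n - j) := by
  have hterm : ∀ j : ℕ, Y (deltaCoeff A k n j u) (p + k - 1 + (1 - k) * n - j) =
      (k : ℂ) ^ (-n) • Y (deltaExpCoeff A k j u) (p + k - 1 + (1 - k) * n - j) := fun j => by
    rw [deltaCoeff, LinearMap.smul_apply, map_smul, Pi.smul_apply]
  simp only [deltaFieldMode, hterm, smul_sum]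
  exact finsum_eq_sum_range fun j hj => by rw [hN j hj, map_zero, Pi.zero_apply, smul_zero]

end VertexData

namespace VOA

variable (A : VOA V) (k : ℕ) [NeZero k]

theorem L_commutator_natCast (m n : ℕ) :
    A.L m * A.L n - A.L n * A.L m = ((m : ℂ) - n) • A.L (m + n : ℕ) := by
  obtain ⟨c, hc⟩ := A.virasoro
  rw [hc]
  by_cases h : (m : ℤ) + n = 0
  · obtain rfl : m = 0 := by omega
    simp
  · simp [h]

theorem sum_deltaExpCoeff_mul_dividedPow_L_one (s : ℕ) :
    ∑ p ∈ antidiagonal s,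
        deltaExpCoeff A.toVertexData k p.1 * ((k : ℂ) ^ p.2 • dividedPow (A.L 1) p.2) =
      ∑ p ∈ antidiagonal s,
        dividedPow (A.L 1) p.1 * ((-1 : ℂ) ^ p.2 • deltaExpCoeff A.toVertexData k p.2) := by
  have hexp := congrArg (coeff s) (expSeries_deltaSeq_mul_scaleSeries A.L_commutator_natCast k)
  simpa only [coeff_mul, coeff_scaleSeries, expSeries_fieldSeries_X, Nat.cast_one,
    ← deltaExponent_eq_fieldSeries, ← deltaExpCoeff_eq_coeff_expSeries] using hexp

variable {A}

theorem deltaExpCoeff_mem {h : ℤ} {v : V} (hv : v ∈ A.wt h) (j : ℕ) :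
    deltaExpCoeff A.toVertexData k j v ∈ A.wt (h - j) := by
  have hweight := LinearMap.congr_fun (expSeries_mem_weightSeries
    (fieldSeries_mem_weightSeries A.L_commutator_natCast (X * PowerSeries.mk (deltaSeq k))) j) v
  rw [← deltaExponent_eq_fieldSeries, ← deltaExpCoeff_eq_coeff_expSeries, LinearMap.sub_apply,
    Module.End.mul_apply, Module.End.mul_apply, Nat.cast_zero, VertexData.mem_wt_iff.mp hv,
    map_smul, LinearMap.smul_apply, sub_eq_iff_eq_add, ← add_smul] at hweight
  rw [VertexData.mem_wt_iff, hweight]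
  congr 1
  push_cast
  ring

theorem deltaExpCoeff_eq_zero {h : ℤ} {v : V} (hv : v ∈ A.wt h) {j : ℕ}
    (hj : A.wt (h - j) = ⊥) : deltaExpCoeff A.toVertexData k j v = 0 :=
  VertexData.eq_zero_of_wt_eq_bot (deltaExpCoeff_mem k hv j) hj

variable (A)

theorem coeff_deltaExponent_vac (j : ℕ) : coeff j (deltaExponent A.toVertexData k) A.vac = 0 := by
  rw [deltaExponent, coeff_mk]
  split_ifs
  · rfl
  · rw [LinearMap.smul_apply, A.L_vac (by omega), smul_zero]

theorem coeff_deltaExponent_conf_mem (j : ℕ) :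
    coeff j (deltaExponent A.toVertexData k) A.conf ∈ ℂ ∙ A.vac := by
  rw [deltaExponent, coeff_mk]
  split_ifs
  · exact Submodule.zero_mem _
  · obtain ⟨c, hc⟩ := A.exists_L_conf
    rw [LinearMap.smul_apply, hc j (by omega), A.L_vac (by omega), smul_zero, zero_add]
    exact Submodule.smul_mem _ _ (Submodule.smul_mem _ _ (Submodule.mem_span_singleton_self _))

theorem coeff_deltaExponent_pow_vac_mem (m j : ℕ) :
    (coeff j (deltaExponent A.toVertexData k ^ m) : Module.End ℂ V) A.vac ∈ ℂ ∙ A.vac := by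
  obtain _ | m := m
  · rw [pow_zero, coeff_one]
    split_ifs
    · exact Submodule.mem_span_singleton_self _
    · exact Submodule.zero_mem _
  · rw [pow_succ, coeff_mul, LinearMap.sum_apply]
    refine Submodule.sum_mem _ fun p _ => ?_
    rw [Module.End.mul_apply, coeff_deltaExponent_vac, map_zero]
    exact Submodule.zero_mem _

theorem coeff_deltaExponent_pow_succ_conf_mem (m j : ℕ) :
    (coeff j (deltaExponent A.toVertexData k ^ (m + 1)) : Module.End ℂ V) A.conf ∈ ℂ ∙ A.vac := by
  rw [pow_succ, coeff_mul, LinearMap.sum_apply]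
  refine Submodule.sum_mem _ fun p _ => ?_
  obtain ⟨c, hc⟩ := Submodule.mem_span_singleton.mp (A.coeff_deltaExponent_conf_mem k p.2)
  rw [Module.End.mul_apply, ← hc, map_smul]
  exact Submodule.smul_mem _ _ (A.coeff_deltaExponent_pow_vac_mem k m p.1)

theorem deltaExpCoeff_succ_conf_mem (j : ℕ) :
    deltaExpCoeff A.toVertexData k (j + 1) A.conf ∈ ℂ ∙ A.vac := by
  rw [deltaExpCoeff, LinearMap.sum_apply]
  refine Submodule.sum_mem _ fun m _ => Submodule.smul_mem _ _ ?_
  obtain _ | m := m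
  · rw [pow_zero, coeff_one, if_neg j.succ_ne_zero]
    exact Submodule.zero_mem _
  · exact A.coeff_deltaExponent_pow_succ_conf_mem k m (j + 1)

end VOA

end Delta

/-! ### The grading of `T_σ(W)` -/

section AffineEigenspace

variable {W : Type*} [AddCommGroup W] [Module ℂ W] (L : Module.End ℂ W) {a : ℂ} (ha : a ≠ 0) (c : ℂ)
include ha

theorem eigenspace_smul_add_smul_one (μ : ℂ) :
    Module.End.eigenspace (a • L + c • 1) μ = Module.End.eigenspace L (a⁻¹ * (μ - c)) := by
  ext w
  rw [Module.End.mem_eigenspace_iff, Module.End.mem_eigenspace_iff, LinearMap.add_apply,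
    LinearMap.smul_apply, LinearMap.smul_apply, Module.End.one_apply, ← eq_sub_iff_add_eq,
    ← sub_smul, mul_smul, eq_inv_smul_iff₀ ha]

theorem restrictedDual_smul_add_smul_one : restrictedDual (a • L + c • 1) = restrictedDual L := by
  ext f
  let e : ℂ ≃ ℂ := (Equiv.subRight c).trans (Equiv.mulLeft₀ a⁻¹ (inv_ne_zero ha))
  have hsupport : {μ : ℂ | ∃ w ∈ Module.End.eigenspace (a • L + c • 1) μ, f w ≠ 0} =
      e ⁻¹' {μ : ℂ | ∃ w ∈ Module.End.eigenspace L μ, f w ≠ 0} := by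
    ext μ
    simp only [eigenspace_smul_add_smul_one L ha]
    rfl
  change Set.Finite _ ↔ Set.Finite _
  rw [hsupport]
  exact ⟨fun h => h.of_preimage e.surjective, fun h => h.preimage e.injective.injOn⟩

end AffineEigenspace

theorem IsWeakTwistedModule.mode_mem_span_one {V M : Type*} [AddCommGroup V] [Module ℂ V]
    [AddCommGroup M] [Module ℂ M] {A : VertexData V} {g : Module.End ℂ V} {T : ℕ}
    {Y : V →ₗ[ℂ] (ℤ → Module.End ℂ M)} (hY : IsWeakTwistedModule A g T Y) {v : V}
    (hv : v ∈ ℂ ∙ A.vac) (p : ℤ) : Y v p ∈ ℂ ∙ (1 : Module.End ℂ M) := by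
  obtain ⟨c, rfl⟩ := Submodule.mem_span_singleton.mp hv
  rw [map_smul, Pi.smul_apply, hY.vacuum]
  split_ifs
  · exact Submodule.smul_mem _ _ (Submodule.mem_span_singleton_self _)
  · rw [smul_zero]
    exact Submodule.zero_mem _

namespace IsCycleTwist

variable {V W : Type*} [AddCommGroup V] [Module ℂ V] [AddCommGroup W] [Module ℂ W]
  {A : VOA V} {k : ℕ} [NeZero k] {σ : Equiv.Perm (Fin k)} {YW : V →ₗ[ℂ] (ℤ → Module.End ℂ W)}
  {YT : (⨂[ℂ] _ : Fin k, V) →ₗ[ℂ] (ℤ → Module.End ℂ W)}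

theorem exists_mode_inPosition_zero_conf_eq (hT : IsCycleTwist A k σ YW YT)
    (hW : IsWeakTwistedModule A.toVertexData LinearMap.id 1 YW) :
    ∃ c : ℂ, YT (inPosition A k 0 A.conf) k = (k : ℂ) ^ (-2 : ℤ) • YW A.conf 1 + c • 1 := by
  have hA := A.isConformal
  obtain ⟨N, hN⟩ := hA.exists_wt_eq_bot 2
  have htail : (k : ℂ) ^ (-2 : ℤ) • ∑ j ∈ range N,
      YW (deltaExpCoeff A.toVertexData k (j + 1) A.conf)
        (k + k - 1 + (1 - k) * 2 - (j + 1 : ℕ)) ∈ ℂ ∙ (1 : Module.End ℂ W) :=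
    Submodule.smul_mem _ _ (Submodule.sum_mem _ fun j _ =>
      hW.mode_mem_span_one (A.deltaExpCoeff_succ_conf_mem k j) _)
  obtain ⟨c, hc⟩ := Submodule.mem_span_singleton.mp htail
  refine ⟨c, ?_⟩
  rw [hT.field 2 _ hA.conf_mem, deltaFieldMode_eq_sum YW (N := N + 1) 2 k fun j hj =>
    VOA.deltaExpCoeff_eq_zero k hA.conf_mem (hN j (by omega)), sum_range_succ', smul_add, hc,
    add_comm, deltaExpCoeff_zero, Module.End.one_apply]
  congr 2
  exact congrArg (YW A.conf) (by push_cast; ring)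

variable (hσ : σ.IsCycleOn Set.univ)
include hσ

theorem mode_inPosition_eq_mode_inPosition_zero (hT : IsCycleTwist A k σ YW YT) (i : Fin k)
    (u : V) : YT (inPosition A k i u) k = YT (inPosition A k 0 u) k := by
  have hk : (k : ℂ) ≠ 0 := Nat.cast_ne_zero.mpr (NeZero.ne k)
  refine isCycleOn_univ_induction hσ
    (P := fun i => YT (inPosition A k i u) k = YT (inPosition A k 0 u) k) rfl (fun i hi => ?_) i
  rw [hT.mode_inPosition_apply hσ, Int.cast_natCast, mul_div_cancel_right₀ _ hk,
    Complex.exp_two_pi_mul_I, one_smul, hi]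

theorem exists_L_zero_eq (hT : IsCycleTwist A k σ YW YT)
    (hW : IsWeakTwistedModule A.toVertexData LinearMap.id 1 YW) :
    ∃ c : ℂ, YT (tensorPower A k).conf k = (k : ℂ)⁻¹ • YW A.conf 1 + c • 1 := by
  obtain ⟨c, hc⟩ := hT.exists_mode_inPosition_zero_conf_eq hW
  have hconf : (tensorPower A k).conf = ∑ i, inPosition A k i A.conf := rfl
  refine ⟨k * c, ?_⟩
  simp only [hconf, map_sum, Finset.sum_apply, hT.mode_inPosition_eq_mode_inPosition_zero hσ, hc]
  rw [sum_const, card_univ, Fintype.card_fin, ← Nat.cast_smul_eq_nsmul ℂ, smul_add, smul_smul,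
    smul_smul]
  congr 2
  have hk : (k : ℂ) ≠ 0 := Nat.cast_ne_zero.mpr (NeZero.ne k)
  rw [zpow_neg, zpow_ofNat]
  field_simp

theorem isTwistedModule (hT : IsCycleTwist A k σ YW YT) (hW : IsVOAModule A YW) :
    IsTwistedModule (tensorPower A k) (permAction V σ) k YT := by
  have hk : (k : ℂ) ≠ 0 := Nat.cast_ne_zero.mpr (NeZero.ne k)
  obtain ⟨c, hc⟩ := hT.exists_L_zero_eq hσ hW.toIsWeakTwistedModule
  have heigenspace : ∀ μ, Module.End.eigenspace (YT (tensorPower A k).conf k) μ =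
      Module.End.eigenspace (YW A.conf (1 : ℕ)) (k * (μ - c)) := fun μ => by
    rw [hc, eigenspace_smul_add_smul_one _ (inv_ne_zero hk), inv_inv, Nat.cast_one]
  refine { hT.twisted with graded := ?_, finite := fun μ => ?_, lower_bound := fun μ => ?_ }
  · have hsurj : Function.Surjective fun μ : ℂ => k * (μ - c) := fun ν =>
      ⟨ν / k + c, by field_simp; ring⟩
    exact (iSup_congr heigenspace).trans ((hsurj.iSup_comp _).trans hW.graded)
  · rw [heigenspace]
    exact hW.finite _
  · obtain ⟨N, hN⟩ := hW.lower_bound (k * (μ - c))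
    refine ⟨N, fun n hn => ?_⟩
    rw [heigenspace, ← hN n hn]
    congr 1
    push_cast
    field_simp
    ring

theorem restrictedDual_eq (hT : IsCycleTwist A k σ YW YT)
    (hW : IsWeakTwistedModule A.toVertexData LinearMap.id 1 YW) :
    restrictedDual (YW A.conf 1) = restrictedDual (YT (tensorPower A k).conf k) := by
  obtain ⟨c, hc⟩ := hT.exists_L_zero_eq hσ hW
  rw [hc, restrictedDual_smul_add_smul_one _ (inv_ne_zero (Nat.cast_ne_zero.mpr (NeZero.ne k)))]

end IsCycleTwist

/-! ### The contragredient module of `T_σ(W)` -/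

section Contragredient

variable {V W : Type*} [AddCommGroup V] [Module ℂ V] [AddCommGroup W] [Module ℂ W]
  {A : VOA V} {k : ℕ} [NeZero k] {σ : Equiv.Perm (Fin k)} {YW : V →ₗ[ℂ] (ℤ → Module.End ℂ W)}
  {YT : (⨂[ℂ] _ : Fin k, V) →ₗ[ℂ] (ℤ → Module.End ℂ W)}

theorem VOA.sum_mode_deltaExpCoeff_dividedPow_L_one (Y : V →ₗ[ℂ] (ℤ → Module.End ℂ W)) {n : ℤ}
    {u : V} (hu : u ∈ A.wt n) {N : ℕ} (hN : ∀ s : ℕ, N ≤ s → A.wt (n - s) = ⊥) (q : ℤ) :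
    ∑ i ∈ range N, ∑ j ∈ range N,
        Y (deltaExpCoeff A.toVertexData k i ((k : ℂ) ^ j • dividedPow (A.L 1) j u))
          (q - (i + j : ℕ)) =
      ∑ j ∈ range N, ∑ i ∈ range N,
        Y (dividedPow (A.L 1) j ((-1 : ℂ) ^ i • deltaExpCoeff A.toVertexData k i u))
          (q - (j + i : ℕ)) := by
  have hbot : ∀ i j : ℕ, N ≤ i + j → A.wt (n - j - i) = ⊥ := fun i j hij => by
    rw [sub_sub, ← Nat.cast_add, add_comm]
    exact hN _ hij
  rw [sum_range_sum_range_eq_sum_antidiagonal fun i j hij => ?left,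
    sum_range_sum_range_eq_sum_antidiagonal fun j i hij => ?right]
  case left =>
    rw [VOA.deltaExpCoeff_eq_zero k (Submodule.smul_mem _ _
      (A.isConformal.dividedPow_L_one_mem hu j)) (hbot i j hij), map_zero, Pi.zero_apply]
  case right =>
    rw [VertexData.eq_zero_of_wt_eq_bot (A.isConformal.dividedPow_L_one_mem
      (Submodule.smul_mem _ _ (VOA.deltaExpCoeff_mem k hu i)) j) (hbot j i hij), map_zero,
      Pi.zero_apply]
  refine sum_congr rfl fun s _ => ?_
  have hmode := congrArg (fun φ : Module.End ℂ V => Y (φ u) (q - s))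
    (A.sum_deltaExpCoeff_mul_dividedPow_L_one k s)
  simp only [LinearMap.sum_apply, map_sum, Finset.sum_apply] at hmode
  refine Eq.trans (sum_congr rfl fun p hp => ?_) (hmode.trans (sum_congr rfl fun p hp => ?_)) <;>
    rw [mem_antidiagonal.mp hp] <;> rfl

theorem VOA.contragredientMode_deltaExpCoeff (Y : V →ₗ[ℂ] (ℤ → Module.End ℂ W)) {n : ℤ}
    {u : V} (hu : u ∈ A.wt n) {N : ℕ} (hN : ∀ s : ℕ, N ≤ s → A.wt (n - s) = ⊥) (i : ℕ) (p : ℤ) :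
    contragredientMode A.toVertexData 1 Y (n - i) (deltaExpCoeff A.toVertexData k i u)
        (p + k - 1 + (1 - k) * n - i) =
      (-1 : ℂ) ^ n • ∑ j ∈ range N,
        Y (dividedPow (A.L 1) j ((-1 : ℂ) ^ i • deltaExpCoeff A.toVertexData k i u))
          (-p + k * n - k - 1 + n - (j + i : ℕ)) := by
  have hvanish : ∀ j, N ≤ j →
      dividedPow (A.L 1) j (deltaExpCoeff A.toVertexData k i u) = 0 := fun j hj => by
    refine VertexData.eq_zero_of_wt_eq_bot
      (A.isConformal.dividedPow_L_one_mem (VOA.deltaExpCoeff_mem k hu i) j) ?_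
    rw [sub_sub, ← Nat.cast_add]
    exact hN _ (by omega)
  have hsign : (-1 : ℂ) ^ (n - i) = (-1 : ℂ) ^ n * (-1) ^ i := by
    rw [zpow_sub₀ (by norm_num), zpow_natCast, div_eq_mul_inv, ← inv_pow, inv_neg_one]
  rw [contragredientMode_eq_sum _ _ _ _ _ hvanish, hsign, mul_smul, smul_sum]
  refine congrArg _ (sum_congr rfl fun j _ => ?_)
  rw [map_smul, map_smul, Pi.smul_apply]
  exact congrArg _ (congrArg (Y _) (by push_cast; ring))

namespace IsCycleTwist

theorem mode_inPosition_zero_dividedPow_L_one (hT : IsCycleTwist A k σ YW YT) {n : ℤ} {u : V}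
    (hu : u ∈ A.wt n) {N : ℕ} (hN : ∀ s : ℕ, N ≤ s → A.wt (n - s) = ⊥) (j : ℕ) (p : ℤ) :
    YT (inPosition A k 0 (dividedPow (A.L 1) j u)) (-p + k * (2 * n - j - 2)) =
      (k : ℂ) ^ (-n) • ∑ i ∈ range N,
        YW (deltaExpCoeff A.toVertexData k i ((k : ℂ) ^ j • dividedPow (A.L 1) j u))
          (-p + k * n - k - 1 + n - (i + j : ℕ)) := by
  have hk : (k : ℂ) ≠ 0 := Nat.cast_ne_zero.mpr (NeZero.ne k)
  have hmem := A.isConformal.dividedPow_L_one_mem hu j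
  have hvanish : ∀ i, N ≤ i →
      deltaExpCoeff A.toVertexData k i (dividedPow (A.L 1) j u) = 0 := fun i hi => by
    refine VOA.deltaExpCoeff_eq_zero k hmem ?_
    rw [sub_sub, ← Nat.cast_add]
    exact hN _ (by omega)
  rw [hT.field _ _ hmem, deltaFieldMode_eq_sum YW _ _ hvanish, neg_sub, sub_eq_neg_add,
    zpow_add₀ hk, zpow_natCast, mul_smul, smul_sum]
  refine congrArg _ (sum_congr rfl fun i _ => ?_)
  rw [map_smul, map_smul, Pi.smul_apply]
  exact congrArg _ (congrArg (YW _) (by push_cast; ring))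

theorem contragredientMode_inPosition_zero (hT : IsCycleTwist A k σ YW YT) {n : ℤ} {u : V}
    (hu : u ∈ A.wt n) {N : ℕ} (hN : ∀ s : ℕ, N ≤ s → A.wt (n - s) = ⊥) (p : ℤ) :
    contragredientMode (tensorPower A k) k YT n (inPosition A k 0 u) p =
      (k : ℂ) ^ (-n) • ∑ i ∈ range N, contragredientMode A.toVertexData 1 YW (n - i)
        (deltaExpCoeff A.toVertexData k i u) (p + k - 1 + (1 - k) * n - i) := by
  have hvanish : ∀ j, N ≤ j →
      dividedPow ((tensorPower A k).L 1) j (inPosition A k 0 u) = 0 := fun j hj => by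
    rw [tensorPower_dividedPow_L_one_inPosition, VertexData.eq_zero_of_wt_eq_bot
      (A.isConformal.dividedPow_L_one_mem hu j) (hN j hj), ← inPositionLinear_apply, map_zero]
  rw [contragredientMode_eq_sum _ _ _ _ _ hvanish]
  simp only [tensorPower_dividedPow_L_one_inPosition,
    hT.mode_inPosition_zero_dividedPow_L_one hu hN, VOA.contragredientMode_deltaExpCoeff YW hu hN]
  rw [← smul_sum, ← smul_sum, smul_comm, sum_comm,
    VOA.sum_mode_deltaExpCoeff_dividedPow_L_one YW hu hN, sum_comm]

theorem contragredient (hT : IsCycleTwist A k σ YW YT) {σ' : Equiv.Perm (Fin k)}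
    {D : Submodule ℂ (Module.Dual ℂ W)} {YW' : V →ₗ[ℂ] (ℤ → Module.End ℂ D)}
    (hYW' : IsContragredient A.toVertexData 1 YW D YW')
    {YT' : (⨂[ℂ] _ : Fin k, V) →ₗ[ℂ] (ℤ → Module.End ℂ D)}
    (hYT' : IsContragredient (tensorPower A k) k YT D YT')
    (htwisted : IsWeakTwistedModule (tensorPower A k) (permAction V σ') k YT') :
    IsCycleTwist A k σ' YW' YT' where
  twisted := htwisted
  field n u hu p := by
    obtain ⟨N, hN⟩ := A.isConformal.exists_wt_eq_bot n
    refine LinearMap.ext fun f => Subtype.ext (LinearMap.ext fun w => ?_)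
    rw [hYT'.2 n _ (inPosition_mem_wt 0 hu), hT.contragredientMode_inPosition_zero hu hN,
      deltaFieldMode_eq_sum YW' n p fun j hj => VOA.deltaExpCoeff_eq_zero k hu (hN j hj)]
    simp only [LinearMap.smul_apply, LinearMap.sum_apply, map_smul, map_sum, Submodule.coe_smul,
      Submodule.coe_sum]
    exact congrArg _ (sum_congr rfl fun i _ =>
      (hYW'.2 _ _ (VOA.deltaExpCoeff_mem k hu i) _ f w).symm)

end IsCycleTwist

theorem isCycleOn_finRotate (k : ℕ) : (finRotate k).IsCycleOn Set.univ := by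
  obtain hk | hk := lt_or_ge k 2
  · have : Subsingleton (Fin k) := Fin.subsingleton_iff_le_one.mpr (by omega)
    exact Equiv.Perm.isCycleOn_of_subsingleton _ _
  · have hsupport : {i | finRotate k i ≠ i} = Set.univ := by
      rw [← Equiv.Perm.coe_support_eq_set_support, support_finRotate_of_le hk, coe_univ]
    exact hsupport ▸ (isCycle_finRotate_of_le hk).isCycleOn

theorem mainTheorem4_general (hσ : σ.IsCycleOn Set.univ) (hW : IsVOAModule A YW)
    (hT : IsCycleTwist A k σ YW YT) :
    (∀ Y, IsCycleTwist A k σ YW Y → Y = YT) ∧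
    ∃ YW' : V →ₗ[ℂ] (ℤ → Module.End ℂ (restrictedDual (YW A.conf 1))),
      IsContragredient A.toVertexData 1 YW (restrictedDual (YW A.conf 1)) YW' ∧
      IsVOAModule A YW' ∧
      ∃ YT' : (⨂[ℂ] _ : Fin k, V) →ₗ[ℂ] (ℤ → Module.End ℂ (restrictedDual (YW A.conf 1))),
        IsContragredient (tensorPower A k) k YT (restrictedDual (YW A.conf 1)) YT' ∧
        IsTwistedModule (tensorPower A k) (permAction V σ⁻¹) k YT' ∧
        IsCycleTwist A k σ⁻¹ YW' YT' ∧
        ∀ Y, IsCycleTwist A k σ⁻¹ YW' Y → Y = YT' := by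
  have hid : IsConformalAut A.toVertexData LinearMap.id 1 :=
    ⟨one_pos, one_pow 1, rfl, fun _ _ => rfl⟩
  have hg := permAction_isConformalAut A (NeZero.pos k) (pow_eq_one_of_isCycleOn_univ hσ)
  have hinv : ∀ v, permAction V σ (permAction V σ⁻¹ v) = v := fun v => by
    rw [← Module.End.mul_apply, ← permAction_mul, mul_inv_cancel, permAction_one]
    rfl
  obtain ⟨YW', hYW', hW'⟩ := hW.exists_isContragredient A.isConformal hid (g' := LinearMap.id)
    (D := restrictedDual (YW A.conf 1)) (fun _ => rfl) (by rw [Nat.cast_one])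
  obtain ⟨YT', hYT', hT'⟩ := (hT.isTwistedModule hσ hW).exists_isContragredient
    (tensorPower_isConformal A k) hg hinv (hT.restrictedDual_eq hσ hW.toIsWeakTwistedModule)
  have hC := hT.contragredient hYW' hYT' hT'.toIsWeakTwistedModule
  exact ⟨fun Y hY => hY.unique hσ hT,
    YW', hYW', hW', YT', hYT', hT', hC, fun Y hY => hY.unique hσ.inv hC⟩

end Contragredient

end

/-- If `(W, Y_T)` is `T_g(W)` for `g = (1 2 ⋯ k)` (it is unique), then the contragredient modules `W'` of `W` and
`T_g(W)'` of `T_g(W)` exist, have the same underlying space, are a `V`-module and a `g⁻¹`-twisted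
`V^{⊗k}`-module, respectively, and `T_g(W)'` is the unique twisted module `T_{g⁻¹}(W')`. -/
theorem mainTheorem4 {V W : Type*} [AddCommGroup V] [Module ℂ V] [AddCommGroup W] [Module ℂ W]
    (A : VOA V) (k : ℕ) [NeZero k]
    (YW : V →ₗ[ℂ] (ℤ → Module.End ℂ W)) (hW : IsVOAModule A YW)
    (YT : (⨂[ℂ] _ : Fin k, V) →ₗ[ℂ] (ℤ → Module.End ℂ W))
    (hT : IsCycleTwist A k (finRotate k) YW YT) :
    (∀ Y, IsCycleTwist A k (finRotate k) YW Y → Y = YT) ∧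
    ∃ YW' : V →ₗ[ℂ] (ℤ → Module.End ℂ (restrictedDual (YW A.conf 1))),
      IsContragredient A.toVertexData 1 YW (restrictedDual (YW A.conf 1)) YW' ∧
      IsVOAModule A YW' ∧
      ∃ YT' : (⨂[ℂ] _ : Fin k, V) →ₗ[ℂ] (ℤ → Module.End ℂ (restrictedDual (YW A.conf 1))),
        IsContragredient (tensorPower A k) k YT (restrictedDual (YW A.conf 1)) YT' ∧
        IsTwistedModule (tensorPower A k) (permAction V (finRotate k)⁻¹) k YT' ∧
        IsCycleTwist A k (finRotate k)⁻¹ YW' YT' ∧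
        ∀ Y, IsCycleTwist A k (finRotate k)⁻¹ YW' Y → Y = YT' :=
  mainTheorem4_general (isCycleOn_finRotate k) hW hT
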